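/- Write $\log_2 t=\log\log t$. Let $P^+(n)$ be the largest prime factor of $n$ (with $P^+(1)=1$), $\Omega(n)$ the number of prime factors of $n$ counted with multiplicity, and $\Omega(n,U,T)$ the number of prime factors $p$ of $n$ with $U<p\le T$, counted with multiplicity. Let $\phi$ be Euler's function, $\sigma$ the sum-of-divisors function, and $a_n=(n+1)\log(n+1)-n\log n-1$ for $n\ge1$. For $S\ge 2$, a prime $p$ is called $S$-normal if for both $m=\phi(p)$ and $m=\sigma(p)$ one has $\Omega(m,1,S)\le 2\log_2 S$ and, for all real $U,T$ with $S\le U<T\le m$, $|\Omega(m,U,T)-(\log_2T-\log_2U)|<\sqrt{\log_2S\,\log_2T}$. There are absolute constants $c,C>0$ and $y_0$ such that the following holds for all real $y\ge y_0$. Let $k\ge1$ and $l\ge0$ be integers, let $e^e\le S\le v_k\le v_{k-1}\le\dots\le v_0=y$ be real numbers, and let $1<u_j\le v_j$ for $0\le j\le k-1$. Put $$\delta=\sqrt{\log_2S/\log_2y},\qquad \nu_j=\log_2v_j/\log_2y,\qquad \mu_j=\log_2u_j/\log_2y.$$ Let $d$ be a positive integer with $P^+(d)\le v_k$. Suppose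 that (a) for $2\le j\le k-1$, either $(\mu_j,\nu_j)=(\mu_{j-1},\nu_{j-1})$ or $\nu_j\le\mu_{j-1}-2\delta$; and also $\nu_k\le\mu_{k-1}-2\delta$; (b) for $1\le j\le k-2$, $\nu_j>\nu_{j+2}$. Then the number of solutions of $$(p_0-1)\cdots(p_{k-1}-1)fd=(q_0+1)\cdots(q_{k-1}+1)e\le y$$ in $p_0,\dots,p_{k-1},q_0,\dots,q_{k-1}$ and positive integers $e,f$ satisfying (i) all $p_i$ and $q_i$ are $S$-normal primes; (ii) $u_i\le P^+(p_i-1)\le v_i$ and $u_i\le P^+(q_i+1)\le v_i$ for $0\le i\le k-1$; (iii) neither $\phi\bigl(\prod_{i=0}^{k-1}p_i\bigr)$ nor $\sigma\bigl(\prod_{i=0}^{k-1}q_i\bigr)$ is divisible by $r^2$ for a prime $r\ge v_k$; (iv) $P^+(ef)\le v_k$ and $\Omega(f)\le4l\log_2v_k$; (v) $p_0-1$ has a divisor $\ge y^{1/2}$ all of whose prime factors are $>v_1$; is finite and at most $$C\,\frac yd\,(c\log_2y)^{6k}(k+1)^{\Omega(d)}(\log v_k)^{8(k+l)\log(k+1)+1}(\log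 y)^{-2+\sum_{i=1}^{k-1}a_i\nu_i+E},$$ where $E=\delta\sum_{i=2}^k(i\log i+i)+2\sum_{i=1}^{k-1}(\nu_i-\mu_i)$. -/

import Mathlib

/-- The twice iterated natural logarithm. -/
noncomputable def logLog (x : ℝ) : ℝ := Real.log (Real.log x)

/-- The largest prime factor `P⁺(n)` of `n`, with the convention `P⁺(1) = 1`. -/
def largestPrimeFactor (n : ℕ) : ℕ := max 1 (n.primeFactors.sup id)

open Classical in
/-- `Ω(n, U, T)`: the number of prime factors `p` of `n` with `U < p ≤ T`,
counted with multiplicity. -/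
noncomputable def bigOmegaBetween (n : ℕ) (U T : ℝ) : ℕ :=
  ∑ p ∈ n.primeFactors.filter (fun p : ℕ => U < (p : ℝ) ∧ (p : ℝ) ≤ T), n.factorization p

/-- The two conditions that `S`-normality of a prime `p` imposes on the values
`m = φ(p)` and `m = σ(p)`. -/
def NormalValue (S : ℝ) (m : ℕ) : Prop :=
  (bigOmegaBetween m 1 S : ℝ) ≤ 2 * logLog S ∧
  ∀ U T : ℝ, S ≤ U → U < T → T ≤ (m : ℝ) →
    |(bigOmegaBetween m U T : ℝ) - (logLog T - logLog U)| < Real.sqrt (logLog S * logLog T)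

/-- `S`-normal primes. -/
def IsNormalPrime (S : ℝ) (p : ℕ) : Prop :=
  p.Prime ∧ NormalValue S (Nat.totient p) ∧ NormalValue S (ArithmeticFunction.sigma 1 p)

/-- The coefficients `a_n = (n + 1) log (n + 1) - n log n - 1`. -/
noncomputable def simplexCoeff (n : ℕ) : ℝ :=
  ((n : ℝ) + 1) * Real.log ((n : ℝ) + 1) - (n : ℝ) * Real.log (n : ℝ) - 1

/-- The tuples `(p, q, e, f)` counted by the fundamental sieve estimate: solutions in positive
integers of `(p_0 - 1) ⋯ (p_{k-1} - 1) f d = (q_0 + 1) ⋯ (q_{k-1} + 1) e ≤ y` that satisfy the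
five side conditions. -/
structure IsSieveSolution (y S : ℝ) (k l d : ℕ) (hk : 1 ≤ k) (u v : ℕ → ℝ)
    (p q : Fin k → ℕ) (e f : ℕ) : Prop where
  e_pos : 0 < e
  f_pos : 0 < f
  eqn : (∏ i, (p i - 1)) * f * d = (∏ i, (q i + 1)) * e
  le : (((∏ i, (q i + 1)) * e : ℕ) : ℝ) ≤ y
  normal : ∀ i, IsNormalPrime S (p i) ∧ IsNormalPrime S (q i)
  range_p : ∀ i : Fin k, u i ≤ (largestPrimeFactor (p i - 1) : ℝ) ∧
    (largestPrimeFactor (p i - 1) : ℝ) ≤ v i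
  range_q : ∀ i : Fin k, u i ≤ (largestPrimeFactor (q i + 1) : ℝ) ∧
    (largestPrimeFactor (q i + 1) : ℝ) ≤ v i
  squarefree : ∀ r : ℕ, r.Prime → v k ≤ (r : ℝ) →
    ¬ r ^ 2 ∣ Nat.totient (∏ i, p i) ∧ ¬ r ^ 2 ∣ ArithmeticFunction.sigma 1 (∏ i, q i)
  smooth : (largestPrimeFactor (e * f) : ℝ) ≤ v k
  omega_f : (ArithmeticFunction.cardFactors f : ℝ) ≤ 4 * (l : ℝ) * logLog (v k)
  rough : ∃ b : ℕ, b ∣ p ⟨0, hk⟩ - 1 ∧ y ^ (1 / 2 : ℝ) ≤ (b : ℝ) ∧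
    ∀ r : ℕ, r.Prime → r ∣ b → v 1 < (r : ℝ)

/-- The set of all solutions `(p, q, e, f)`. -/
def sieveSolutions (y S : ℝ) (k l d : ℕ) (hk : 1 ≤ k) (u v : ℕ → ℝ) :
    Set ((Fin k → ℕ) × (Fin k → ℕ) × ℕ × ℕ) :=
  {t | IsSieveSolution y S k l d hk u v t.1 t.2.1 t.2.2.1 t.2.2.2}

/-! Call a prime rough if it exceeds v_k, put a_i = p_i - 1 and b_i = q_i + 1, and call the largest
prime factors of the a_i and b_i special. Solutions are sorted by a code, an upper bound sieve
counts those with a given code, and the bounds are summed over all codes.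

Structure. Condition (iii), the windows and the smoothness of d, e, f imply that entries on one side
sharing a rough prime are equal, that no entry is divisible by the square of a rough prime, and that
a rough prime dividing an entry on one side divides an entry on the other (`HalfStructure`). By (v)
the special prime of a_0 exceeds v_1, so it is also that of b_0 and is larger than all the others
(`SieveConfig`).

One code. The code records e, f and the v_k-smooth parts of the entries, for each rough non-special
prime an entry on each side that it divides, and the relative position of the special primes. Given
the code, the special primes are revealed in increasing order. Once the smaller ones are known, an
entry whose largest prime is the next one, t, is known up to that factor (`SameCode.div_top_eq`), so
t satisfies "At + 1 is prime" or "Bt - 1 is prime" with A, B fixed. Selberg's sieve then makes the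
sum over t cost about (log log y)^2 / log u_i for each entry concerned. The largest special prime is
prime together with both At + 1 and Bt - 1, which saves (log y)^3 up to powers of log log y. The
result is `exists_card_code_fiber_le`.

Sum over codes. The smooth parts contribute an Euler product times a number of factorizations into k
+ 1 parts (`exists_sum_low_le`). A rough prime r in (v_{j+1}, v_j] divides only entries of index at
most j, so it has at most (j+1)^2 assignments, of weight 1/r. Normality allows about (j+1)(ν_j -
ν_{j+1} + δ) log log y such primes in one solution. Hence one factor j+1 per prime can be extracted
at the cost of an exponent (j+1) log(j+1), while the other factor leaves ∏(1 + (j+1)/r), of exponent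
j+1 by Mertens (`sum_prod_assignments_le`).

Exponents. Window j thus carries the weight w_{j+1} with w_n = n log n + n, and w_{n+1} - w_n =
`simplexCoeff n` + 2. Summation by parts gives 1 + ∑ (`simplexCoeff i` + 2) ν_i; the sieve
contributes -3 and -2 ∑ μ_i. Together this is the stated exponent. The at most (2k)^(4k) patterns of
special primes are harmless because ν drops by 2δ every two steps, which forces k^2 ≤ 9 log log y.
-/

/-! ### Estimates of Chebyshev and Mertens type. -/

theorem log_factorial_eq_sum_primes (N : ℕ) :
    Real.log (N.factorial : ℝ) =
      ∑ p ∈ Nat.primesLE N, (N.factorial.factorization p : ℝ) * Real.log p := by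
  have h := Nat.prod_factorization_pow_eq_self (Nat.factorial_ne_zero N)
  have hsupp : N.factorial.factorization.support ⊆ Nat.primesLE N := by
    intro p hp
    rw [Nat.support_factorization, Nat.mem_primeFactors] at hp
    rw [Nat.mem_primesLE]
    exact ⟨(hp.1.dvd_factorial).1 hp.2.1, hp.1⟩
  rw [Finsupp.prod_of_support_subset _ hsupp _ (by simp)] at h
  conv_lhs => rw [← h]
  push_cast
  rw [Real.log_prod]
  · exact Finset.sum_congr rfl fun p _ => Real.log_pow _ _
  · intro p hp
    exact pow_ne_zero _ (Nat.cast_ne_zero.2 (Nat.mem_primesLE.1 hp).2.ne_zero)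

/-- The exponent of p in N! is at least N/p - 1, while log N! ≤ N log N. The subtracted terms add up
to θ(N), which Chebyshev bounds by N log 4. -/
theorem sum_log_div_prime_le (N : ℕ) (hN : 1 ≤ N) :
    ∑ p ∈ Nat.primesLE N, Real.log p / p ≤ Real.log N + Real.log 4 := by
  have hNpos : (0 : ℝ) < N := by exact_mod_cast hN
  have h1 : Real.log (N.factorial : ℝ) ≤ N * Real.log N := by
    rw [← Real.log_pow]
    exact Real.log_le_log (by exact_mod_cast Nat.factorial_pos N)
      (by exact_mod_cast Nat.factorial_le_pow N)
  have h2 := Chebyshev.theta_le_log4_mul_x (x := N) hNpos.le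
  rw [Chebyshev.theta_eq_sum_primesLE_log] at h2
  have h3 : ∑ p ∈ Nat.primesLE N, ((N : ℝ) * (Real.log p / p) - Real.log p) ≤
      Real.log (N.factorial : ℝ) := by
    rw [log_factorial_eq_sum_primes]
    refine Finset.sum_le_sum fun p hp => ?_
    have hp' := (Nat.mem_primesLE.1 hp)
    have hppos : (0 : ℝ) < p := by exact_mod_cast hp'.2.pos
    have hlog : 0 ≤ Real.log p := Real.log_natCast_nonneg p
    have hv : N / p ≤ N.factorial.factorization p := by
      rw [Nat.factorization_factorial hp'.2 (b := Nat.log p N + 2) (by omega)]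
      calc N / p = ∑ i ∈ ({1} : Finset ℕ), N / p ^ i := by simp
        _ ≤ _ := Finset.sum_le_sum_of_subset (by
          intro i hi; simp at hi; subst hi; simp)
    have hdiv : (N : ℝ) / p - 1 ≤ (N.factorial.factorization p : ℝ) := by
      have : (N : ℝ) / p < ((N / p : ℕ) : ℝ) + 1 := by
        rw [div_lt_iff₀ hppos]
        exact_mod_cast (Nat.div_lt_iff_lt_mul hp'.2.pos).1 (Nat.lt_succ_self (N / p))
      have : ((N / p : ℕ) : ℝ) ≤ (N.factorial.factorization p : ℝ) := by exact_mod_cast hv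
      linarith
    calc (N : ℝ) * (Real.log p / p) - Real.log p = ((N : ℝ) / p - 1) * Real.log p := by ring
      _ ≤ _ := mul_le_mul_of_nonneg_right hdiv hlog
  rw [Finset.sum_sub_distrib, ← Finset.mul_sum] at h3
  have : (N : ℝ) * ∑ p ∈ Nat.primesLE N, Real.log p / p ≤ N * (Real.log N + Real.log 4) := by
    linarith
  exact le_of_mul_le_mul_left this hNpos

theorem exists_sum_log_div_mul_pred_le :
    ∃ C : ℝ, 0 ≤ C ∧ ∀ s : Finset ℕ, (∀ p ∈ s, Nat.Prime p) →
      ∑ p ∈ s, Real.log p / ((p : ℝ) * (p - 1)) ≤ C := by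
  have hs : Summable fun n : ℕ => 4 * (1 / (n : ℝ) ^ (3 / 2 : ℝ)) :=
    (Real.summable_one_div_nat_rpow.2 (by norm_num)).mul_left 4
  refine ⟨∑' n : ℕ, 4 * (1 / (n : ℝ) ^ (3 / 2 : ℝ)), tsum_nonneg fun n => by positivity, ?_⟩
  intro s hsp
  refine le_trans (Finset.sum_le_sum fun p hp => ?_) (hs.sum_le_tsum s fun n _ => by positivity)
  have hp2 : (2 : ℝ) ≤ p := by exact_mod_cast (hsp p hp).two_le
  have hp0 : (0 : ℝ) < p := by linarith
  have hlog : Real.log p ≤ 2 * (p : ℝ) ^ (1 / 2 : ℝ) := by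
    have := Real.log_le_rpow_div hp0.le (ε := 1 / 2) (by norm_num)
    linarith
  have hsplit : (p : ℝ) ^ (3 / 2 : ℝ) * (p : ℝ) ^ (1 / 2 : ℝ) = p * p := by
    rw [← Real.rpow_add hp0]; norm_num; ring
  have h32 : 0 < (p : ℝ) ^ (3 / 2 : ℝ) := by positivity
  rw [mul_one_div, div_le_div_iff₀ (by nlinarith) h32]
  calc Real.log p * (p : ℝ) ^ (3 / 2 : ℝ)
      ≤ 2 * (p : ℝ) ^ (1 / 2 : ℝ) * (p : ℝ) ^ (3 / 2 : ℝ) := by gcongr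
    _ = 2 * (p * p) := by rw [← hsplit]; ring
    _ ≤ 4 * (p * (p - 1)) := by nlinarith

/-- Stirling from below against the bound N/(p - 1) for the exponent of p in N!. Since 1/(p-1) = 1/p
+ 1/(p(p-1)), the excess is a convergent sum. -/
theorem exists_le_sum_log_div_prime :
    ∃ C : ℝ, 0 ≤ C ∧ ∀ N : ℕ, 1 ≤ N →
      Real.log N - C ≤ ∑ p ∈ Nat.primesLE N, Real.log p / p := by
  obtain ⟨C, hC, hb⟩ := exists_sum_log_div_mul_pred_le
  refine ⟨C + 1, by linarith, fun N hN => ?_⟩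
  have hNpos : (0 : ℝ) < N := by exact_mod_cast hN
  have h1 : N * Real.log N - N ≤ Real.log (N.factorial : ℝ) := by
    have h := Stirling.le_log_factorial_stirling (n := N) (by omega)
    have : 0 ≤ Real.log N := Real.log_natCast_nonneg N
    have : 0 ≤ Real.log (2 * Real.pi) := Real.log_nonneg (by nlinarith [Real.pi_gt_three])
    linarith
  have h3 : Real.log (N.factorial : ℝ) ≤
      ∑ p ∈ Nat.primesLE N, (N : ℝ) * (Real.log p / p + Real.log p / ((p : ℝ) * (p - 1))) := by
    rw [log_factorial_eq_sum_primes]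
    refine Finset.sum_le_sum fun p hp => ?_
    have hp' := (Nat.mem_primesLE.1 hp)
    have hp2 : (2 : ℝ) ≤ p := by exact_mod_cast hp'.2.two_le
    have hlog : 0 ≤ Real.log p := Real.log_natCast_nonneg p
    have hv : (N.factorial.factorization p : ℝ) ≤ N / (p - 1) := by
      have h := Nat.factorization_factorial_le_div_pred hp'.2 N
      calc (N.factorial.factorization p : ℝ) ≤ ((N / (p - 1) : ℕ) : ℝ) := by exact_mod_cast h
        _ ≤ (N : ℝ) / ((p - 1 : ℕ) : ℝ) := Nat.cast_div_le
        _ = _ := by rw [Nat.cast_sub hp'.2.one_le, Nat.cast_one]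
    calc (N.factorial.factorization p : ℝ) * Real.log p ≤ N / (p - 1) * Real.log p := by gcongr
      _ = _ := by
        have : (p : ℝ) - 1 ≠ 0 := by linarith
        have : (p : ℝ) ≠ 0 := by linarith
        field_simp
        ring
  rw [← Finset.mul_sum, Finset.sum_add_distrib] at h3
  have h4 := hb (Nat.primesLE N) fun p hp => (Nat.mem_primesLE.1 hp).2
  have : (N : ℝ) * (Real.log N - 1) ≤ N * (∑ p ∈ Nat.primesLE N, Real.log p / p + C) := by
    calc (N : ℝ) * (Real.log N - 1) = N * Real.log N - N := by ring
      _ ≤ _ := h1.trans h3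
      _ ≤ _ := by gcongr
  have := le_of_mul_le_mul_left this hNpos
  linarith

/-- Abel summation of (log p)/p against 1/log t. The upper bound for the summatory function enters
at T and under the integral, the lower bound at U. -/
theorem exists_sum_one_div_prime_Ioc_le :
    ∃ C : ℝ, 0 ≤ C ∧ ∀ U T : ℝ, Real.exp 1 ≤ U → U ≤ T →
      ∑ p ∈ (Finset.Ioc ⌊U⌋₊ ⌊T⌋₊).filter Nat.Prime, 1 / (p : ℝ) ≤
        logLog T - logLog U + C := by
  obtain ⟨C, hC, hlow⟩ := exists_le_sum_log_div_prime
  have h4 : 0 ≤ Real.log 4 := Real.log_nonneg (by norm_num)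
  refine ⟨1 + C + Real.log 4, by positivity, fun U T hU hUT => ?_⟩
  have he : (1 : ℝ) < Real.exp 1 := by simp
  have hU0 : 0 < U := by linarith
  have hlogU : 1 ≤ Real.log U := by
    rw [Real.le_log_iff_exp_le hU0]; exact hU
  have hlog : ∀ t, U ≤ t → 1 ≤ Real.log t := fun t ht =>
    hlogU.trans (Real.log_le_log hU0 ht)
  set c : ℕ → ℝ := fun k => if k.Prime then Real.log k / k else 0 with hc
  set A : ℝ → ℝ := fun t => ∑ k ∈ Finset.Icc 0 ⌊t⌋₊, c k with hA
  have hAeq : ∀ t, A t = ∑ p ∈ Nat.primesLE ⌊t⌋₊, Real.log p / p := by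
    intro t
    rw [Nat.primesLE_eq_filter_Icc_zero, Finset.sum_filter]
  have hAle : ∀ t, U ≤ t → A t ≤ Real.log t + Real.log 4 := by
    intro t ht
    have hft : 1 ≤ ⌊t⌋₊ := Nat.le_floor (by push_cast; linarith)
    rw [hAeq]
    refine (sum_log_div_prime_le _ hft).trans ?_
    gcongr
    exact Nat.floor_le (by linarith)
  have hAge : Real.log U - 1 - C ≤ A U := by
    have hft : 1 ≤ ⌊U⌋₊ := Nat.le_floor (by push_cast; linarith)
    rw [hAeq]
    refine le_trans ?_ (hlow _ hft)
    have h1 : U < ⌊U⌋₊ + 1 := Nat.lt_floor_add_one U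
    have h2 : (1 : ℝ) ≤ ⌊U⌋₊ := by exact_mod_cast hft
    have h3 : Real.log U ≤ Real.log (Real.exp 1 * ⌊U⌋₊) := by
      refine Real.log_le_log hU0 ?_
      nlinarith [Real.add_one_le_exp (1 : ℝ)]
    rw [Real.log_mul (by positivity) (by positivity), Real.log_exp] at h3
    linarith
  have hderiv : ∀ t, U ≤ t → HasDerivAt (fun t => (Real.log t)⁻¹) (-(t⁻¹) / Real.log t ^ 2) t := by
    intro t ht
    exact (Real.hasDerivAt_log (by linarith)).inv (by have := hlog t ht; linarith)
  have hcont : ContinuousOn (fun t : ℝ => -(t⁻¹) / Real.log t ^ 2) (Set.Icc U T) := by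
    have h1 : ∀ t ∈ Set.Icc U T, t ≠ 0 := fun t ht => by have := ht.1; linarith
    have h2 : ∀ t ∈ Set.Icc U T, Real.log t ^ 2 ≠ 0 := fun t ht => by
      have := hlog t ht.1; positivity
    exact ((continuousOn_inv₀.mono h1).neg).div
      ((Real.continuousOn_log.mono h1).pow 2) h2
  have hint : MeasureTheory.IntegrableOn (deriv fun t : ℝ => (Real.log t)⁻¹) (Set.Icc U T) := by
    refine (hcont.integrableOn_Icc).congr_fun (fun t ht => ?_) measurableSet_Icc
    exact ((hderiv t ht.1).deriv).symm
  have habel := sum_mul_eq_sub_sub_integral_mul c (f := fun t : ℝ => (Real.log t)⁻¹)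
    hU0.le hUT (fun t ht => (hderiv t ht.1).differentiableAt) hint
  have hprod : MeasureTheory.IntegrableOn
      (fun t => deriv (fun t : ℝ => (Real.log t)⁻¹) t * A t) (Set.Icc U T) :=
    integrableOn_mul_sum_Icc c hU0.le hint
  -- An explicit antiderivative of (log t + log 4)/(t log² t), the majorant of the integrand.
  have hG : ∀ t, U ≤ t → HasDerivAt (fun t => logLog t - Real.log 4 * (Real.log t)⁻¹)
      (t⁻¹ / Real.log t - Real.log 4 * (-(t⁻¹) / Real.log t ^ 2)) t := by
    intro t ht
    have hl := hlog t ht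
    exact ((Real.hasDerivAt_log (by linarith)).log (by linarith)).sub
      ((hderiv t ht).const_mul _)
  have hgcont : ContinuousOn
      (fun t : ℝ => t⁻¹ / Real.log t - Real.log 4 * (-(t⁻¹) / Real.log t ^ 2)) (Set.Icc U T) := by
    have h1 : ∀ t ∈ Set.Icc U T, t ≠ 0 := fun t ht => by have := ht.1; linarith
    have h2 : ∀ t ∈ Set.Icc U T, Real.log t ≠ 0 := fun t ht => by
      have := hlog t ht.1; positivity
    exact ((continuousOn_inv₀.mono h1).div (Real.continuousOn_log.mono h1) h2).sub
      (hcont.const_smul (Real.log 4))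
  have hFTC : ∫ t in Set.Ioc U T, (t⁻¹ / Real.log t - Real.log 4 * (-(t⁻¹) / Real.log t ^ 2)) =
      (logLog T - Real.log 4 * (Real.log T)⁻¹) - (logLog U - Real.log 4 * (Real.log U)⁻¹) := by
    rw [← intervalIntegral.integral_of_le hUT]
    refine intervalIntegral.integral_eq_sub_of_hasDerivAt
      (f := fun t => logLog t - Real.log 4 * (Real.log t)⁻¹) (fun t ht => ?_) ?_
    · rw [Set.uIcc_of_le hUT] at ht
      exact hG t ht.1
    · rw [← Set.uIcc_of_le hUT] at hgcont
      exact hgcont.intervalIntegrable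
  have hmono : -∫ t in Set.Ioc U T, deriv (fun t : ℝ => (Real.log t)⁻¹) t * A t ≤
      ∫ t in Set.Ioc U T, (t⁻¹ / Real.log t - Real.log 4 * (-(t⁻¹) / Real.log t ^ 2)) := by
    rw [← MeasureTheory.integral_neg]
    refine MeasureTheory.setIntegral_mono_on (hprod.mono_set Set.Ioc_subset_Icc_self).neg
      (hgcont.integrableOn_Icc.mono_set Set.Ioc_subset_Icc_self) measurableSet_Ioc fun t ht => ?_
    have hl := hlog t ht.1.le
    have ht0 : 0 < t := by linarith [ht.1]
    rw [(hderiv t ht.1.le).deriv]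
    calc -(-(t⁻¹) / Real.log t ^ 2 * A t) = t⁻¹ / Real.log t ^ 2 * A t := by ring
      _ ≤ t⁻¹ / Real.log t ^ 2 * (Real.log t + Real.log 4) := by
        gcongr; exact hAle t ht.1.le
      _ = _ := by field_simp; ring
  have hsum : ∑ p ∈ (Finset.Ioc ⌊U⌋₊ ⌊T⌋₊).filter Nat.Prime, 1 / (p : ℝ) =
      ∑ k ∈ Finset.Ioc ⌊U⌋₊ ⌊T⌋₊, (Real.log k)⁻¹ * c k := by
    rw [Finset.sum_filter]
    refine Finset.sum_congr rfl fun k _ => ?_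
    by_cases hk : k.Prime
    · have : Real.log k ≠ 0 := (Real.log_pos (by exact_mod_cast hk.one_lt)).ne'
      have : (k : ℝ) ≠ 0 := by exact_mod_cast hk.ne_zero
      simp only [hc, if_pos hk]
      field_simp
    · simp [hc, hk]
  rw [hsum, habel]
  have hT : (Real.log T)⁻¹ * A T ≤ 1 + Real.log 4 * (Real.log T)⁻¹ := by
    have hl := hlog T hUT
    calc (Real.log T)⁻¹ * A T ≤ (Real.log T)⁻¹ * (Real.log T + Real.log 4) := by
          gcongr; exact hAle T hUT
      _ = _ := by field_simp
  have hU1 : 1 - (1 + C) * (Real.log U)⁻¹ ≤ (Real.log U)⁻¹ * A U := by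
    calc 1 - (1 + C) * (Real.log U)⁻¹ = (Real.log U)⁻¹ * (Real.log U - 1 - C) := by
          field_simp; ring
      _ ≤ _ := by gcongr
  have hinv : (Real.log U)⁻¹ ≤ 1 := inv_le_one_of_one_le₀ hlogU
  have : (1 + C + Real.log 4) * (Real.log U)⁻¹ ≤ (1 + C + Real.log 4) * 1 := by gcongr
  linarith

theorem exists_sum_one_div_mul_pred_le :
    ∃ C : ℝ, 0 ≤ C ∧ ∀ s : Finset ℕ, (∀ p ∈ s, Nat.Prime p) →
      ∑ p ∈ s, 1 / ((p : ℝ) * (p - 1)) ≤ C := by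
  obtain ⟨C, hC, h⟩ := exists_sum_log_div_mul_pred_le
  have h2 : 0 < Real.log 2 := Real.log_pos (by norm_num)
  refine ⟨C / Real.log 2, by positivity, fun s hs => ?_⟩
  rw [le_div_iff₀ h2, Finset.sum_mul]
  refine le_trans (Finset.sum_le_sum fun p hp => ?_) (h s hs)
  have hp2 : (2 : ℝ) ≤ p := by exact_mod_cast (hs p hp).two_le
  rw [div_mul_eq_mul_div, one_mul]
  have : 0 < (p : ℝ) * (p - 1) := by nlinarith
  gcongr

theorem inv_one_sub_inv_le_exp {p : ℕ} (hp : p.Prime) :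
    (1 - (p : ℝ)⁻¹)⁻¹ ≤ Real.exp (1 / p + 1 / ((p : ℝ) * (p - 1))) := by
  have hp2 : (2 : ℝ) ≤ p := by exact_mod_cast hp.two_le
  have h1 : (p : ℝ) - 1 ≠ 0 := by linarith
  have h2 : (p : ℝ) ≠ 0 := by linarith
  have : (1 - (p : ℝ)⁻¹)⁻¹ = (1 / p + 1 / ((p : ℝ) * (p - 1))) + 1 := by
    field_simp
    ring
  rw [this]
  exact Real.add_one_le_exp _

theorem inv_one_sub_inv_prime_pos {p : ℕ} (hp : p.Prime) : 0 < (1 - (p : ℝ)⁻¹)⁻¹ := by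
  have hp2 : (1 : ℝ) < p := by exact_mod_cast hp.one_lt
  exact inv_pos.2 (sub_pos.2 (inv_lt_one_of_one_lt₀ hp2))

theorem one_le_inv_one_sub_inv_prime {p : ℕ} (hp : p.Prime) : 1 ≤ (1 - (p : ℝ)⁻¹)⁻¹ := by
  have hp2 : (1 : ℝ) < p := by exact_mod_cast hp.one_lt
  refine (one_le_inv₀ (sub_pos.2 (inv_lt_one_of_one_lt₀ hp2))).2 ?_
  have : 0 < (p : ℝ)⁻¹ := by positivity
  linarith

/-- Upper bound in Mertens' third theorem. -/
theorem exists_prod_primesLE_inv_one_sub_inv_le :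
    ∃ C : ℝ, 0 < C ∧ ∀ x : ℝ, Real.exp 1 ≤ x →
      ∏ p ∈ Nat.primesLE ⌊x⌋₊, (1 - (p : ℝ)⁻¹)⁻¹ ≤ C * Real.log x := by
  obtain ⟨C₁, hC₁, h₁⟩ := exists_sum_one_div_prime_Ioc_le
  obtain ⟨C₂, hC₂, h₂⟩ := exists_sum_one_div_mul_pred_le
  set B : ℝ := ∑ p ∈ Nat.primesLE ⌊Real.exp 1⌋₊, 1 / (p : ℝ) with hB
  refine ⟨Real.exp (B + C₁ + C₂), Real.exp_pos _, fun x hx => ?_⟩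
  have hx0 : 0 < x := (Real.exp_pos 1).trans_le hx
  have hlog : 1 ≤ Real.log x := by rw [Real.le_log_iff_exp_le hx0]; exact hx
  have hsplit : ∑ p ∈ Nat.primesLE ⌊x⌋₊, 1 / (p : ℝ) =
      B + ∑ p ∈ (Finset.Ioc ⌊Real.exp 1⌋₊ ⌊x⌋₊).filter Nat.Prime, 1 / (p : ℝ) := by
    rw [hB, Nat.primesLE_eq_filter_Ioc_zero, Nat.primesLE_eq_filter_Ioc_zero,
      ← Finset.sum_union]
    · rw [← Finset.filter_union, Finset.Ioc_union_Ioc_eq_Ioc (Nat.zero_le _)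
        (Nat.floor_le_floor hx)]
    · refine Finset.disjoint_filter_filter (Finset.disjoint_left.2 fun a ha hb => ?_)
      rw [Finset.mem_Ioc] at ha hb
      omega
  have h3 := h₁ (Real.exp 1) x le_rfl hx
  have h4 := h₂ (Nat.primesLE ⌊x⌋₊) fun p hp => (Nat.mem_primesLE.1 hp).2
  have hee : logLog (Real.exp 1) = 0 := by simp [logLog]
  calc ∏ p ∈ Nat.primesLE ⌊x⌋₊, (1 - (p : ℝ)⁻¹)⁻¹
      ≤ ∏ p ∈ Nat.primesLE ⌊x⌋₊, Real.exp (1 / p + 1 / ((p : ℝ) * (p - 1))) := by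
        refine Finset.prod_le_prod (fun p hp => ?_) fun p hp => ?_
        · exact (inv_one_sub_inv_prime_pos (Nat.mem_primesLE.1 hp).2).le
        · exact inv_one_sub_inv_le_exp (Nat.mem_primesLE.1 hp).2
    _ = Real.exp (∑ p ∈ Nat.primesLE ⌊x⌋₊, (1 / (p : ℝ) + 1 / ((p : ℝ) * (p - 1)))) :=
        (Real.exp_sum _ _).symm
    _ ≤ Real.exp (B + C₁ + C₂ + logLog x) := by
        rw [Finset.sum_add_distrib, hsplit]
        refine Real.exp_le_exp.2 ?_
        linarith
    _ = _ := by
        rw [Real.exp_add, logLog, Real.exp_log (by linarith)]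

theorem card_primeFactors_mul_log_two_le (n : ℕ) (hn : n ≠ 0) :
    (n.primeFactors.card : ℝ) * Real.log 2 ≤ Real.log n := by
  rw [← Real.log_pow]
  refine Real.log_le_log (by positivity) ?_
  have h1 : 2 ^ n.primeFactors.card ≤ ∏ p ∈ n.primeFactors, p := by
    rw [← Finset.prod_const]
    exact Finset.prod_le_prod' fun p hp => (Nat.prime_of_mem_primeFactors hp).two_le
  exact_mod_cast h1.trans (Nat.le_of_dvd (Nat.pos_of_ne_zero hn) (Nat.prod_primeFactors_dvd n))

/-- The classical bound for n/φ(n). Primes up to L are handled by Mertens; at most log n / log 2 ≤ L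
/ log 2 prime factors are larger, and each contributes at most exp(2/L), a bounded total. -/
theorem exists_prod_primeFactors_inv_one_sub_inv_le :
    ∃ C : ℝ, 0 < C ∧ ∀ (n : ℕ) (L : ℝ), n ≠ 0 → Real.exp 1 ≤ L → Real.log n ≤ L →
      ∏ p ∈ n.primeFactors, (1 - (p : ℝ)⁻¹)⁻¹ ≤ C * Real.log L := by
  obtain ⟨C, hC, h⟩ := exists_prod_primesLE_inv_one_sub_inv_le
  have h2 : 0 < Real.log 2 := Real.log_pos (by norm_num)
  refine ⟨C * Real.exp (2 / Real.log 2), by positivity, fun n L hn hL hnL => ?_⟩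
  have hL0 : 0 < L := (Real.exp_pos 1).trans_le hL
  have hL2 : 2 ≤ L := by linarith [Real.add_one_le_exp (1 : ℝ)]
  rw [← Finset.prod_filter_mul_prod_filter_not n.primeFactors (fun p : ℕ => (p : ℝ) ≤ L)]
  have hsmall : ∏ p ∈ n.primeFactors.filter (fun p : ℕ => (p : ℝ) ≤ L), (1 - (p : ℝ)⁻¹)⁻¹ ≤
      C * Real.log L := by
    refine le_trans (Finset.prod_le_prod_of_subset_of_one_le (s := _) ?_ ?_ ?_) (h L hL)
    · intro p hp
      rw [Finset.mem_filter] at hp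
      exact Nat.mem_primesLE.2 ⟨Nat.le_floor hp.2, Nat.prime_of_mem_primeFactors hp.1⟩
    · intro p hp
      exact (inv_one_sub_inv_prime_pos
        (Nat.prime_of_mem_primeFactors (Finset.mem_filter.1 hp).1)).le
    · intro p hp _
      exact one_le_inv_one_sub_inv_prime (Nat.mem_primesLE.1 hp).2
  have hlarge : ∏ p ∈ n.primeFactors.filter (fun p : ℕ => ¬(p : ℝ) ≤ L), (1 - (p : ℝ)⁻¹)⁻¹ ≤
      Real.exp (2 / Real.log 2) := by
    calc ∏ p ∈ n.primeFactors.filter (fun p : ℕ => ¬(p : ℝ) ≤ L), (1 - (p : ℝ)⁻¹)⁻¹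
        ≤ ∏ p ∈ n.primeFactors.filter (fun p : ℕ => ¬(p : ℝ) ≤ L), Real.exp (2 / L) := by
          refine Finset.prod_le_prod (fun p hp => ?_) fun p hp => ?_
          · exact (inv_one_sub_inv_prime_pos
              (Nat.prime_of_mem_primeFactors (Finset.mem_filter.1 hp).1)).le
          · rw [Finset.mem_filter, not_le] at hp
            refine (inv_one_sub_inv_le_exp (Nat.prime_of_mem_primeFactors hp.1)).trans ?_
            gcongr
            have hp1 : (1 : ℝ) < p - 1 := by linarith
            calc 1 / (p : ℝ) + 1 / ((p : ℝ) * (p - 1)) ≤ 1 / L + 1 / (L * 1) := by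
                  gcongr
                  · exact hp.2.le
                  · exact hp.2.le
              _ = _ := by ring
      _ = Real.exp ((n.primeFactors.filter (fun p : ℕ => ¬(p : ℝ) ≤ L)).card * (2 / L)) := by
          rw [Finset.prod_const, ← Real.exp_nat_mul]
      _ ≤ _ := by
          gcongr
          have hc : ((n.primeFactors.filter (fun p : ℕ => ¬(p : ℝ) ≤ L)).card : ℝ) ≤
              n.primeFactors.card := by
            exact_mod_cast Finset.card_filter_le _ _
          have := card_primeFactors_mul_log_two_le n hn
          rw [mul_div_assoc', div_le_div_iff₀ hL0 h2]
          nlinarith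
  calc _ ≤ (C * Real.log L) * Real.exp (2 / Real.log 2) := by
        refine mul_le_mul hsmall hlarge (Finset.prod_nonneg fun p hp => ?_) ?_
        · exact (inv_one_sub_inv_prime_pos
            (Nat.prime_of_mem_primeFactors (Finset.mem_filter.1 hp).1)).le
        · have : 0 ≤ Real.log L := Real.log_nonneg (by linarith)
          positivity
    _ = _ := by ring

/-! ### Reciprocal sums over integers with restricted prime factors. -/

/-- The monoid homomorphism `n ↦ n⁻¹`. -/
noncomputable def natInvHom : ℕ →* ℝ where
  toFun n := (n : ℝ)⁻¹
  map_one' := by simp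
  map_mul' m n := by push_cast; rw [mul_inv]

theorem sum_inv_factoredNumbers_le (P s : Finset ℕ) (hP : ∀ p ∈ P, Nat.Prime p)
    (hs : ∀ n ∈ s, n ∈ Nat.factoredNumbers P) :
    ∑ n ∈ s, (n : ℝ)⁻¹ ≤ ∏ p ∈ P, (1 - (p : ℝ)⁻¹)⁻¹ := by
  have h := EulerProduct.summable_and_hasSum_factoredNumbers_prod_filter_prime_geometric
    (f := natInvHom) (fun {p} hp => by
      have : (1 : ℝ) < p := by exact_mod_cast hp.one_lt
      simpa [natInvHom] using inv_lt_one_of_one_lt₀ this) P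
  rw [Finset.filter_true_of_mem hP] at h
  have hsum := h.2.summable
  rw [show (∏ p ∈ P, (1 - (p : ℝ)⁻¹)⁻¹) = ∑' m : Nat.factoredNumbers P, natInvHom (m : ℕ) from
    h.2.tsum_eq.symm]
  classical
  have := hsum.sum_le_tsum (s.subtype fun n => n ∈ Nat.factoredNumbers P)
    (fun n _ => by simp only [natInvHom, MonoidHom.coe_mk, OneHom.coe_mk]; positivity)
  refine le_trans (le_of_eq ?_) this
  rw [Finset.sum_subtype_of_mem (fun n : ℕ => natInvHom n) hs]
  rfl

theorem exists_sum_inv_smooth_le :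
    ∃ C : ℝ, 0 < C ∧ ∀ (V : ℝ) (s : Finset ℕ), Real.exp 1 ≤ V →
      (∀ n ∈ s, n ≠ 0 ∧ ∀ p : ℕ, p.Prime → p ∣ n → (p : ℝ) ≤ V) →
      ∑ n ∈ s, (n : ℝ)⁻¹ ≤ C * Real.log V := by
  obtain ⟨C, hC, h⟩ := exists_prod_primesLE_inv_one_sub_inv_le
  refine ⟨C, hC, fun V s hV hs => (sum_inv_factoredNumbers_le (Nat.primesLE ⌊V⌋₊) s
    (fun p hp => (Nat.mem_primesLE.1 hp).2) fun n hn => ?_).trans (h V hV)⟩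
  rw [Nat.mem_factoredNumbers']
  intro p hp hpn
  exact Nat.mem_primesLE.2 ⟨Nat.le_floor ((hs n hn).2 p hp hpn), hp⟩

/-- Divide n by the product of D: the quotient is supported on D, so Euler's product applies, and
p⁻¹ (1 - p⁻¹)⁻¹ = (p - 1)⁻¹. -/
theorem sum_inv_primeFactors_eq_le (D s : Finset ℕ) (hD : ∀ p ∈ D, Nat.Prime p)
    (hs : ∀ n ∈ s, n ≠ 0 ∧ n.primeFactors = D) :
    ∑ n ∈ s, (n : ℝ)⁻¹ ≤ ∏ p ∈ D, ((p : ℝ) - 1)⁻¹ := by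
  set P : ℕ := ∏ p ∈ D, p with hP
  have hP0 : P ≠ 0 := Finset.prod_ne_zero_iff.2 fun p hp => (hD p hp).ne_zero
  have hdvd : ∀ n ∈ s, P ∣ n := fun n hn => by
    rw [hP, ← (hs n hn).2]; exact Nat.prod_primeFactors_dvd n
  have hinj : Set.InjOn (fun n => n / P) s := by
    intro a ha b hb hab
    obtain ⟨x, rfl⟩ := hdvd a ha
    obtain ⟨z, rfl⟩ := hdvd b hb
    simp only [Nat.mul_div_cancel_left _ (Nat.pos_of_ne_zero hP0)] at hab
    rw [hab]
  have h1 : ∑ n ∈ s, (n : ℝ)⁻¹ = (P : ℝ)⁻¹ * ∑ m ∈ s.image fun n => n / P, (m : ℝ)⁻¹ := by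
    rw [Finset.sum_image hinj, Finset.mul_sum]
    refine Finset.sum_congr rfl fun n hn => ?_
    obtain ⟨x, rfl⟩ := hdvd n hn
    rw [Nat.mul_div_cancel_left _ (Nat.pos_of_ne_zero hP0)]
    push_cast
    rw [mul_inv]
  have h2 : ∏ p ∈ D, ((p : ℝ) - 1)⁻¹ = (P : ℝ)⁻¹ * ∏ p ∈ D, (1 - (p : ℝ)⁻¹)⁻¹ := by
    rw [hP, Nat.cast_prod, ← Finset.prod_inv_distrib, ← Finset.prod_mul_distrib]
    refine Finset.prod_congr rfl fun p hp => ?_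
    have : (p : ℝ) ≠ 0 := Nat.cast_ne_zero.2 (hD p hp).ne_zero
    rw [← mul_inv]
    congr 1
    field_simp
  rw [h1, h2]
  refine mul_le_mul_of_nonneg_left (sum_inv_factoredNumbers_le D _ hD fun m hm => ?_)
    (by positivity)
  obtain ⟨n, hn, rfl⟩ := Finset.mem_image.1 hm
  rw [Nat.mem_factoredNumbers']
  intro p hp hpn
  rw [← (hs n hn).2]
  exact Nat.mem_primeFactors.2 ⟨hp, hpn.trans (Nat.div_dvd_of_dvd (hdvd n hn)), (hs n hn).1⟩

/-! ### Lower bounds for the denominators of Selberg's sieve. -/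

/-- The sets of primes with product at most `N`. -/
def primeSubsets (P : Finset ℕ) (N : ℕ) : Finset (Finset ℕ) :=
  P.powerset.filter fun D => ∏ p ∈ D, p ≤ N

theorem mem_primeSubsets {P D : Finset ℕ} {N : ℕ} :
    D ∈ primeSubsets P N ↔ D ⊆ P ∧ ∏ p ∈ D, p ≤ N := by
  simp [primeSubsets]

/-- Group the harmonic sum by the set of prime factors of n. This is the lower bound for the
one-dimensional sieve denominator, from which all the others are derived. -/
theorem log_le_sum_primeSubsets (N : ℕ) :
    Real.log (N + 1) ≤
      ∑ D ∈ primeSubsets (Nat.primesLE N) N, ∏ p ∈ D, ((p : ℝ) - 1)⁻¹ := by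
  have h := log_add_one_le_harmonic N
  rw [harmonic_eq_sum_Icc] at h
  push_cast at h
  refine h.trans ?_
  rw [← Finset.sum_fiberwise_of_maps_to (s := Finset.Icc 1 N)
    (t := primeSubsets (Nat.primesLE N) N) (g := Nat.primeFactors)]
  · refine Finset.sum_le_sum fun D hD => sum_inv_primeFactors_eq_le D _ ?_ ?_
    · intro p hp
      exact (Nat.mem_primesLE.1 ((mem_primeSubsets.1 hD).1 hp)).2
    · intro n hn
      rw [Finset.mem_filter, Finset.mem_Icc] at hn
      exact ⟨by omega, hn.2⟩
  · intro n hn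
    rw [Finset.mem_Icc] at hn
    refine mem_primeSubsets.2 ⟨fun p hp => ?_, ?_⟩
    · rw [Nat.mem_primeFactors] at hp
      exact Nat.mem_primesLE.2 ⟨(Nat.le_of_dvd (by omega) hp.2.1).trans hn.2, hp.1⟩
    · exact (Nat.le_of_dvd (by omega) (Nat.prod_primeFactors_dvd n)).trans hn.2

theorem sum_le_sum_of_injOn_of_le {ι κ : Type*} {s : Finset ι} {t : Finset κ} (i : ι → κ)
    {f : ι → ℝ} {g : κ → ℝ} (hi : ∀ x ∈ s, i x ∈ t) (hinj : Set.InjOn i s)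
    (hg : ∀ y ∈ t, 0 ≤ g y) (h : ∀ x ∈ s, f x ≤ g (i x)) : ∑ x ∈ s, f x ≤ ∑ y ∈ t, g y := by
  classical
  calc ∑ x ∈ s, f x ≤ ∑ x ∈ s, g (i x) := Finset.sum_le_sum h
    _ = ∑ y ∈ s.image i, g y := (Finset.sum_image hinj).symm
    _ ≤ _ := Finset.sum_le_sum_of_subset_of_nonneg (Finset.image_subset_iff.2 hi)
      fun y hy _ => hg y hy

/-- A prime of E lies in the first set only, in the second only, or in both; these are the three
terms of its factor. -/
theorem sum_union_eq_prod_mul_prod_le {α : Type*} [DecidableEq α] (E : Finset α) (f g : α → ℝ)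
    (hf : ∀ p ∈ E, 0 ≤ f p) (hg : ∀ p ∈ E, 0 ≤ g p) (s : Finset (Finset α × Finset α))
    (hs : ∀ x ∈ s, x.1 ∪ x.2 = E) :
    ∑ x ∈ s, (∏ p ∈ x.1, f p) * ∏ p ∈ x.2, g p ≤ ∏ p ∈ E, (f p + g p + f p * g p) := by
  have h1 : ∏ p ∈ E, (f p + g p + f p * g p) = ∏ p ∈ E, (f p * (1 + g p) + g p) :=
    Finset.prod_congr rfl fun p _ => by ring
  rw [h1, Finset.prod_add, ← Finset.sum_fiberwise_of_maps_to (s := s) (t := E.powerset)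
    (g := Prod.fst)]
  · refine Finset.sum_le_sum fun A hA => ?_
    have hAE := Finset.mem_powerset.1 hA
    have h2 : (∏ p ∈ A, f p * (1 + g p)) * ∏ p ∈ E \ A, g p =
        ∑ B ∈ A.powerset, (∏ p ∈ A, f p) * ((∏ p ∈ B, g p) * ∏ p ∈ E \ A, g p) := by
      rw [Finset.prod_mul_distrib, Finset.prod_one_add, ← Finset.mul_sum, ← Finset.sum_mul,
        mul_assoc]
    have h3 : ∀ x ∈ s.filter (fun x => x.1 = A), x.2 = x.2 ∩ A ∪ E \ A := by
      intro x hx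
      rw [Finset.mem_filter] at hx
      have := hs x hx.1
      rw [hx.2] at this
      ext p
      have hp := Finset.ext_iff.1 this p
      simp only [Finset.mem_union, Finset.mem_inter, Finset.mem_sdiff] at hp ⊢
      tauto
    rw [h2]
    refine sum_le_sum_of_injOn_of_le (fun x => x.2 ∩ A) ?_ ?_ ?_ ?_
    · intro x _
      exact Finset.mem_powerset.2 Finset.inter_subset_right
    · intro x hx z hz hxz
      have hx' := Finset.mem_coe.1 hx
      have hz' := Finset.mem_coe.1 hz
      refine Prod.ext ?_ ?_
      · rw [(Finset.mem_filter.1 hx').2, (Finset.mem_filter.1 hz').2]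
      · rw [h3 x hx', h3 z hz']
        exact congrArg (· ∪ E \ A) hxz
    · intro B hB
      rw [Finset.mem_powerset] at hB
      refine mul_nonneg (Finset.prod_nonneg fun p hp => hf p (hAE hp))
        (mul_nonneg (Finset.prod_nonneg fun p hp => hg p (hAE (hB hp)))
          (Finset.prod_nonneg fun p hp => hg p (Finset.mem_sdiff.1 hp).1))
    · intro x hx
      have hdisj : Disjoint (x.2 ∩ A) (E \ A) :=
        (Finset.disjoint_sdiff (s := A) (t := E)).mono_left Finset.inter_subset_right
      rw [← Finset.prod_union hdisj, ← h3 x hx, (Finset.mem_filter.1 hx).2]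
  · intro x hx
    rw [Finset.mem_powerset, ← hs x hx]
    exact Finset.subset_union_left

theorem sum_prod_mul_sum_prod_le {α : Type*} [DecidableEq α] (𝒟₁ 𝒟₂ 𝒟 : Finset (Finset α))
    (f g : α → ℝ) (h𝒟 : ∀ A ∈ 𝒟₁, ∀ B ∈ 𝒟₂, A ∪ B ∈ 𝒟)
    (hf : ∀ E ∈ 𝒟, ∀ p ∈ E, 0 ≤ f p) (hg : ∀ E ∈ 𝒟, ∀ p ∈ E, 0 ≤ g p) :
    (∑ D ∈ 𝒟₁, ∏ p ∈ D, f p) * ∑ D ∈ 𝒟₂, ∏ p ∈ D, g p ≤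
      ∑ D ∈ 𝒟, ∏ p ∈ D, (f p + g p + f p * g p) := by
  rw [Finset.sum_mul_sum, ← Finset.sum_product',
    ← Finset.sum_fiberwise_of_maps_to (s := 𝒟₁ ×ˢ 𝒟₂) (t := 𝒟) (g := fun x => x.1 ∪ x.2)]
  · exact Finset.sum_le_sum fun E hE =>
      sum_union_eq_prod_mul_prod_le E f g (hf E hE) (hg E hE) _
        fun x hx => (Finset.mem_filter.1 hx).2
  · intro x hx
    rw [Finset.mem_product] at hx
    exact h𝒟 _ hx.1 _ hx.2

theorem union_mem_primeSubsets {P : Finset ℕ} (hP : ∀ p ∈ P, Nat.Prime p) {M N : ℕ}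
    {A B : Finset ℕ} (hA : A ∈ primeSubsets P M) (hB : B ∈ primeSubsets P N) :
    A ∪ B ∈ primeSubsets P (M * N) := by
  rw [mem_primeSubsets] at *
  refine ⟨Finset.union_subset hA.1 hB.1, ?_⟩
  have h1 : (∏ p ∈ A ∪ B, p) * ∏ p ∈ A ∩ B, p = (∏ p ∈ A, p) * ∏ p ∈ B, p :=
    Finset.prod_union_inter
  have h2 : 1 ≤ ∏ p ∈ A ∩ B, p := Finset.one_le_prod' fun p hp =>
    (hP p (hA.1 (Finset.mem_inter.1 hp).1)).one_le
  calc ∏ p ∈ A ∪ B, p ≤ (∏ p ∈ A ∪ B, p) * ∏ p ∈ A ∩ B, p := Nat.le_mul_of_pos_right _ h2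
    _ = _ := h1
    _ ≤ M * N := Nat.mul_le_mul hA.2 hB.2

/-- A square of the one-dimensional denominator minorizes the two-dimensional one, at the price of
replacing N by N², so no asymptotics in higher dimension are needed. The overlap term (p-1)⁻² is
absorbed by passing from p - 1 to p - 2. The cube below works the same way. -/
theorem sq_sum_primeSubsets_le {P : Finset ℕ} (hP : ∀ p ∈ P, Nat.Prime p) (h2 : ∀ p ∈ P, 2 < p)
    (N : ℕ) :
    (∑ D ∈ primeSubsets P N, ∏ p ∈ D, ((p : ℝ) - 1)⁻¹) ^ 2 ≤
      ∑ D ∈ primeSubsets P (N ^ 2), ∏ p ∈ D, 2 / ((p : ℝ) - 2) := by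
  have hpos : ∀ p ∈ P, (0 : ℝ) ≤ ((p : ℝ) - 1)⁻¹ := fun p hp => by
    have : (1 : ℝ) < p := by exact_mod_cast (hP p hp).one_lt
    exact inv_nonneg.2 (by linarith)
  rw [sq, sq]
  refine (sum_prod_mul_sum_prod_le _ _ (primeSubsets P (N * N)) _ _
    (fun A hA B hB => union_mem_primeSubsets hP hA hB)
    (fun E hE p hp => hpos p ((mem_primeSubsets.1 hE).1 hp))
    (fun E hE p hp => hpos p ((mem_primeSubsets.1 hE).1 hp))).trans ?_
  refine Finset.sum_le_sum fun D hD => Finset.prod_le_prod (fun p hp => ?_) fun p hp => ?_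
  · have := hpos p ((mem_primeSubsets.1 hD).1 hp)
    positivity
  · have hp2 : (3 : ℝ) ≤ p := by exact_mod_cast h2 p ((mem_primeSubsets.1 hD).1 hp)
    have h1 : (0 : ℝ) < p - 1 := by linarith
    have h2 : (0 : ℝ) < p - 2 := by linarith
    have : ((p : ℝ) - 1)⁻¹ + ((p : ℝ) - 1)⁻¹ + ((p : ℝ) - 1)⁻¹ * ((p : ℝ) - 1)⁻¹ =
        (2 * p - 1) / ((p - 1) * (p - 1)) := by
      field_simp; ring
    rw [this, div_le_div_iff₀ (by positivity) h2]
    nlinarith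

theorem cube_sum_primeSubsets_le {P : Finset ℕ} (hP : ∀ p ∈ P, Nat.Prime p) (h3 : ∀ p ∈ P, 3 < p)
    (N : ℕ) :
    (∑ D ∈ primeSubsets P N, ∏ p ∈ D, ((p : ℝ) - 1)⁻¹) ^ 3 ≤
      ∑ D ∈ primeSubsets P (N ^ 3), ∏ p ∈ D, 3 / ((p : ℝ) - 3) := by
  have hpos : ∀ p ∈ P, (0 : ℝ) ≤ ((p : ℝ) - 1)⁻¹ := fun p hp => by
    have : (1 : ℝ) < p := by exact_mod_cast (hP p hp).one_lt
    exact inv_nonneg.2 (by linarith)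
  have hpos2 : ∀ p ∈ P, (0 : ℝ) ≤ 2 / ((p : ℝ) - 2) := fun p hp => by
    have : (3 : ℝ) < p := by exact_mod_cast h3 p hp
    exact div_nonneg (by norm_num) (by linarith)
  have hnn : 0 ≤ ∑ D ∈ primeSubsets P N, ∏ p ∈ D, ((p : ℝ) - 1)⁻¹ :=
    Finset.sum_nonneg fun D hD => Finset.prod_nonneg fun p hp =>
      hpos p ((mem_primeSubsets.1 hD).1 hp)
  rw [pow_succ, pow_succ N 2]
  refine (mul_le_mul_of_nonneg_right (sq_sum_primeSubsets_le hP
    (fun p hp => (by norm_num : 2 < 3).trans (h3 p hp)) N) hnn).trans ?_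
  refine (sum_prod_mul_sum_prod_le _ _ (primeSubsets P (N ^ 2 * N)) _ _
    (fun A hA B hB => union_mem_primeSubsets hP hA hB)
    (fun E hE p hp => hpos2 p ((mem_primeSubsets.1 hE).1 hp))
    (fun E hE p hp => hpos p ((mem_primeSubsets.1 hE).1 hp))).trans ?_
  refine Finset.sum_le_sum fun D hD => Finset.prod_le_prod (fun p hp => ?_) fun p hp => ?_
  · have := hpos p ((mem_primeSubsets.1 hD).1 hp)
    have := hpos2 p ((mem_primeSubsets.1 hD).1 hp)
    positivity
  · have hp2 : (4 : ℝ) ≤ p := by exact_mod_cast h3 p ((mem_primeSubsets.1 hD).1 hp)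
    have h1 : (0 : ℝ) < p - 1 := by linarith
    have h2 : (0 : ℝ) < p - 2 := by linarith
    have h3 : (0 : ℝ) < p - 3 := by linarith
    have : 2 / ((p : ℝ) - 2) + ((p : ℝ) - 1)⁻¹ + 2 / ((p : ℝ) - 2) * ((p : ℝ) - 1)⁻¹ =
        (3 * p - 2) / ((p - 1) * (p - 2)) := by
      field_simp; ring
    rw [this, div_le_div_iff₀ (by positivity) h3]
    nlinarith

/-- The price of not sieving by the primes of B: split D into D ∩ B and D \ B and let the first part
run over all subsets of B, which gives ∏ (1 + (p-1)⁻¹). -/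
theorem sum_primeSubsets_le_prod_mul {P B : Finset ℕ} {N : ℕ}
    (hP : ∀ p ∈ P, Nat.Prime p) (hB : ∀ p ∈ B, Nat.Prime p) (hPB : Nat.primesLE N ⊆ P ∪ B) :
    ∑ D ∈ primeSubsets (Nat.primesLE N) N, ∏ p ∈ D, ((p : ℝ) - 1)⁻¹ ≤
      (∏ p ∈ B, (1 - (p : ℝ)⁻¹)⁻¹) * ∑ D ∈ primeSubsets P N, ∏ p ∈ D, ((p : ℝ) - 1)⁻¹ := by
  have hnn : ∀ p : ℕ, p.Prime → (0 : ℝ) ≤ ((p : ℝ) - 1)⁻¹ := fun p hp => by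
    have : (1 : ℝ) < p := by exact_mod_cast hp.one_lt
    exact inv_nonneg.2 (by linarith)
  have h1 : ∏ p ∈ B, (1 - (p : ℝ)⁻¹)⁻¹ = ∑ D ∈ B.powerset, ∏ p ∈ D, ((p : ℝ) - 1)⁻¹ := by
    rw [← Finset.prod_one_add]
    refine Finset.prod_congr rfl fun p hp => ?_
    have : (1 : ℝ) < p := by exact_mod_cast (hB p hp).one_lt
    have h1 : (p : ℝ) - 1 ≠ 0 := by linarith
    have h2 : (p : ℝ) ≠ 0 := by linarith
    field_simp
    ring
  rw [h1, Finset.sum_mul_sum, ← Finset.sum_product']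
  refine sum_le_sum_of_injOn_of_le (fun D => (D ∩ B, D \ B)) ?_ ?_ ?_ ?_
  · intro D hD
    rw [mem_primeSubsets] at hD
    rw [Finset.mem_product, Finset.mem_powerset, mem_primeSubsets]
    refine ⟨Finset.inter_subset_right, fun p hp => ?_, le_trans ?_ hD.2⟩
    · rw [Finset.mem_sdiff] at hp
      exact (Finset.mem_union.1 (hPB (hD.1 hp.1))).resolve_right hp.2
    · exact Finset.prod_le_prod_of_subset_of_one_le' Finset.sdiff_subset fun p hp _ =>
        (Nat.mem_primesLE.1 (hD.1 hp)).2.one_le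
  · intro D _ E _ hDE
    simp only [Prod.mk.injEq] at hDE
    rw [← Finset.sdiff_union_inter D B, ← Finset.sdiff_union_inter E B, hDE.1, hDE.2]
  · intro x hx
    rw [Finset.mem_product, Finset.mem_powerset, mem_primeSubsets] at hx
    exact mul_nonneg (Finset.prod_nonneg fun p hp => hnn p (hB p (hx.1 hp)))
      (Finset.prod_nonneg fun p hp => hnn p (hP p (hx.2.1 hp)))
  · intro D hD
    rw [mul_comm, ← Finset.prod_union (Finset.disjoint_sdiff_inter D B),
      Finset.sdiff_union_inter]

/-! ### Complete sums of periodic functions. -/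

theorem sum_range_mul_of_coprime_periodic {m n : ℕ} (hm : 0 < m) (hn : 0 < n)
    (h : m.Coprime n) (f g : ℕ → ℝ) (hf : ∀ x, f (x % m) = f x) (hg : ∀ x, g (x % n) = g x) :
    ∑ x ∈ Finset.range (m * n), f x * g x =
      (∑ x ∈ Finset.range m, f x) * ∑ x ∈ Finset.range n, g x := by
  rw [Finset.sum_mul_sum, ← Finset.sum_product']
  refine Finset.sum_bij' (fun x _ => (x % m, x % n))
    (fun x _ => (Nat.chineseRemainder h x.1 x.2 : ℕ)) ?_ ?_ ?_ ?_ ?_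
  · intro x _
    simp [Nat.mod_lt _ hm, Nat.mod_lt _ hn]
  · intro x _
    exact Finset.mem_range.2 (Nat.chineseRemainder_lt_mul h _ _ hm.ne' hn.ne')
  · intro x hx
    have hc := (Nat.chineseRemainder h (x % m) (x % n)).2
    have h1 : (Nat.chineseRemainder h (x % m) (x % n) : ℕ) ≡ x [MOD m * n] :=
      (Nat.modEq_and_modEq_iff_modEq_mul h).1
        ⟨hc.1.trans (Nat.mod_modEq _ _), hc.2.trans (Nat.mod_modEq _ _)⟩
    exact h1.eq_of_lt_of_lt (Nat.chineseRemainder_lt_mul h _ _ hm.ne' hn.ne')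
      (Finset.mem_range.1 hx)
  · intro x hx
    rw [Finset.mem_product, Finset.mem_range, Finset.mem_range] at hx
    have hc := (Nat.chineseRemainder h x.1 x.2).2
    refine Prod.ext ?_ ?_
    · exact (Nat.mod_eq_of_modEq hc.1 hx.1)
    · exact (Nat.mod_eq_of_modEq hc.2 hx.2)
  · intro x _
    simp only [hf, hg]

theorem prod_mod_prod {D : Finset ℕ} (f : ℕ → ℕ → ℝ) (hf : ∀ p ∈ D, ∀ x, f p (x % p) = f p x)
    (x : ℕ) : ∏ p ∈ D, f p (x % ∏ p ∈ D, p) = ∏ p ∈ D, f p x := by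
  refine Finset.prod_congr rfl fun p hp => ?_
  rw [← hf p hp (x % _), Nat.mod_mod_of_dvd _ (Finset.dvd_prod_of_mem _ hp), hf p hp]

theorem sum_range_prod_periodic {D : Finset ℕ} (hD : ∀ p ∈ D, Nat.Prime p)
    (f : ℕ → ℕ → ℝ) (hf : ∀ p ∈ D, ∀ x, f p (x % p) = f p x) :
    ∑ x ∈ Finset.range (∏ p ∈ D, p), ∏ p ∈ D, f p x =
      ∏ p ∈ D, ∑ x ∈ Finset.range p, f p x := by
  induction D using Finset.induction_on with
  | empty => simp
  | insert q D hq ih =>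
    simp only [Finset.prod_insert hq]
    have hD' : ∀ p ∈ D, Nat.Prime p := fun p hp => hD p (Finset.mem_insert_of_mem hp)
    have hf' : ∀ p ∈ D, ∀ x, f p (x % p) = f p x :=
      fun p hp => hf p (Finset.mem_insert_of_mem hp)
    have hqp := hD q (Finset.mem_insert_self _ _)
    have hcop : q.Coprime (∏ p ∈ D, p) := Nat.Coprime.prod_right fun p hp =>
      (Nat.coprime_primes hqp (hD' p hp)).2 fun h => hq (h ▸ hp)
    rw [sum_range_mul_of_coprime_periodic hqp.pos (Finset.prod_pos fun p hp => (hD' p hp).pos)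
      hcop (f q) (fun x => ∏ p ∈ D, f p x) (hf q (Finset.mem_insert_self _ _))
      (prod_mod_prod f hf'), ih hD' hf']

theorem sum_range_periodic (F : ℕ → ℝ) (q N : ℕ) (hF : ∀ x, F (x % q) = F x) :
    ∑ x ∈ Finset.range N, F x =
      (N / q : ℕ) * ∑ x ∈ Finset.range q, F x + ∑ x ∈ Finset.range (N % q), F x := by
  have hmul : ∀ m : ℕ, ∀ r, ∑ x ∈ Finset.range (q * m + r), F x =
      m * ∑ x ∈ Finset.range q, F x + ∑ x ∈ Finset.range r, F x := by
    intro m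
    induction m with
    | zero => intro r; simp
    | succ m ih =>
      intro r
      have hshift : ∀ x, F (q + x) = F x := fun x => by
        rw [← hF (q + x), Nat.add_mod_left, hF]
      rw [show q * (m + 1) + r = q + (q * m + r) by ring, Finset.sum_range_add]
      simp only [hshift]
      rw [ih]
      push_cast
      ring
  conv_lhs => rw [← Nat.div_add_mod N q]
  exact hmul _ _

/-! ### Selberg's sieve in orthogonal form. -/

/-- The sieve function with mean value zero modulo `p`, equal to `1` off the residues `R`. -/
noncomputable def sieveFun (κ : ℕ) (R : ℕ → Finset ℕ) (p n : ℕ) : ℝ :=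
  if n % p ∈ R p then -(((p : ℝ) - κ) / κ) else 1

theorem sieveFun_mod (κ : ℕ) (R : ℕ → Finset ℕ) (p n : ℕ) :
    sieveFun κ R p (n % p) = sieveFun κ R p n := by
  simp [sieveFun]

theorem abs_sieveFun_le {κ : ℕ} (hκ : 1 ≤ κ) (R : ℕ → Finset ℕ) {p : ℕ} (hp : κ < p) (n : ℕ) :
    |sieveFun κ R p n| ≤ p := by
  have hκ' : (1 : ℝ) ≤ κ := by exact_mod_cast hκ
  have hp' : (κ : ℝ) < p := by exact_mod_cast hp
  rw [sieveFun]
  split_ifs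
  · rw [abs_neg, abs_of_nonneg (div_nonneg (by linarith) (by linarith)),
      div_le_iff₀ (by linarith)]
    nlinarith
  · simp; linarith

theorem sum_sieveFun_pow {κ : ℕ} (R : ℕ → Finset ℕ) {p : ℕ} (hR : R p ⊆ Finset.range p)
    (hc : (R p).card = κ) (j : ℕ) :
    ∑ x ∈ Finset.range p, sieveFun κ R p x ^ j =
      κ * (-(((p : ℝ) - κ) / κ)) ^ j + ((p : ℝ) - κ) := by
  have hle : κ ≤ p := by
    rw [← hc]; simpa using Finset.card_le_card hR
  rw [← Finset.sum_sdiff hR, add_comm]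
  congr 1
  · rw [Finset.sum_congr rfl (g := fun _ => (-(((p : ℝ) - κ) / κ)) ^ j), Finset.sum_const, hc,
      nsmul_eq_mul]
    intro x hx
    rw [sieveFun, Nat.mod_eq_of_lt (Finset.mem_range.1 (hR hx)), if_pos hx]
  · rw [Finset.sum_congr rfl (g := fun _ => (1 : ℝ)), Finset.sum_const,
      Finset.card_sdiff_of_subset hR, hc, Finset.card_range, nsmul_eq_mul, mul_one,
      Nat.cast_sub hle]
    intro x hx
    rw [Finset.mem_sdiff] at hx
    rw [sieveFun, Nat.mod_eq_of_lt (Finset.mem_range.1 hx.1), if_neg hx.2, one_pow]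

/-- Near-orthogonality. If D ≠ E, some prime p divides only one of the two products, and the mean
value zero modulo p kills the complete periods. If D = E, each p contributes its second moment p(p -
κ)/κ. The incomplete period has at most z² terms of size at most z², whence z⁴. -/
theorem sum_range_prod_sieveFun_mul_le {κ N z : ℕ} (hκ : 1 ≤ κ) {P : Finset ℕ}
    (hP : ∀ p ∈ P, Nat.Prime p) (hPκ : ∀ p ∈ P, κ < p) (R : ℕ → Finset ℕ)
    (hR : ∀ p ∈ P, R p ⊆ Finset.range p ∧ (R p).card = κ)
    {D E : Finset ℕ} (hD : D ∈ primeSubsets P z) (hE : E ∈ primeSubsets P z) :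
    ∑ n ∈ Finset.range N, (∏ p ∈ D, sieveFun κ R p n) * ∏ p ∈ E, sieveFun κ R p n ≤
      (if D = E then (N : ℝ) * ∏ p ∈ D, (κ / ((p : ℝ) - κ))⁻¹ else 0) + (z : ℝ) ^ 4 := by
  rw [mem_primeSubsets] at hD hE
  have hDE : D ∪ E ⊆ P := Finset.union_subset hD.1 hE.1
  set f : ℕ → ℕ → ℝ := fun p n =>
    (if p ∈ D then sieveFun κ R p n else 1) * if p ∈ E then sieveFun κ R p n else 1 with hf
  have hprod : ∀ n, (∏ p ∈ D, sieveFun κ R p n) * ∏ p ∈ E, sieveFun κ R p n =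
      ∏ p ∈ D ∪ E, f p n := by
    intro n
    rw [hf, Finset.prod_mul_distrib, Finset.prod_ite_mem, Finset.prod_ite_mem,
      Finset.union_inter_cancel_left, Finset.union_inter_cancel_right]
  have hfmod : ∀ p ∈ D ∪ E, ∀ x, f p (x % p) = f p x := by
    intro p _ x
    simp only [hf, sieveFun_mod]
  set q : ℕ := ∏ p ∈ D ∪ E, p with hq
  have hq0 : 0 < q := Finset.prod_pos fun p hp => (hP p (hDE hp)).pos
  have hqz : q ≤ z ^ 2 := by
    have := union_mem_primeSubsets hP (mem_primeSubsets.2 hD) (mem_primeSubsets.2 hE)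
    rw [sq]
    exact (mem_primeSubsets.1 this).2
  have habs : ∀ n, |∏ p ∈ D ∪ E, f p n| ≤ (z : ℝ) ^ 2 := by
    intro n
    have hb : ∀ A : Finset ℕ, A ⊆ P → ∏ p ∈ A, p ≤ z → |∏ p ∈ A, sieveFun κ R p n| ≤ z := by
      intro A hA hAz
      rw [Finset.abs_prod]
      calc ∏ p ∈ A, |sieveFun κ R p n| ≤ ∏ p ∈ A, (p : ℝ) :=
            Finset.prod_le_prod (fun p _ => abs_nonneg _)
              fun p hp => abs_sieveFun_le hκ R (hPκ p (hA hp)) n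
        _ = ((∏ p ∈ A, p : ℕ) : ℝ) := by push_cast; rfl
        _ ≤ z := by exact_mod_cast hAz
    rw [← hprod, abs_mul, sq]
    exact mul_le_mul (hb D hD.1 hD.2) (hb E hE.1 hE.2) (abs_nonneg _) (Nat.cast_nonneg _)
  simp only [hprod]
  rw [sum_range_periodic _ q N fun x => prod_mod_prod f hfmod x]
  refine add_le_add ?_ ?_
  · rw [sum_range_prod_periodic (fun p hp => hP p (hDE hp)) f hfmod]
    split_ifs with h
    · subst h
      rw [Finset.union_self]
      have hval : ∏ p ∈ D, ∑ x ∈ Finset.range p, f p x =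
          q * ∏ p ∈ D, (κ / ((p : ℝ) - κ))⁻¹ := by
        rw [hq, Finset.union_self, Nat.cast_prod, ← Finset.prod_mul_distrib]
        refine Finset.prod_congr rfl fun p hp => ?_
        have hp' : (κ : ℝ) < p := by exact_mod_cast hPκ p (hD.1 hp)
        have hκ' : (1 : ℝ) ≤ κ := by exact_mod_cast hκ
        have hR' := hR p (hD.1 hp)
        have : ∀ x, f p x = sieveFun κ R p x ^ 2 := fun x => by
          simp only [hf, if_pos hp]; ring
        simp only [this]
        rw [sum_sieveFun_pow R hR'.1 hR'.2]
        have h1 : (κ : ℝ) ≠ 0 := by linarith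
        have h2 : (p : ℝ) - κ ≠ 0 := by linarith
        field_simp
        ring
      rw [hval, ← mul_assoc]
      refine mul_le_mul_of_nonneg_right ?_ (Finset.prod_nonneg fun p hp => ?_)
      · exact_mod_cast Nat.div_mul_le_self N q
      · have hp' : (κ : ℝ) < p := by exact_mod_cast hPκ p (hD.1 hp)
        exact inv_nonneg.2 (div_nonneg (Nat.cast_nonneg _) (by linarith))
    · have : ∃ p ∈ D ∪ E, (p ∈ D ∧ p ∉ E) ∨ (p ∉ D ∧ p ∈ E) := by
        by_contra hcon
        refine h (Finset.ext fun p => ?_)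
        by_contra hp
        refine hcon ⟨p, ?_, ?_⟩
        · rw [Finset.mem_union]; tauto
        · tauto
      obtain ⟨p, hp, hpx⟩ := this
      have hzero : ∑ x ∈ Finset.range p, f p x = 0 := by
        have hR' := hR p (hDE hp)
        have h0 := sum_sieveFun_pow R hR'.1 hR'.2 1
        have hκ' : (κ : ℝ) ≠ 0 := by exact_mod_cast (by omega : κ ≠ 0)
        have : ∀ x, f p x = sieveFun κ R p x ^ 1 := fun x => by
          rcases hpx with h' | h' <;> simp [hf, h'.1, h'.2]
        simp only [this]
        rw [h0]
        field_simp
        ring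
      rw [Finset.prod_eq_zero hp hzero, mul_zero]
  · calc ∑ x ∈ Finset.range (N % q), ∏ p ∈ D ∪ E, f p x
        ≤ ∑ x ∈ Finset.range (N % q), (z : ℝ) ^ 2 :=
          Finset.sum_le_sum fun x _ => (le_abs_self _).trans (habs x)
      _ = (N % q : ℕ) * (z : ℝ) ^ 2 := by rw [Finset.sum_const, Finset.card_range, nsmul_eq_mul]
      _ ≤ (z : ℝ) ^ 2 * (z : ℝ) ^ 2 := by
          gcongr
          exact_mod_cast ((Nat.mod_lt N hq0).le.trans hqz)
      _ = _ := by ring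

/-- Selberg's upper bound sieve for `κ` residue classes modulo every prime of `P`. -/
theorem card_sifted_le {κ N z : ℕ} (hκ : 1 ≤ κ) (hz : 1 ≤ z) {P : Finset ℕ}
    (hP : ∀ p ∈ P, Nat.Prime p) (hPκ : ∀ p ∈ P, κ < p) (R : ℕ → Finset ℕ)
    (hR : ∀ p ∈ P, R p ⊆ Finset.range p ∧ (R p).card = κ)
    (S : Finset ℕ) (hS : S ⊆ Finset.range N) (hSR : ∀ n ∈ S, ∀ p ∈ P, n % p ∉ R p) :
    0 < ∑ D ∈ primeSubsets P z, ∏ p ∈ D, κ / ((p : ℝ) - κ) ∧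
    (S.card : ℝ) ≤ N / (∑ D ∈ primeSubsets P z, ∏ p ∈ D, κ / ((p : ℝ) - κ)) + (z : ℝ) ^ 4 := by
  set h : Finset ℕ → ℝ := fun D => ∏ p ∈ D, κ / ((p : ℝ) - κ) with hh
  set G : ℝ := ∑ D ∈ primeSubsets P z, h D with hG
  have hpos : ∀ D ∈ primeSubsets P z, 0 < h D := fun D hD => Finset.prod_pos fun p hp => by
    have hp' : (κ : ℝ) < p := by exact_mod_cast hPκ p ((mem_primeSubsets.1 hD).1 hp)
    have hκ' : (1 : ℝ) ≤ κ := by exact_mod_cast hκ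
    exact div_pos (by linarith) (by linarith)
  have hGpos : 0 < G := by
    refine Finset.sum_pos hpos ⟨∅, mem_primeSubsets.2 ⟨by simp, by simpa using hz⟩⟩
  refine ⟨hGpos, ?_⟩
  -- F is constantly G on the sifted set, because every sieve function is 1 there.
  -- Near-orthogonality bounds the sum of F² over the whole interval by N G + z⁴ G², and division by
  -- G² finishes the proof.
  set F : ℕ → ℝ := fun n => ∑ D ∈ primeSubsets P z, h D * ∏ p ∈ D, sieveFun κ R p n with hF
  have hFS : ∀ n ∈ S, F n = G := by
    intro n hn
    refine Finset.sum_congr rfl fun D hD => ?_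
    rw [Finset.prod_eq_one, mul_one]
    intro p hp
    rw [sieveFun, if_neg (hSR n hn p ((mem_primeSubsets.1 hD).1 hp))]
  have h1 : (S.card : ℝ) * G ^ 2 ≤ ∑ n ∈ Finset.range N, F n ^ 2 := by
    calc (S.card : ℝ) * G ^ 2 = ∑ n ∈ S, F n ^ 2 := by
          rw [Finset.sum_congr rfl fun n hn => by rw [hFS n hn], Finset.sum_const, nsmul_eq_mul]
      _ ≤ _ := Finset.sum_le_sum_of_subset_of_nonneg hS fun n _ _ => sq_nonneg _
  have h2 : ∑ n ∈ Finset.range N, F n ^ 2 =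
      ∑ D ∈ primeSubsets P z, ∑ E ∈ primeSubsets P z, h D * h E *
        ∑ n ∈ Finset.range N, (∏ p ∈ D, sieveFun κ R p n) * ∏ p ∈ E, sieveFun κ R p n := by
    simp only [Finset.mul_sum]
    rw [Finset.sum_congr rfl fun D _ => Finset.sum_comm, Finset.sum_comm]
    refine Finset.sum_congr rfl fun n _ => ?_
    rw [sq, hF, Finset.sum_mul_sum]
    refine Finset.sum_congr rfl fun D _ => Finset.sum_congr rfl fun E _ => by ring
  have h3 : ∑ n ∈ Finset.range N, F n ^ 2 ≤ N * G + (z : ℝ) ^ 4 * G ^ 2 := by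
    rw [h2]
    calc _ ≤ ∑ D ∈ primeSubsets P z, ∑ E ∈ primeSubsets P z, h D * h E *
          ((if D = E then (N : ℝ) * ∏ p ∈ D, (κ / ((p : ℝ) - κ))⁻¹ else 0) + (z : ℝ) ^ 4) := by
          refine Finset.sum_le_sum fun D hD => Finset.sum_le_sum fun E hE => ?_
          exact mul_le_mul_of_nonneg_left
            (sum_range_prod_sieveFun_mul_le hκ hP hPκ R hR hD hE)
            (mul_pos (hpos D hD) (hpos E hE)).le
      _ = ∑ D ∈ primeSubsets P z, (N * h D + (z : ℝ) ^ 4 * h D * G) := by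
          refine Finset.sum_congr rfl fun D hD => ?_
          simp only [mul_add, Finset.sum_add_distrib, mul_ite, mul_zero, Finset.sum_ite_eq,
            if_pos hD]
          congr 1
          · rw [Finset.prod_inv_distrib]
            have := (hpos D hD).ne'
            change h D * h D * (N * (h D)⁻¹) = _
            field_simp
          · rw [hG, Finset.mul_sum]
            exact Finset.sum_congr rfl fun E _ => by ring
      _ = _ := by
          rw [Finset.sum_add_distrib, ← Finset.mul_sum, ← Finset.sum_mul, ← Finset.mul_sum, sq,
            mul_assoc]
  have h4 : (S.card : ℝ) * G ^ 2 ≤ (N / G + (z : ℝ) ^ 4) * G ^ 2 := by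
    refine (h1.trans h3).trans (le_of_eq ?_)
    field_simp
  exact le_of_mul_le_mul_right h4 (by positivity)

/-! ### Prime values of linear forms. -/

theorem log_pow_le_const_mul_sqrt (κ : ℕ) (hκ : κ ≤ 3) {X : ℝ} (hX : 2 ≤ X) :
    Real.log X ^ κ * X ^ (1 / 2 : ℝ) ≤ 216 * X := by
  have hX0 : 0 < X := by linarith
  have h6 : Real.log X ≤ 6 * X ^ (1 / 6 : ℝ) := by
    have := Real.log_le_rpow_div hX0.le (ε := 1 / 6) (by norm_num)
    linarith
  have h1 : 1 ≤ 6 * X ^ (1 / 6 : ℝ) := by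
    have := Real.one_le_rpow (by linarith : 1 ≤ X) (by norm_num : (0 : ℝ) ≤ 1 / 6)
    linarith
  have hlog : 0 ≤ Real.log X := Real.log_nonneg (by linarith)
  have h2 : Real.log X ^ κ ≤ (6 * X ^ (1 / 6 : ℝ)) ^ 3 :=
    (pow_le_pow_left₀ hlog h6 κ).trans (pow_le_pow_right₀ h1 hκ)
  calc Real.log X ^ κ * X ^ (1 / 2 : ℝ) ≤ (6 * X ^ (1 / 6 : ℝ)) ^ 3 * X ^ (1 / 2 : ℝ) := by gcongr
    _ = 216 * ((X ^ (1 / 6 : ℝ)) ^ 3 * X ^ (1 / 2 : ℝ)) := by ring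
    _ = 216 * X := by
      rw [← Real.rpow_natCast, ← Real.rpow_mul hX0.le, ← Real.rpow_add hX0]
      norm_num

/-- The sieve uses the primes up to w = X^(1/24) not dividing E, with level w^κ, so that the
denominator is at least the κ-th power of the one-dimensional one at w. As κ ≤ 3, the error (w^κ)⁴
is at most w^12 ≤ X^(1/2). Omitting the primes of E costs (C log L)^κ, and 6 ∣ E leaves only primes
above 3, hence above κ. -/
theorem exists_card_sifted_le (κ : ℕ) (hκ1 : 1 ≤ κ) (hκ3 : κ ≤ 3)
    (hG : ∀ P : Finset ℕ, (∀ p ∈ P, Nat.Prime p) → (∀ p ∈ P, 3 < p) → ∀ N : ℕ,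
      (∑ D ∈ primeSubsets P N, ∏ p ∈ D, ((p : ℝ) - 1)⁻¹) ^ κ ≤
        ∑ D ∈ primeSubsets P (N ^ κ), ∏ p ∈ D, (κ : ℝ) / ((p : ℝ) - κ)) :
    ∃ C : ℝ, 0 < C ∧ ∀ (X L : ℝ) (E : ℕ) (S : Finset ℕ) (Z : (p : ℕ) → Finset (ZMod p)),
      2 ≤ X → Real.exp 1 ≤ L → E ≠ 0 → Real.log E ≤ L → 6 ∣ E → (∀ n ∈ S, (n : ℝ) ≤ X) →
      (∀ p : ℕ, p.Prime → ¬p ∣ E → (Z p).card = κ) →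
      (∀ n ∈ S, ∀ p : ℕ, p.Prime → ¬p ∣ E → p + 1 < n → (n : ZMod p) ∉ Z p) →
      (S.card : ℝ) ≤ C * (X * Real.log L ^ κ / Real.log X ^ κ) := by
  obtain ⟨C, hC, hsing⟩ := exists_prod_primeFactors_inv_one_sub_inv_le
  refine ⟨2 * (24 * C) ^ κ + 4 * 216, by positivity, ?_⟩
  intro X L E S Z hX hL hE hEL h6 hSX hZ hS
  have hX0 : 0 < X := by linarith
  have hL0 : 0 < L := (Real.exp_pos 1).trans_le hL
  have hlogL : 1 ≤ Real.log L := by rw [Real.le_log_iff_exp_le hL0]; exact hL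
  have hlogX : 0 < Real.log X := Real.log_pos (by linarith)
  have hX24 : 1 ≤ X ^ (1 / 24 : ℝ) := Real.one_le_rpow (by linarith) (by norm_num)
  set w : ℕ := ⌊X ^ (1 / 24 : ℝ)⌋₊ with hw
  have hw1 : 1 ≤ w := Nat.le_floor (by simpa using hX24)
  have hwle : (w : ℝ) ≤ X ^ (1 / 24 : ℝ) := Nat.floor_le (by positivity)
  have hwlt : X ^ (1 / 24 : ℝ) < w + 1 := Nat.lt_floor_add_one _
  set P : Finset ℕ := Nat.primesLE w \ E.primeFactors with hPdef
  have hP : ∀ p ∈ P, Nat.Prime p ∧ p ≤ w ∧ ¬p ∣ E := by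
    intro p hp
    rw [hPdef, Finset.mem_sdiff, Nat.mem_primesLE, Nat.mem_primeFactors] at hp
    exact ⟨hp.1.2, hp.1.1, fun h => hp.2 ⟨hp.1.2, h, hE⟩⟩
  have hP3 : ∀ p ∈ P, 3 < p := by
    intro p hp
    have hp' := hP p hp
    by_contra hle
    have : p = 2 ∨ p = 3 := by have := hp'.1.two_le; omega
    rcases this with rfl | rfl
    · exact hp'.2.2 ((by norm_num : 2 ∣ 6).trans h6)
    · exact hp'.2.2 ((by norm_num : 3 ∣ 6).trans h6)
  set S' : Finset ℕ := S.filter fun n => w + 1 < n with hS'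
  have hsmall : (S.card : ℝ) ≤ S'.card + (w + 2) := by
    have h1 : S ⊆ S' ∪ Finset.range (w + 2) := by
      intro n hn
      rw [Finset.mem_union, hS', Finset.mem_filter, Finset.mem_range]
      by_cases h : w + 1 < n
      · exact Or.inl ⟨hn, h⟩
      · right; omega
    have h2 := (Finset.card_le_card h1).trans (Finset.card_union_le _ _)
    rw [Finset.card_range] at h2
    exact_mod_cast h2
  have hval : ∀ p ∈ P, NeZero p := fun p hp => ⟨(hP p hp).1.ne_zero⟩
  have hsieve := card_sifted_le (κ := κ) (N := ⌊X⌋₊ + 1) (z := w ^ κ) hκ1 (Nat.one_le_pow _ _ hw1)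
    (P := P) (fun p hp => (hP p hp).1) (fun p hp => hκ3.trans_lt (hP3 p hp))
    (fun p => (Z p).image ZMod.val) (fun p hp => by
      have := hval p hp
      refine ⟨fun r hr => ?_, ?_⟩
      · obtain ⟨a, _, rfl⟩ := Finset.mem_image.1 hr
        exact Finset.mem_range.2 (ZMod.val_lt a)
      · rw [Finset.card_image_of_injective _ (ZMod.val_injective p)]
        exact hZ p (hP p hp).1 (hP p hp).2.2)
    S' (fun n hn => by
      rw [Finset.mem_range]
      exact Nat.lt_succ_of_le (Nat.le_floor (hSX n (Finset.mem_filter.1 hn).1)))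
    (fun n hn p hp hmem => by
      have := hval p hp
      rw [hS', Finset.mem_filter] at hn
      obtain ⟨a, ha, hav⟩ := Finset.mem_image.1 hmem
      refine hS n hn.1 p (hP p hp).1 (hP p hp).2.2 (by have := (hP p hp).2.1; omega) ?_
      have : (n : ZMod p) = a := by
        rw [← ZMod.natCast_zmod_val a, hav, ZMod.natCast_mod]
      rwa [this])
  obtain ⟨hGpos, hcard⟩ := hsieve
  set G : ℝ := ∑ D ∈ primeSubsets P (w ^ κ), ∏ p ∈ D, (κ : ℝ) / ((p : ℝ) - κ) with hGdef
  have hlogw : Real.log X / 24 ≤ Real.log (w + 1) := by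
    have : Real.log (X ^ (1 / 24 : ℝ)) ≤ Real.log (w + 1) :=
      Real.log_le_log (by positivity) hwlt.le
    rw [Real.log_rpow hX0] at this
    linarith
  set G₁ : ℝ := ∑ D ∈ primeSubsets P w, ∏ p ∈ D, ((p : ℝ) - 1)⁻¹ with hG₁
  have hG₁nn : 0 ≤ G₁ := Finset.sum_nonneg fun D hD => Finset.prod_nonneg fun p hp => by
    have : (1 : ℝ) < p := by exact_mod_cast (hP p ((mem_primeSubsets.1 hD).1 hp)).1.one_lt
    exact inv_nonneg.2 (by linarith)
  have hG₁low : Real.log X / 24 ≤ C * Real.log L * G₁ := by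
    refine hlogw.trans ((log_le_sum_primeSubsets w).trans
      ((sum_primeSubsets_le_prod_mul (P := P) (B := E.primeFactors) (fun p hp => (hP p hp).1)
        (fun p hp => Nat.prime_of_mem_primeFactors hp) ?_).trans ?_))
    · intro p hp
      rw [hPdef, Finset.sdiff_union_self_eq_union]
      exact Finset.mem_union_left _ hp
    · exact mul_le_mul_of_nonneg_right (hsing E L hE hL hEL) hG₁nn
  have hGlow : (Real.log X / (24 * C * Real.log L)) ^ κ ≤ G := by
    refine le_trans (pow_le_pow_left₀ (by positivity) ?_ κ)
      (hG P (fun p hp => (hP p hp).1) hP3 w)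
    rw [div_le_iff₀ (by positivity)]
    nlinarith
  have hA : ((⌊X⌋₊ + 1 : ℕ) : ℝ) / G ≤ 2 * (24 * C) ^ κ * (X * Real.log L ^ κ / Real.log X ^ κ) := by
    have h1 : ((⌊X⌋₊ + 1 : ℕ) : ℝ) ≤ 2 * X := by
      push_cast
      have := Nat.floor_le hX0.le
      linarith
    calc ((⌊X⌋₊ + 1 : ℕ) : ℝ) / G ≤ 2 * X / (Real.log X / (24 * C * Real.log L)) ^ κ := by
          gcongr
      _ = _ := by rw [div_pow, mul_pow]; field_simp
  have hB : ((w ^ κ : ℕ) : ℝ) ^ 4 + (w + 2) ≤ 4 * X ^ (1 / 2 : ℝ) := by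
    have hX1 : 1 ≤ X := by linarith
    have hw12 : (w : ℝ) ^ 12 ≤ X ^ (1 / 2 : ℝ) := by
      calc (w : ℝ) ^ 12 ≤ (X ^ (1 / 24 : ℝ)) ^ 12 := by gcongr
        _ = X ^ (1 / 2 : ℝ) := by
          rw [← Real.rpow_natCast, ← Real.rpow_mul hX0.le]; norm_num
    have hw1' : (1 : ℝ) ≤ w := by exact_mod_cast hw1
    have h1 : ((w ^ κ : ℕ) : ℝ) ^ 4 ≤ (w : ℝ) ^ 12 := by
      push_cast
      rw [← pow_mul]
      exact pow_le_pow_right₀ hw1' (by omega)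
    have h2 : (w : ℝ) ≤ (w : ℝ) ^ 12 := le_self_pow₀ hw1' (by norm_num)
    linarith [one_le_pow₀ (n := 12) hw1']
  have hD : X ^ (1 / 2 : ℝ) ≤ 216 * (X * Real.log L ^ κ / Real.log X ^ κ) := by
    have h1 := log_pow_le_const_mul_sqrt κ hκ3 hX
    have h2 : 1 ≤ Real.log L ^ κ := one_le_pow₀ hlogL
    rw [mul_div_assoc', le_div_iff₀ (by positivity)]
    nlinarith
  calc (S.card : ℝ) ≤ S'.card + (w + 2) := hsmall
    _ ≤ ((⌊X⌋₊ + 1 : ℕ) : ℝ) / G + (((w ^ κ : ℕ) : ℝ) ^ 4 + (w + 2)) := by linarith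
    _ ≤ _ := by nlinarith

/-- The forbidden classes 0, -1/A and 1/B exist and are distinct modulo every prime not dividing
6AB(A + B). The margin p + 1 < n rules out that n, An + 1 or Bn - 1 is the sieving prime p itself;
the extra 1 is needed for Bn - 1 with B = 1. -/
theorem exists_card_prime_linear_le :
    ∃ C : ℝ, 0 < C ∧ ∀ (A B : ℕ) (X L : ℝ) (S : Finset ℕ), 0 < A → 0 < B → 2 ≤ X →
      Real.exp 1 ≤ L → Real.log (6 * (A * B * (A + B)) : ℕ) ≤ L → (∀ n ∈ S, (n : ℝ) ≤ X) →
      ((∀ n ∈ S, n.Prime ∧ (A * n + 1).Prime) →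
        (S.card : ℝ) ≤ C * (X * Real.log L ^ 2 / Real.log X ^ 2)) ∧
      ((∀ n ∈ S, n.Prime ∧ (B * n - 1).Prime) →
        (S.card : ℝ) ≤ C * (X * Real.log L ^ 2 / Real.log X ^ 2)) ∧
      ((∀ n ∈ S, n.Prime ∧ (A * n + 1).Prime ∧ (B * n - 1).Prime) →
        (S.card : ℝ) ≤ C * (X * Real.log L ^ 3 / Real.log X ^ 3)) := by
  obtain ⟨C₂, hC₂, h₂⟩ := exists_card_sifted_le 2 (by norm_num) (by norm_num)
    (fun P hP hP3 N => by
      have := sq_sum_primeSubsets_le hP (fun p hp => (by norm_num : 2 < 3).trans (hP3 p hp)) N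
      simpa using this)
  obtain ⟨C₃, hC₃, h₃⟩ := exists_card_sifted_le 3 (by norm_num) (by norm_num)
    (fun P hP hP3 N => by
      have := cube_sum_primeSubsets_le hP hP3 N
      simpa using this)
  refine ⟨C₂ + C₃, by positivity, fun A B X L S hA hB hX hL hE hSX => ?_⟩
  have hlogX : 0 < Real.log X := Real.log_pos (by linarith)
  have hlogL : 0 < Real.log L := by
    have : Real.exp 1 > 1 := by simp
    exact Real.log_pos (by linarith)
  set E : ℕ := 6 * (A * B * (A + B)) with hEdef
  have hE0 : E ≠ 0 := by positivity
  have hcop : ∀ p : ℕ, ¬p ∣ E → (A : ZMod p) ≠ 0 ∧ (B : ZMod p) ≠ 0 ∧ (A : ZMod p) + B ≠ 0 := by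
    intro p hp
    refine ⟨fun h => hp ?_, fun h => hp ?_, fun h => hp ?_⟩
    · rw [ZMod.natCast_eq_zero_iff] at h
      exact (h.mul_right B).mul_right (A + B) |>.mul_left 6
    · rw [ZMod.natCast_eq_zero_iff] at h
      exact (h.mul_left A).mul_right (A + B) |>.mul_left 6
    · have : ((A + B : ℕ) : ZMod p) = 0 := by push_cast; exact h
      rw [ZMod.natCast_eq_zero_iff] at this
      exact (this.mul_left (A * B)).mul_left 6
  have hzero : ∀ n p : ℕ, n.Prime → p.Prime → p + 1 < n → (n : ZMod p) ≠ 0 := by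
    intro n p hn hp hpn h
    rw [ZMod.natCast_eq_zero_iff, Nat.prime_dvd_prime_iff_eq hp hn] at h
    omega
  have hAne : ∀ n p : ℕ, (A * n + 1).Prime → p.Prime → ¬p ∣ E → p + 1 < n →
      (n : ZMod p) ≠ -(A : ZMod p)⁻¹ := by
    intro n p hn hp hpE hpn h
    have := Fact.mk hp
    have h0 : ((A * n + 1 : ℕ) : ZMod p) = 0 := by
      push_cast
      rw [h, mul_neg, mul_inv_cancel₀ (hcop p hpE).1]
      ring
    rw [ZMod.natCast_eq_zero_iff, Nat.prime_dvd_prime_iff_eq hp hn] at h0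
    nlinarith
  have hBne : ∀ n p : ℕ, (B * n - 1).Prime → p.Prime → ¬p ∣ E → p + 1 < n →
      (n : ZMod p) ≠ (B : ZMod p)⁻¹ := by
    intro n p hn hp hpE hpn h
    have := Fact.mk hp
    have hpos : 1 ≤ B * n := by nlinarith
    have h0 : ((B * n - 1 : ℕ) : ZMod p) = 0 := by
      rw [Nat.cast_sub hpos]
      push_cast
      rw [h, mul_inv_cancel₀ (hcop p hpE).2.1]
      ring
    rw [ZMod.natCast_eq_zero_iff, Nat.prime_dvd_prime_iff_eq hp hn] at h0
    have : n ≤ B * n := Nat.le_mul_of_pos_left n hB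
    omega
  have hinvA : ∀ p : ℕ, p.Prime → ¬p ∣ E → -(A : ZMod p)⁻¹ ≠ 0 := by
    intro p hp hpE
    have := Fact.mk hp
    exact neg_ne_zero.2 (inv_ne_zero (hcop p hpE).1)
  have hinvB : ∀ p : ℕ, p.Prime → ¬p ∣ E → (B : ZMod p)⁻¹ ≠ 0 := by
    intro p hp hpE
    have := Fact.mk hp
    exact inv_ne_zero (hcop p hpE).2.1
  have hAB : ∀ p : ℕ, p.Prime → ¬p ∣ E → -(A : ZMod p)⁻¹ ≠ (B : ZMod p)⁻¹ := by
    intro p hp hpE h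
    have := Fact.mk hp
    have h' := hcop p hpE
    apply h'.2.2
    rw [← inv_neg, inv_inj] at h
    rw [← h]; ring
  refine ⟨fun hS => ?_, fun hS => ?_, fun hS => ?_⟩
  · refine (h₂ X L E S (fun p => {0, -(A : ZMod p)⁻¹}) hX hL hE0 hE (Dvd.intro _ rfl) hSX
      (fun p hp hpE => Finset.card_pair (hinvA p hp hpE).symm) ?_).trans ?_
    · intro n hn p hp hpE hpn hmem
      rw [Finset.mem_insert, Finset.mem_singleton] at hmem
      exact hmem.elim (hzero n p (hS n hn).1 hp hpn) (hAne n p (hS n hn).2 hp hpE hpn)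
    · gcongr; linarith
  · refine (h₂ X L E S (fun p => {0, (B : ZMod p)⁻¹}) hX hL hE0 hE (Dvd.intro _ rfl) hSX
      (fun p hp hpE => Finset.card_pair (hinvB p hp hpE).symm) ?_).trans ?_
    · intro n hn p hp hpE hpn hmem
      rw [Finset.mem_insert, Finset.mem_singleton] at hmem
      exact hmem.elim (hzero n p (hS n hn).1 hp hpn) (hBne n p (hS n hn).2 hp hpE hpn)
    · gcongr; linarith
  · refine (h₃ X L E S (fun p => {0, -(A : ZMod p)⁻¹, (B : ZMod p)⁻¹}) hX hL hE0 hE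
      (Dvd.intro _ rfl) hSX (fun p hp hpE => Finset.card_eq_three.2 ⟨_, _, _,
        (hinvA p hp hpE).symm, (hinvB p hp hpE).symm, hAB p hp hpE, rfl⟩) ?_).trans ?_
    · intro n hn p hp hpE hpn hmem
      rw [Finset.mem_insert, Finset.mem_insert, Finset.mem_singleton] at hmem
      rcases hmem with h | h | h
      · exact hzero n p (hS n hn).1 hp hpn h
      · exact hAne n p (hS n hn).2.1 hp hpE hpn h
      · exact hBne n p (hS n hn).2.2 hp hpE hpn h
    · gcongr; linarith

/-! ### From counts to reciprocal sums over primes in linear forms. -/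

/-- Dyadic decomposition: the block 2^j ≤ n < 2^(j+1) contributes O(M/(j+1)^κ), and only blocks with
j + 1 ≥ log u / log 2 occur, so the tail loses one power of the logarithm. -/
theorem sum_inv_le_of_card_le (κ : ℕ) (hκ : 2 ≤ κ) {M u : ℝ} (hM : 0 ≤ M) (hu : Real.exp 1 ≤ u)
    (Z : Finset ℕ) (hZu : ∀ n ∈ Z, u ≤ n)
    (hZ : ∀ X : ℝ, 2 ≤ X → ((Z.filter fun n : ℕ => (n : ℝ) ≤ X).card : ℝ) ≤
      M * (X / Real.log X ^ κ)) :
    ∑ n ∈ Z, (n : ℝ)⁻¹ ≤ 8 * M / Real.log u ^ (κ - 1) := by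
  have hl2 : 0 < Real.log 2 := Real.log_pos (by norm_num)
  have hl2' : 1 / 2 ≤ Real.log 2 := by linarith [Real.log_two_gt_d9]
  have hu0 : 0 < u := (Real.exp_pos 1).trans_le hu
  have hlu : 1 ≤ Real.log u := by rw [Real.le_log_iff_exp_le hu0]; exact hu
  set x : ℝ := Real.log u / Real.log 2 with hx
  have hx1 : 1 ≤ x := by
    rw [hx, le_div_iff₀ hl2]
    linarith [Real.log_two_lt_d9]
  have hx0 : 0 < x := by linarith
  set J : Finset ℕ := Z.image (Nat.log 2) with hJ
  have hJx : ∀ j ∈ J, x ≤ (j : ℝ) + 1 := by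
    intro j hj
    obtain ⟨n, hn, rfl⟩ := Finset.mem_image.1 hj
    have hun := hZu n hn
    have h1 : (n : ℝ) ≤ 2 ^ (Nat.log 2 n + 1) := by
      exact_mod_cast (Nat.lt_pow_succ_log_self (by norm_num) n).le
    have h2 := Real.log_le_log hu0 (hun.trans h1)
    rw [Real.log_pow] at h2
    rw [hx, div_le_iff₀ hl2]
    exact_mod_cast h2
  have hblock : ∀ j ∈ J, ∑ n ∈ Z.filter (fun n => Nat.log 2 n = j), (n : ℝ)⁻¹ ≤
      2 * M / Real.log 2 ^ κ * (((j : ℝ) + 1) ^ κ)⁻¹ := by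
    intro j hj
    have hsub : Z.filter (fun n => Nat.log 2 n = j) ⊆
        Z.filter fun n : ℕ => (n : ℝ) ≤ 2 ^ (j + 1) := by
      intro n hn
      rw [Finset.mem_filter] at hn ⊢
      refine ⟨hn.1, ?_⟩
      rw [← hn.2]
      exact_mod_cast (Nat.lt_pow_succ_log_self (by norm_num) n).le
    have hcard : ((Z.filter (fun n => Nat.log 2 n = j)).card : ℝ) ≤
        M * (2 ^ (j + 1) / (((j : ℝ) + 1) * Real.log 2) ^ κ) := by
      have h1 := hZ (2 ^ (j + 1)) (by
        calc (2 : ℝ) = 2 ^ 1 := by norm_num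
          _ ≤ 2 ^ (j + 1) := pow_le_pow_right₀ (by norm_num) (by omega))
      rw [Real.log_pow] at h1
      push_cast at h1
      refine le_trans ?_ h1
      exact_mod_cast Finset.card_le_card hsub
    calc ∑ n ∈ Z.filter (fun n => Nat.log 2 n = j), (n : ℝ)⁻¹
        ≤ ∑ n ∈ Z.filter (fun n => Nat.log 2 n = j), ((2 : ℝ) ^ j)⁻¹ := by
          refine Finset.sum_le_sum fun n hn => ?_
          rw [Finset.mem_filter] at hn
          have hn0 : n ≠ 0 := by
            rintro rfl
            have := hZu 0 hn.1
            push_cast at this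
            linarith
          have : 2 ^ j ≤ n := by
            rw [← hn.2]; exact Nat.pow_log_le_self 2 hn0
          gcongr
          exact_mod_cast this
      _ = (Z.filter (fun n => Nat.log 2 n = j)).card * ((2 : ℝ) ^ j)⁻¹ := by
          rw [Finset.sum_const, nsmul_eq_mul]
      _ ≤ M * (2 ^ (j + 1) / (((j : ℝ) + 1) * Real.log 2) ^ κ) * ((2 : ℝ) ^ j)⁻¹ := by gcongr
      _ = _ := by
          rw [mul_pow, pow_succ]
          field_simp
  have hsq : ∑ j ∈ J, (((j : ℝ) + 1) ^ 2)⁻¹ ≤ 2 / x := by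
    obtain ⟨B, hB⟩ := J.exists_nat_subset_range
    set m : ℕ := ⌈x⌉₊ with hm
    have hm1 : 1 ≤ m := Nat.one_le_iff_ne_zero.2 (Nat.ceil_pos.2 hx0).ne'
    have h1 : ∑ j ∈ J, (((j : ℝ) + 1) ^ 2)⁻¹ ≤
        ∑ i ∈ Finset.Ioo (m - 1) (B + 1), ((i : ℝ) ^ 2)⁻¹ := by
      refine sum_le_sum_of_injOn_of_le (fun j => j + 1) ?_ ?_ ?_ ?_
      · intro j hj
        have h1 := Nat.ceil_le.2 (show x ≤ ((j + 1 : ℕ) : ℝ) by push_cast; exact hJx j hj)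
        have h2 := Finset.mem_range.1 (hB hj)
        rw [Finset.mem_Ioo]
        omega
      · intro a _ b _ hab
        simpa using hab
      · intro i _
        positivity
      · intro j _
        push_cast
        exact le_rfl
    refine h1.trans ((sum_Ioo_inv_sq_le (m - 1) (B + 1)).trans ?_)
    have h2 : ((m - 1 : ℕ) : ℝ) + 1 = m := by
      rw [Nat.cast_sub hm1]; ring
    rw [h2]
    gcongr
    exact Nat.le_ceil x
  have hpow : ∑ j ∈ J, (((j : ℝ) + 1) ^ κ)⁻¹ ≤ 2 / x ^ (κ - 1) := by
    calc ∑ j ∈ J, (((j : ℝ) + 1) ^ κ)⁻¹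
        ≤ ∑ j ∈ J, (x ^ (κ - 2))⁻¹ * (((j : ℝ) + 1) ^ 2)⁻¹ := by
          refine Finset.sum_le_sum fun j hj => ?_
          have := hJx j hj
          rw [← mul_inv]
          gcongr
          calc x ^ (κ - 2) * ((j : ℝ) + 1) ^ 2 ≤ ((j : ℝ) + 1) ^ (κ - 2) * ((j : ℝ) + 1) ^ 2 := by
                gcongr
            _ = ((j : ℝ) + 1) ^ κ := by rw [← pow_add]; congr 1; omega
      _ = (x ^ (κ - 2))⁻¹ * ∑ j ∈ J, (((j : ℝ) + 1) ^ 2)⁻¹ := by rw [Finset.mul_sum]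
      _ ≤ (x ^ (κ - 2))⁻¹ * (2 / x) := by gcongr
      _ = 2 / x ^ (κ - 1) := by
          rw [show κ - 1 = (κ - 2) + 1 by omega, pow_succ]
          field_simp
  rw [← Finset.sum_fiberwise_of_maps_to (s := Z) (t := J) (g := Nat.log 2)
    fun n hn => Finset.mem_image_of_mem _ hn]
  calc _ ≤ ∑ j ∈ J, 2 * M / Real.log 2 ^ κ * (((j : ℝ) + 1) ^ κ)⁻¹ := Finset.sum_le_sum hblock
    _ = 2 * M / Real.log 2 ^ κ * ∑ j ∈ J, (((j : ℝ) + 1) ^ κ)⁻¹ := by rw [Finset.mul_sum]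
    _ ≤ 2 * M / Real.log 2 ^ κ * (2 / x ^ (κ - 1)) := by gcongr
    _ = 4 * M / Real.log 2 / Real.log u ^ (κ - 1) := by
        obtain ⟨m, rfl⟩ : ∃ m, κ = m + 1 := ⟨κ - 1, by omega⟩
        rw [hx, Nat.add_sub_cancel, div_pow, pow_succ]
        field_simp
        ring
    _ ≤ _ := by
        gcongr
        rw [div_le_iff₀ hl2]
        nlinarith

/-- The bounds for primes represented by two or three linear forms, with coefficients up to `2y`. -/
theorem exists_linear_forms_bounds :
    ∃ C y₀ : ℝ, 1 ≤ C ∧ ∀ y : ℝ, y₀ ≤ y → ∀ A B : ℕ, 0 < A → 0 < B → (A : ℝ) ≤ 2 * y →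
      (B : ℝ) ≤ 2 * y → ∀ Z : Finset ℕ, (∀ n ∈ Z, n.Prime) →
      (∀ u : ℝ, Real.exp 1 ≤ u → (∀ n ∈ Z, u ≤ n) →
        ((∀ n ∈ Z, (A * n + 1).Prime) →
          ∑ n ∈ Z, (n : ℝ)⁻¹ ≤ C * logLog y ^ 2 / Real.log u) ∧
        ((∀ n ∈ Z, (B * n - 1).Prime) →
          ∑ n ∈ Z, (n : ℝ)⁻¹ ≤ C * logLog y ^ 2 / Real.log u) ∧
        ((∀ n ∈ Z, (A * n + 1).Prime ∧ (B * n - 1).Prime) →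
          ∑ n ∈ Z, (n : ℝ)⁻¹ ≤ C * logLog y ^ 3 / Real.log u ^ 2)) ∧
      (∀ X : ℝ, 2 ≤ X → (∀ n ∈ Z, (A * n + 1).Prime ∧ (B * n - 1).Prime) → (∀ n ∈ Z, (n : ℝ) ≤ X) →
        (Z.card : ℝ) ≤ C * (X * logLog y ^ 3 / Real.log X ^ 3)) := by
  obtain ⟨C, hC, h⟩ := exists_card_prime_linear_le
  refine ⟨64 * C + 1, max 96 (Real.exp (Real.exp (Real.log 4))), by linarith, ?_⟩
  intro y hy A B hA hB hAy hBy Z hZ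
  have hy96 : 96 ≤ y := (le_max_left _ _).trans hy
  have hy0 : 0 < y := by linarith
  have hyexp : Real.exp (Real.exp (Real.log 4)) ≤ y := (le_max_right _ _).trans hy
  have hlogy : 4 ≤ Real.log y := by
    rw [Real.le_log_iff_exp_le hy0]
    rwa [Real.exp_log (by norm_num)] at hyexp
  -- For A, B ≤ 2y the number 6AB(A + B) is at most 96 y³, hence at most y⁴ since y ≥ 96.
  set L : ℝ := 4 * Real.log y with hLdef
  have hL : Real.exp 1 ≤ L := by
    linarith [Real.exp_one_lt_d9]
  have hL2 : Real.log 4 ≤ logLog y := Real.log_le_log (by norm_num) hlogy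
  have hlogL : Real.log L ≤ 2 * logLog y := by
    rw [hLdef, Real.log_mul (by norm_num) (by linarith)]
    rw [logLog] at *
    linarith
  have hl4 : 0 < Real.log 4 := Real.log_pos (by norm_num)
  have hL20 : 0 ≤ logLog y := by linarith
  have hlogL0 : 0 ≤ Real.log L := Real.log_nonneg (by linarith)
  have hE : Real.log (6 * (A * B * (A + B)) : ℕ) ≤ L := by
    have hA' : (0 : ℝ) < A := by exact_mod_cast hA
    have hB' : (0 : ℝ) < B := by exact_mod_cast hB
    rw [hLdef, show (4 : ℝ) * Real.log y = Real.log (y ^ 4) by rw [Real.log_pow]; norm_num]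
    refine Real.log_le_log (by positivity) ?_
    push_cast
    calc (6 : ℝ) * (A * B * (A + B)) ≤ 6 * (2 * y * (2 * y) * (2 * y + 2 * y)) := by gcongr
      _ = 96 * y ^ 3 := by ring
      _ ≤ y * y ^ 3 := by gcongr
      _ = y ^ 4 := by ring
  have hfilt : ∀ X : ℝ, ∀ n ∈ Z.filter (fun n : ℕ => (n : ℝ) ≤ X), (n : ℝ) ≤ X :=
    fun X n hn => (Finset.mem_filter.1 hn).2
  have hfz : ∀ X : ℝ, ∀ n ∈ Z.filter (fun n : ℕ => (n : ℝ) ≤ X), n ∈ Z :=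
    fun X n hn => (Finset.mem_filter.1 hn).1
  have hconv : ∀ (κ : ℕ) (X : ℝ), 2 ≤ X → κ ≤ 3 → C * (X * Real.log L ^ κ / Real.log X ^ κ) ≤
      (8 * C * logLog y ^ κ) * (X / Real.log X ^ κ) := by
    intro κ X hX hκ
    have hlX : 0 < Real.log X := Real.log_pos (by linarith)
    have h1 : Real.log L ^ κ ≤ 8 * logLog y ^ κ := by
      calc Real.log L ^ κ ≤ (2 * logLog y) ^ κ := by gcongr
        _ = 2 ^ κ * logLog y ^ κ := mul_pow _ _ _
        _ ≤ 2 ^ 3 * logLog y ^ κ := by gcongr; norm_num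
        _ = _ := by norm_num
    calc C * (X * Real.log L ^ κ / Real.log X ^ κ) ≤
          C * (X * (8 * logLog y ^ κ) / Real.log X ^ κ) := by gcongr
      _ = _ := by ring
  refine ⟨fun u hu hZu => ⟨fun hA1 => ?_, fun hB1 => ?_, fun hAB => ?_⟩, fun X hX hAB hZX => ?_⟩
  · have hlu : 0 < Real.log u := Real.log_pos (by linarith [Real.exp_one_gt_d9])
    have := sum_inv_le_of_card_le 2 le_rfl (M := 8 * C * logLog y ^ 2) (by positivity) hu Z hZu
      fun X hX => ((h A B X L _ hA hB hX hL hE (hfilt X)).1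
        fun n hn => ⟨hZ n (hfz X n hn), hA1 n (hfz X n hn)⟩).trans (hconv 2 X hX (by norm_num))
    refine this.trans ?_
    rw [pow_one]
    refine div_le_div_of_nonneg_right ?_ hlu.le
    nlinarith [sq_nonneg (logLog y)]
  · have hlu : 0 < Real.log u := Real.log_pos (by linarith [Real.exp_one_gt_d9])
    have := sum_inv_le_of_card_le 2 le_rfl (M := 8 * C * logLog y ^ 2) (by positivity) hu Z hZu
      fun X hX => ((h A B X L _ hA hB hX hL hE (hfilt X)).2.1
        fun n hn => ⟨hZ n (hfz X n hn), hB1 n (hfz X n hn)⟩).trans (hconv 2 X hX (by norm_num))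
    refine this.trans ?_
    rw [pow_one]
    refine div_le_div_of_nonneg_right ?_ hlu.le
    nlinarith [sq_nonneg (logLog y)]
  · have hlu : 0 < Real.log u := Real.log_pos (by linarith [Real.exp_one_gt_d9])
    have := sum_inv_le_of_card_le 3 (by norm_num) (M := 8 * C * logLog y ^ 3) (by positivity) hu Z
      hZu fun X hX => ((h A B X L _ hA hB hX hL hE (hfilt X)).2.2
        fun n hn => ⟨hZ n (hfz X n hn), hAB n (hfz X n hn)⟩).trans (hconv 3 X hX le_rfl)
    refine this.trans ?_
    refine div_le_div_of_nonneg_right ?_ (by positivity)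
    have : 0 ≤ logLog y ^ 3 := by positivity
    nlinarith
  · have hlX : 0 < Real.log X := Real.log_pos (by linarith)
    refine (((h A B X L Z hA hB hX hL hE hZX).2.2 fun n hn => ⟨hZ n hn, hAB n hn⟩).trans
      (hconv 3 X hX le_rfl)).trans ?_
    have : 0 ≤ X * logLog y ^ 3 / Real.log X ^ 3 := by positivity
    calc 8 * C * logLog y ^ 3 * (X / Real.log X ^ 3) =
          8 * C * (X * logLog y ^ 3 / Real.log X ^ 3) := by ring
      _ ≤ _ := by nlinarith

/-- Here n runs over the candidates for one special prime, and I, J index the entries on the two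
sides whose largest prime factor it is. If neither side has two such entries, the sieve supplies the
saving. Otherwise the weight is at most n⁻², and convergence beats all the logarithms without any
sieving. The right side has one factor per entry in every case. -/
theorem exists_special_prime_sum_le :
    ∃ C y₀ : ℝ, 1 ≤ C ∧ ∀ y : ℝ, y₀ ≤ y → ∀ {ι : Type} (I J : Finset ι) (u : ι → ℝ)
      (Z : Finset ℕ), (∀ i, i ∈ I ∨ i ∈ J → Real.exp 1 ≤ u i) → (I.Nonempty ∨ J.Nonempty) →
      (∀ n ∈ Z, n.Prime ∧ ∀ i, i ∈ I ∨ i ∈ J → u i ≤ n) →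
      (I.card = 1 → ∃ A : ℕ, 0 < A ∧ (A : ℝ) ≤ 2 * y ∧ ∀ n ∈ Z, (A * n + 1).Prime) →
      (J.card = 1 → ∃ B : ℕ, 0 < B ∧ (B : ℝ) ≤ 2 * y ∧ ∀ n ∈ Z, (B * n - 1).Prime) →
      ∑ n ∈ Z, ((n : ℝ) ^ max I.card J.card)⁻¹ ≤
        (∏ i ∈ I, C * logLog y ^ 2 / Real.log (u i)) *
          ∏ i ∈ J, C * logLog y ^ 2 / Real.log (u i) := by
  obtain ⟨C, y₀, hC, h⟩ := exists_linear_forms_bounds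
  have hs : Summable fun n : ℕ => 1 / (n : ℝ) ^ (3 / 2 : ℝ) :=
    Real.summable_one_div_nat_rpow.2 (by norm_num)
  set K : ℝ := ∑' n : ℕ, 1 / (n : ℝ) ^ (3 / 2 : ℝ) with hK
  have hK0 : 0 ≤ K := tsum_nonneg fun n => by positivity
  refine ⟨C + 64 * (K + 1), max y₀ (Real.exp (Real.exp 1)), by linarith, ?_⟩
  intro y hy ι I J u Z hu hne hZ hA hB
  have hy1 : y₀ ≤ y := (le_max_left _ _).trans hy
  have hyexp : Real.exp (Real.exp 1) ≤ y := (le_max_right _ _).trans hy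
  have hy0 : 0 < y := (Real.exp_pos _).trans_le hyexp
  have hlogy : Real.exp 1 ≤ Real.log y := by
    rw [Real.le_log_iff_exp_le hy0]; exact hyexp
  have hL2 : 1 ≤ logLog y := by
    rw [logLog, Real.le_log_iff_exp_le ((Real.exp_pos 1).trans_le hlogy)]; exact hlogy
  have h2y : (1 : ℝ) ≤ 2 * y := by
    have := Real.add_one_le_exp (Real.exp 1)
    linarith [Real.exp_pos 1]
  set C' : ℝ := C + 64 * (K + 1) with hC'
  have hlu : ∀ i, i ∈ I ∨ i ∈ J → 1 ≤ Real.log (u i) := fun i hi => by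
    rw [Real.le_log_iff_exp_le ((Real.exp_pos 1).trans_le (hu i hi))]; exact hu i hi
  have hCC : C * logLog y ^ 2 ≤ C' * logLog y ^ 2 := by
    gcongr; linarith
  by_cases hmax : 2 ≤ max I.card J.card
  · set e : ℕ := max I.card J.card with he
    -- Every log u_i is at most log n, and log² n ≤ 64 n^(1/4). So the at most 2e logarithms weaken
    -- n^(-e) only to 64^e n^(-3e/4), which is at most 64^e n^(-3/2) because e ≥ 2.
    have hterm : ∀ n ∈ Z, ((n : ℝ) ^ e)⁻¹ * ((∏ i ∈ I, Real.log (u i)) * ∏ i ∈ J, Real.log (u i)) ≤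
        64 ^ e * (1 / (n : ℝ) ^ (3 / 2 : ℝ)) := by
      intro n hn
      have hn' := hZ n hn
      have hn1 : (1 : ℝ) ≤ n := by exact_mod_cast hn'.1.one_le
      have hn0 : (0 : ℝ) < n := by linarith
      have hlogn : 1 ≤ Real.log n := by
        obtain ⟨i, hi⟩ : ∃ i, i ∈ I ∨ i ∈ J := by
          rcases hne with ⟨i, hi⟩ | ⟨i, hi⟩
          · exact ⟨i, Or.inl hi⟩
          · exact ⟨i, Or.inr hi⟩
        exact (hlu i hi).trans (Real.log_le_log ((Real.exp_pos 1).trans_le (hu i hi)) (hn'.2 i hi))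
      have hb : ∀ F : Finset ι, (∀ i ∈ F, i ∈ I ∨ i ∈ J) → F.card ≤ e →
          ∏ i ∈ F, Real.log (u i) ≤ Real.log n ^ e := by
        intro F hF hFe
        calc ∏ i ∈ F, Real.log (u i) ≤ ∏ i ∈ F, Real.log n := by
              refine Finset.prod_le_prod (fun i hi => by linarith [hlu i (hF i hi)]) fun i hi => ?_
              exact Real.log_le_log ((Real.exp_pos 1).trans_le (hu i (hF i hi))) (hn'.2 i (hF i hi))
          _ = Real.log n ^ F.card := Finset.prod_const _
          _ ≤ _ := pow_le_pow_right₀ hlogn hFe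
      have hl8 : Real.log n ≤ 8 * (n : ℝ) ^ (1 / 8 : ℝ) := by
        have := Real.log_le_rpow_div hn0.le (ε := 1 / 8) (by norm_num)
        linarith
      have hl2 : Real.log n ^ 2 ≤ 64 * (n : ℝ) ^ (1 / 4 : ℝ) := by
        calc Real.log n ^ 2 ≤ (8 * (n : ℝ) ^ (1 / 8 : ℝ)) ^ 2 := by gcongr
          _ = 64 * ((n : ℝ) ^ (1 / 8 : ℝ)) ^ 2 := by ring
          _ = _ := by
            rw [← Real.rpow_natCast ((n : ℝ) ^ (1 / 8 : ℝ)), ← Real.rpow_mul hn0.le]; norm_num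
      have hJ0 : 0 ≤ ∏ i ∈ J, Real.log (u i) :=
        Finset.prod_nonneg fun i hi => by linarith [hlu i (Or.inr hi)]
      have hn34 : (n : ℝ) ^ (-(3 / 4) : ℝ) ≤ 1 :=
        Real.rpow_le_one_of_one_le_of_nonpos hn1 (by norm_num)
      calc ((n : ℝ) ^ e)⁻¹ * ((∏ i ∈ I, Real.log (u i)) * ∏ i ∈ J, Real.log (u i))
          ≤ ((n : ℝ) ^ e)⁻¹ * (Real.log n ^ e * Real.log n ^ e) := by
            gcongr
            · exact hb I (fun i hi => Or.inl hi) (le_max_left _ _)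
            · exact hb J (fun i hi => Or.inr hi) (le_max_right _ _)
        _ = ((n : ℝ)⁻¹ * Real.log n ^ 2) ^ e := by
            rw [mul_pow, inv_pow, ← pow_mul, mul_comm 2 e, pow_mul]; ring
        _ ≤ ((n : ℝ)⁻¹ * (64 * (n : ℝ) ^ (1 / 4 : ℝ))) ^ e := by gcongr
        _ = (64 * (n : ℝ) ^ (-(3 / 4) : ℝ)) ^ e := by
            rw [← Real.rpow_neg_one, mul_left_comm, ← Real.rpow_add hn0]
            norm_num
        _ = 64 ^ e * ((n : ℝ) ^ (-(3 / 4) : ℝ)) ^ e := mul_pow _ _ _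
        _ ≤ 64 ^ e * ((n : ℝ) ^ (-(3 / 4) : ℝ)) ^ 2 := by
            gcongr 64 ^ e * ?_
            exact pow_le_pow_of_le_one (by positivity) hn34 hmax
        _ = _ := by
            rw [← Real.rpow_natCast ((n : ℝ) ^ (-(3 / 4) : ℝ)), ← Real.rpow_mul hn0.le, one_div,
              ← Real.rpow_neg hn0.le]
            norm_num
    have hlogpos : 0 < (∏ i ∈ I, Real.log (u i)) * ∏ i ∈ J, Real.log (u i) :=
      mul_pos (Finset.prod_pos fun i hi => by linarith [hlu i (Or.inl hi)])
        (Finset.prod_pos fun i hi => by linarith [hlu i (Or.inr hi)])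
    have hrhs : (∏ i ∈ I, C' * logLog y ^ 2 / Real.log (u i)) *
        ∏ i ∈ J, C' * logLog y ^ 2 / Real.log (u i) =
        (C' * logLog y ^ 2) ^ (I.card + J.card) /
          ((∏ i ∈ I, Real.log (u i)) * ∏ i ∈ J, Real.log (u i)) := by
      rw [Finset.prod_div_distrib, Finset.prod_div_distrib, Finset.prod_const, Finset.prod_const,
        pow_add, div_mul_div_comm]
    rw [hrhs, le_div_iff₀ hlogpos, Finset.sum_mul]
    have hbase : 64 * (K + 1) ≤ C' * logLog y ^ 2 := by
      have h1 : 1 ≤ logLog y ^ 2 := one_le_pow₀ hL2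
      have h2 : 64 * (K + 1) ≤ C' := by linarith
      calc 64 * (K + 1) ≤ C' * 1 := by linarith
        _ ≤ _ := mul_le_mul_of_nonneg_left h1 (by linarith)
    calc _ ≤ ∑ n ∈ Z, 64 ^ e * (1 / (n : ℝ) ^ (3 / 2 : ℝ)) := Finset.sum_le_sum hterm
      _ = 64 ^ e * ∑ n ∈ Z, 1 / (n : ℝ) ^ (3 / 2 : ℝ) := by rw [Finset.mul_sum]
      _ ≤ 64 ^ e * K := by
          gcongr
          exact hs.sum_le_tsum Z fun n _ => by positivity
      _ ≤ 64 ^ e * (K + 1) ^ e := by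
          gcongr
          have : K + 1 ≤ (K + 1) ^ e := le_self_pow₀ (by linarith) (by omega)
          linarith
      _ = (64 * (K + 1)) ^ e := (mul_pow _ _ _).symm
      _ ≤ (C' * logLog y ^ 2) ^ e := by gcongr
      _ ≤ _ := pow_le_pow_right₀ (by linarith) (max_le (by omega) (by omega))
  · have hI1 : I.card ≤ 1 := by
      have := le_max_left I.card J.card; omega
    have hJ1 : J.card ≤ 1 := by
      have := le_max_right I.card J.card; omega
    have hZp : ∀ n ∈ Z, n.Prime := fun n hn => (hZ n hn).1
    rcases Nat.lt_or_ge I.card 1 with hI | hI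
    · have hI0 : I = ∅ := Finset.card_eq_zero.1 (by omega)
      have hJne : J.Nonempty := by simpa [hI0] using hne
      have hJc : J.card = 1 := le_antisymm hJ1 hJne.card_pos
      obtain ⟨j, rfl⟩ := Finset.card_eq_one.1 hJc
      obtain ⟨B, hB0, hBy, hBZ⟩ := hB hJc
      have huj := hu j (by simp)
      have := ((h y hy1 1 B one_pos hB0 (by simpa using h2y) hBy Z hZp).1 (u j) huj
        fun n hn => (hZ n hn).2 j (by simp)).2.1 hBZ
      subst hI0
      simp only [Finset.card_empty, Finset.card_singleton, Finset.prod_empty,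
        Finset.prod_singleton, one_mul, zero_le, sup_of_le_right, pow_one]
      refine this.trans ?_
      have := hlu j (by simp)
      gcongr
    · have hIc : I.card = 1 := le_antisymm hI1 hI
      obtain ⟨i, rfl⟩ := Finset.card_eq_one.1 hIc
      obtain ⟨A, hA0, hAy, hAZ⟩ := hA hIc
      have hui := hu i (by simp)
      have hlui := hlu i (by simp)
      rcases Nat.lt_or_ge J.card 1 with hJ | hJ
      · have hJ0 : J = ∅ := Finset.card_eq_zero.1 (by omega)
        have := ((h y hy1 A 1 hA0 one_pos hAy (by simpa using h2y) Z hZp).1 (u i) hui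
          fun n hn => (hZ n hn).2 i (by simp)).1 hAZ
        subst hJ0
        simp only [Finset.card_empty, Finset.card_singleton, Finset.prod_empty,
          Finset.prod_singleton, mul_one, zero_le, sup_of_le_left, pow_one]
        refine this.trans ?_
        gcongr
      · have hJc : J.card = 1 := le_antisymm hJ1 hJ
        obtain ⟨j, rfl⟩ := Finset.card_eq_one.1 hJc
        obtain ⟨B, hB0, hBy, hBZ⟩ := hB hJc
        have hluj := hlu j (by simp)
        have huj := hu j (by simp)
        -- The same n is at least u_i and u_j, so the three-form sieve applies from their maximum;
        -- the square of its logarithm dominates log u_i log u_j.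
        have hmaxu : Real.exp 1 ≤ max (u i) (u j) := hui.trans (le_max_left _ _)
        have hlogmax : Real.log (u i) * Real.log (u j) ≤ Real.log (max (u i) (u j)) ^ 2 := by
          have h1 : Real.log (u i) ≤ Real.log (max (u i) (u j)) :=
            Real.log_le_log ((Real.exp_pos 1).trans_le hui) (le_max_left _ _)
          have h2 : Real.log (u j) ≤ Real.log (max (u i) (u j)) :=
            Real.log_le_log ((Real.exp_pos 1).trans_le huj) (le_max_right _ _)
          rw [sq]
          exact mul_le_mul h1 h2 (by linarith) (by linarith)
        have := ((h y hy1 A B hA0 hB0 hAy hBy Z hZp).1 (max (u i) (u j)) hmaxu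
          fun n hn => max_le ((hZ n hn).2 i (by simp)) ((hZ n hn).2 j (by simp))).2.2
          fun n hn => ⟨hAZ n hn, hBZ n hn⟩
        simp only [Finset.card_singleton, Finset.prod_singleton, max_self, pow_one]
        refine this.trans ?_
        calc C * logLog y ^ 3 / Real.log (max (u i) (u j)) ^ 2
            ≤ C * logLog y ^ 4 / (Real.log (u i) * Real.log (u j)) := by
              gcongr; norm_num
          _ ≤ (C' * C') * logLog y ^ 4 / (Real.log (u i) * Real.log (u j)) := by
              gcongr
              nlinarith
          _ = _ := by field_simp

/-! ### Sums over trees of prefixes -/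

/-- The truncation of a sequence to its first `n` terms. -/
def truncSeq (n : ℕ) (s : ℕ → ℕ) (a : ℕ) : ℕ := if a < n then s a else 0

theorem truncSeq_eq_iff {n : ℕ} {s t : ℕ → ℕ} :
    truncSeq n s = truncSeq n t ↔ ∀ a < n, s a = t a := by
  constructor
  · intro h a ha
    simpa [truncSeq, ha] using congrFun h a
  · intro h
    funext a
    by_cases ha : a < n
    · simp [truncSeq, ha, h a ha]
    · simp [truncSeq, ha]

open Classical in
-- Induction on the depth of the tree of prefixes: below any fixed prefix the next terms have total
-- weight at most σ, uniformly in the prefix.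
theorem sum_prod_truncSeq_le {α : Type*} (𝓕 : Finset α) (τ : α → ℕ → ℕ) (w : ℕ → ℕ → ℝ)
    (σ : ℕ → ℝ) (n : ℕ) (hw : ∀ a t, 0 ≤ w a t) (hσ : ∀ a < n, 0 ≤ σ a)
    (h : ∀ a < n, ∀ x ∈ 𝓕,
      ∑ t ∈ (𝓕.filter fun x' => ∀ b < a, τ x' b = τ x b).image (fun x' => τ x' a), w a t ≤ σ a) :
    ∑ g ∈ 𝓕.image (fun x => truncSeq n (τ x)), ∏ a ∈ Finset.range n, w a (g a) ≤
      ∏ a ∈ Finset.range n, σ a := by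
  induction n with
  | zero =>
    rw [Finset.range_zero, Finset.prod_empty]
    simp only [Finset.prod_empty, Finset.sum_const, nsmul_eq_mul, mul_one]
    have : 𝓕.image (fun x => truncSeq 0 (τ x)) ⊆ {fun _ => 0} := by
      intro g hg
      obtain ⟨x, _, rfl⟩ := Finset.mem_image.1 hg
      exact Finset.mem_singleton.2 (funext fun a => by simp [truncSeq])
    exact_mod_cast (Finset.card_le_card this).trans (Finset.card_singleton _).le
  | succ n ih =>
    have ih' := ih (fun a ha => hσ a (by omega)) (fun a ha => h a (by omega))
    have htr : ∀ s, truncSeq n (truncSeq (n + 1) s) = truncSeq n s := fun s =>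
      truncSeq_eq_iff.2 fun a ha => by simp [truncSeq, Nat.lt_succ_of_lt ha]
    rw [← Finset.sum_fiberwise_of_maps_to (s := 𝓕.image fun x => truncSeq (n + 1) (τ x))
      (t := 𝓕.image fun x => truncSeq n (τ x)) (g := truncSeq n), Finset.prod_range_succ]
    · calc _ ≤ ∑ g ∈ 𝓕.image (fun x => truncSeq n (τ x)),
            (∏ a ∈ Finset.range n, w a (g a)) * σ n := by
            refine Finset.sum_le_sum fun g hg => ?_
            obtain ⟨x, hx, rfl⟩ := Finset.mem_image.1 hg
            have h1 : ∀ s ∈ (𝓕.image fun x => truncSeq (n + 1) (τ x)).filter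
                (fun s => truncSeq n s = truncSeq n (τ x)),
                ∏ a ∈ Finset.range (n + 1), w a (s a) =
                  (∏ a ∈ Finset.range n, w a (truncSeq n (τ x) a)) * w n (s n) := by
              intro s hs
              rw [Finset.prod_range_succ]
              congr 1
              refine Finset.prod_congr rfl fun a ha => ?_
              rw [← (Finset.mem_filter.1 hs).2]
              simp [truncSeq, Finset.mem_range.1 ha]
            rw [Finset.sum_congr rfl h1, ← Finset.mul_sum]
            refine mul_le_mul_of_nonneg_left ?_ (Finset.prod_nonneg fun a _ => hw a _)
            refine le_trans ?_ (h n (by omega) x hx)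
            refine sum_le_sum_of_injOn_of_le (fun s => s n) ?_ ?_ (fun t _ => hw n t)
              fun s _ => le_rfl
            · intro s hs
              rw [Finset.mem_filter] at hs
              obtain ⟨x', hx', rfl⟩ := Finset.mem_image.1 hs.1
              rw [htr, truncSeq_eq_iff] at hs
              exact Finset.mem_image.2 ⟨x', Finset.mem_filter.2 ⟨hx', hs.2⟩,
                by simp [truncSeq]⟩
            · intro s hs t ht hst
              have hs' := Finset.mem_filter.1 (Finset.mem_coe.1 hs)
              have ht' := Finset.mem_filter.1 (Finset.mem_coe.1 ht)
              obtain ⟨x₁, _, rfl⟩ := Finset.mem_image.1 hs'.1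
              obtain ⟨x₂, _, rfl⟩ := Finset.mem_image.1 ht'.1
              have h2 := hs'.2.trans ht'.2.symm
              rw [htr, htr, truncSeq_eq_iff] at h2
              refine truncSeq_eq_iff.2 fun a ha => ?_
              rcases Nat.lt_succ_iff_lt_or_eq.1 ha with ha | rfl
              · exact h2 a ha
              · simpa [truncSeq] using hst
        _ = (∑ g ∈ 𝓕.image (fun x => truncSeq n (τ x)), ∏ a ∈ Finset.range n, w a (g a)) * σ n := by
            rw [Finset.sum_mul]
        _ ≤ _ := mul_le_mul_of_nonneg_right ih' (hσ n (by omega))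
    · intro s hs
      obtain ⟨x, hx, rfl⟩ := Finset.mem_image.1 hs
      exact Finset.mem_image.2 ⟨x, hx, (htr _).symm⟩

open Classical in
-- For use with τ listing the special primes in increasing order: the last choice is counted for a
-- fixed prefix, the earlier ones are summed along the tree.
theorem card_le_of_prefix_bounds {α : Type*} (𝓕 : Finset α) (τ : α → ℕ → ℕ) (w : ℕ → ℕ → ℝ)
    (σ : ℕ → ℝ) (n : ℕ) (K : ℝ) (hK : 0 ≤ K) (hw : ∀ a t, 0 ≤ w a t) (hσ : ∀ a < n, 0 ≤ σ a)
    (h : ∀ a < n, ∀ x ∈ 𝓕,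
      ∑ t ∈ (𝓕.filter fun x' => ∀ b < a, τ x' b = τ x b).image (fun x' => τ x' a), w a t ≤ σ a)
    (htop : ∀ x ∈ 𝓕, ((𝓕.filter fun x' => ∀ b < n, τ x' b = τ x b).card : ℝ) ≤
      K * ∏ a ∈ Finset.range n, w a (τ x a)) :
    (𝓕.card : ℝ) ≤ K * ∏ a ∈ Finset.range n, σ a := by
  rw [Finset.card_eq_sum_card_image (fun x => truncSeq n (τ x)) 𝓕]
  push_cast
  calc _ ≤ ∑ g ∈ 𝓕.image (fun x => truncSeq n (τ x)), K * ∏ a ∈ Finset.range n, w a (g a) := by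
        refine Finset.sum_le_sum fun g hg => ?_
        obtain ⟨x, hx, rfl⟩ := Finset.mem_image.1 hg
        simp only [truncSeq_eq_iff]
        refine (htop x hx).trans (le_of_eq ?_)
        congr 1
        refine Finset.prod_congr rfl fun a ha => ?_
        simp [truncSeq, Finset.mem_range.1 ha]
    _ = K * ∑ g ∈ 𝓕.image (fun x => truncSeq n (τ x)), ∏ a ∈ Finset.range n, w a (g a) := by
        rw [Finset.mul_sum]
    _ ≤ _ := mul_le_mul_of_nonneg_left (sum_prod_truncSeq_le 𝓕 τ w σ n hw hσ h) hK

/-! ### The largest prime factor and the smooth part -/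

theorem le_largestPrimeFactor {n p : ℕ} (hn : n ≠ 0) (hp : p.Prime) (h : p ∣ n) :
    p ≤ largestPrimeFactor n :=
  le_max_of_le_right (Finset.le_sup (f := id) (Nat.mem_primeFactors.2 ⟨hp, h, hn⟩))

theorem largestPrimeFactor_mem {n : ℕ} (h : 1 < largestPrimeFactor n) :
    (largestPrimeFactor n).Prime ∧ largestPrimeFactor n ∣ n := by
  have hsup : largestPrimeFactor n = n.primeFactors.sup id := by
    rw [largestPrimeFactor] at h ⊢
    omega
  have hne : n.primeFactors.Nonempty := by
    by_contra hcon
    rw [Finset.not_nonempty_iff_eq_empty] at hcon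
    rw [hsup, hcon] at h
    simp at h
  obtain ⟨p, hp, hpe⟩ := Finset.exists_mem_eq_sup n.primeFactors hne id
  rw [hsup, hpe]
  rw [Nat.mem_primeFactors] at hp
  exact ⟨hp.1, hp.2.1⟩

open Classical in
/-- The part of `n` composed of primes at most `V`. -/
noncomputable def smoothPart (V : ℝ) (n : ℕ) : ℕ :=
  (n.factorization.filter fun p : ℕ => (p : ℝ) ≤ V).prod fun p e => p ^ e

open Classical in
theorem factorization_smoothPart (V : ℝ) (n : ℕ) :
    (smoothPart V n).factorization = n.factorization.filter fun p : ℕ => (p : ℝ) ≤ V := by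
  refine Nat.prod_pow_factorization_eq_self fun p hp => ?_
  rw [Finsupp.support_filter, Finset.mem_filter, Nat.support_factorization] at hp
  exact Nat.prime_of_mem_primeFactors hp.1

theorem factorization_smoothPart_apply (V : ℝ) (n p : ℕ) [Decidable ((p : ℝ) ≤ V)] :
    (smoothPart V n).factorization p = if (p : ℝ) ≤ V then n.factorization p else 0 := by
  classical
  rw [factorization_smoothPart, Finsupp.filter_apply]
  congr

theorem smoothPart_ne_zero (V : ℝ) (n : ℕ) : smoothPart V n ≠ 0 := by
  classical
  rw [smoothPart, Finsupp.prod]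
  refine Finset.prod_ne_zero_iff.2 fun p hp => ?_
  rw [Finsupp.support_filter, Finset.mem_filter, Nat.support_factorization] at hp
  exact pow_ne_zero _ (Nat.prime_of_mem_primeFactors hp.1).ne_zero

theorem smoothPart_dvd (V : ℝ) {n : ℕ} (hn : n ≠ 0) : smoothPart V n ∣ n := by
  classical
  rw [← Nat.factorization_le_iff_dvd (smoothPart_ne_zero V n) hn]
  intro p
  rw [factorization_smoothPart_apply]
  split_ifs <;> simp

theorem le_of_prime_dvd_smoothPart {V : ℝ} {n p : ℕ} (hp : p.Prime) (h : p ∣ smoothPart V n) :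
    (p : ℝ) ≤ V := by
  classical
  by_contra hcon
  have h1 := hp.factorization_pos_of_dvd (smoothPart_ne_zero V n) h
  rw [factorization_smoothPart_apply, if_neg hcon] at h1
  exact lt_irrefl _ h1

theorem smoothPart_mul (V : ℝ) {m n : ℕ} (hm : m ≠ 0) (hn : n ≠ 0) :
    smoothPart V (m * n) = smoothPart V m * smoothPart V n := by
  classical
  refine Nat.eq_of_factorization_eq (smoothPart_ne_zero _ _)
    (mul_ne_zero (smoothPart_ne_zero _ _) (smoothPart_ne_zero _ _)) fun p => ?_
  rw [Nat.factorization_mul (smoothPart_ne_zero _ _) (smoothPart_ne_zero _ _), Finsupp.add_apply]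
  simp only [factorization_smoothPart_apply, Nat.factorization_mul hm hn, Finsupp.add_apply]
  split_ifs <;> rfl

theorem smoothPart_eq_self {V : ℝ} {n : ℕ} (hn : n ≠ 0)
    (h : ∀ p : ℕ, p.Prime → p ∣ n → (p : ℝ) ≤ V) : smoothPart V n = n := by
  classical
  refine Nat.eq_of_factorization_eq (smoothPart_ne_zero _ _) hn fun p => ?_
  rw [factorization_smoothPart_apply]
  split_ifs with hp
  · rfl
  · symm
    by_contra hne
    have hmem : p ∈ n.primeFactors := by
      rw [← Nat.support_factorization, Finsupp.mem_support_iff]; exact hne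
    exact hp (h p (Nat.prime_of_mem_primeFactors hmem) (Nat.dvd_of_mem_primeFactors hmem))

theorem smoothPart_prod (V : ℝ) {ι : Type*} (s : Finset ι) (f : ι → ℕ) (hf : ∀ i ∈ s, f i ≠ 0) :
    smoothPart V (∏ i ∈ s, f i) = ∏ i ∈ s, smoothPart V (f i) := by
  classical
  induction s using Finset.induction_on with
  | empty =>
    rw [Finset.prod_empty, Finset.prod_empty]
    exact smoothPart_eq_self one_ne_zero fun p hp h => absurd (Nat.dvd_one.1 h) hp.ne_one
  | insert i s hi ih =>
    rw [Finset.prod_insert hi, Finset.prod_insert hi, smoothPart_mul V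
      (hf i (Finset.mem_insert_self _ _))
      (Finset.prod_ne_zero_iff.2 fun j hj => hf j (Finset.mem_insert_of_mem hj)),
      ih fun j hj => hf j (Finset.mem_insert_of_mem hj)]

/-! ### Tuples of shifted primes with the same rough prime factors -/

/-- One half of the structure of a solution: the primes above `V` dividing the entries of `a`. -/
structure HalfStructure (V : ℝ) {k : ℕ} (a b : Fin k → ℕ) : Prop where
  ne_zero : ∀ i, a i ≠ 0
  eq_of_dvd : ∀ r : ℕ, r.Prime → V < r → ∀ i j, r ∣ a i → r ∣ a j → a i = a j
  sqfree : ∀ r : ℕ, r.Prime → V < r → ∀ i, ¬r ^ 2 ∣ a i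
  dvd_other : ∀ r : ℕ, r.Prime → V < r → ∀ i, r ∣ a i → ∃ j, r ∣ b j
  top_prime : ∀ i, (largestPrimeFactor (a i)).Prime
  top_gt : ∀ i, V < largestPrimeFactor (a i)

/-- The set of largest prime factors of the entries of `a` and `b`. -/
def specialPrimes {k : ℕ} (a b : Fin k → ℕ) : Finset ℕ :=
  Finset.univ.image (fun i => largestPrimeFactor (a i)) ∪
    Finset.univ.image (fun i => largestPrimeFactor (b i))

theorem specialPrimes_comm {k : ℕ} (a b : Fin k → ℕ) : specialPrimes a b = specialPrimes b a :=
  Finset.union_comm _ _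

theorem mem_specialPrimes {k : ℕ} {a b : Fin k → ℕ} {t : ℕ} :
    t ∈ specialPrimes a b ↔
      (∃ i, largestPrimeFactor (a i) = t) ∨ ∃ i, largestPrimeFactor (b i) = t := by
  simp [specialPrimes]

theorem card_specialPrimes_le {k : ℕ} (a b : Fin k → ℕ) : (specialPrimes a b).card ≤ 2 * k := by
  refine (Finset.card_union_le _ _).trans ?_
  have h1 := Finset.card_image_le (s := (Finset.univ : Finset (Fin k)))
    (f := fun i => largestPrimeFactor (a i))
  have h2 := Finset.card_image_le (s := (Finset.univ : Finset (Fin k)))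
    (f := fun i => largestPrimeFactor (b i))
  rw [Finset.card_univ, Fintype.card_fin] at h1 h2
  omega

theorem finite_setOf_mem (T : Finset ℕ) : (Set.ofPred (· ∈ T)).Finite := T.finite_toSet

theorem card_finite_setOf_mem (T : Finset ℕ) : (finite_setOf_mem T).toFinset.card = T.card := by
  congr 1
  ext x
  rw [Set.Finite.mem_toFinset]
  rfl

/-- The rank of the largest prime factor of `a i` among the special primes. -/
def topRank {k : ℕ} (a b : Fin k → ℕ) (i : Fin k) : ℕ :=
  Nat.count (· ∈ specialPrimes a b) (largestPrimeFactor (a i))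

/-- The special prime of rank `c`. -/
noncomputable def specialNth {k : ℕ} (a b : Fin k → ℕ) (c : ℕ) : ℕ :=
  Nat.nth (· ∈ specialPrimes a b) c

theorem specialNth_comm {k : ℕ} (a b : Fin k → ℕ) (c : ℕ) : specialNth a b c = specialNth b a c := by
  rw [specialNth, specialNth, specialPrimes_comm]

theorem top_mem_specialPrimes {k : ℕ} (a b : Fin k → ℕ) (i : Fin k) :
    largestPrimeFactor (a i) ∈ specialPrimes a b :=
  mem_specialPrimes.2 (Or.inl ⟨i, rfl⟩)

theorem specialNth_topRank {k : ℕ} (a b : Fin k → ℕ) (i : Fin k) :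
    specialNth a b (topRank a b i) = largestPrimeFactor (a i) :=
  Nat.nth_count (p := (· ∈ specialPrimes a b)) (top_mem_specialPrimes a b i)

theorem topRank_lt_card {k : ℕ} (a b : Fin k → ℕ) (i : Fin k) :
    topRank a b i < (specialPrimes a b).card := by
  rw [← card_finite_setOf_mem]
  exact Nat.count_lt_card (p := (· ∈ specialPrimes a b)) (finite_setOf_mem _)
    (top_mem_specialPrimes a b i)

theorem specialNth_mem {k : ℕ} {a b : Fin k → ℕ} {c : ℕ} (hc : c < (specialPrimes a b).card) :
    specialNth a b c ∈ specialPrimes a b := by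
  rw [← card_finite_setOf_mem] at hc
  exact Nat.nth_mem_of_lt_card (p := (· ∈ specialPrimes a b)) (finite_setOf_mem _) hc

theorem specialNth_injOn {k : ℕ} (a b : Fin k → ℕ) :
    Set.InjOn (specialNth a b) (Set.Iio (specialPrimes a b).card) := by
  rw [← card_finite_setOf_mem]
  exact Nat.nth_injOn (p := (· ∈ specialPrimes a b)) (finite_setOf_mem _)

open Classical in
/-- Some index of an entry divisible by `r`, if there is one. -/
noncomputable def divIndex {k : ℕ} (a : Fin k → ℕ) (r : ℕ) : Option (Fin k) :=
  if h : ∃ i, r ∣ a i then some h.choose else none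

theorem dvd_of_divIndex_eq_some {k : ℕ} {a : Fin k → ℕ} {r : ℕ} {i : Fin k}
    (h : divIndex a r = some i) : r ∣ a i := by
  rw [divIndex] at h
  split_ifs at h with hex
  · rw [Option.some.injEq] at h
    exact h ▸ hex.choose_spec

theorem exists_divIndex_eq_some {k : ℕ} {a : Fin k → ℕ} {r : ℕ} (h : ∃ i, r ∣ a i) :
    ∃ i, divIndex a r = some i := by
  rw [divIndex, dif_pos h]
  exact ⟨_, rfl⟩

/-- The index of a prime that is not special. -/
noncomputable def ordinaryIndex {k : ℕ} (a b : Fin k → ℕ) (r : ℕ) : Option (Fin k) :=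
  if r ∈ specialPrimes a b then none else divIndex a r

theorem ordinaryIndex_eq_some {k : ℕ} {a b : Fin k → ℕ} {r : ℕ} {i : Fin k}
    (h : ordinaryIndex a b r = some i) : r ∉ specialPrimes a b ∧ r ∣ a i := by
  rw [ordinaryIndex] at h
  split_ifs at h with hr
  exact ⟨hr, dvd_of_divIndex_eq_some h⟩

/-- Two solutions have the same code and the same special primes of rank below `n`. -/
structure SameCode (V : ℝ) {k : ℕ} (n : ℕ) (a b a' b' : Fin k → ℕ) : Prop where
  low : ∀ i, smoothPart V (a i) = smoothPart V (a' i)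
  ordinary : ∀ r : ℕ, r.Prime → V < r → ordinaryIndex a b r = ordinaryIndex a' b' r
  rank : ∀ i, topRank a b i = topRank a' b' i
  rank_other : ∀ i, topRank b a i = topRank b' a' i
  cross : ∀ i, divIndex a (largestPrimeFactor (b i)) = divIndex a' (largestPrimeFactor (b' i))
  pre : ∀ c < n, specialNth a b c = specialNth a' b' c

theorem SameCode.symm {V : ℝ} {k n : ℕ} {a b a' b' : Fin k → ℕ} (h : SameCode V n a b a' b') :
    SameCode V n a' b' a b :=
  ⟨fun i => (h.low i).symm, fun r hr hV => (h.ordinary r hr hV).symm, fun i => (h.rank i).symm,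
    fun i => (h.rank_other i).symm, fun i => (h.cross i).symm, fun c hc => (h.pre c hc).symm⟩

/-- If r is special, it lies below the top of a_i, so its rank is below n and it is a known prime.
It is not the top of any a_j, since that entry would equal a_i; so it is the top of some b_j, and
`cross` names an entry of a that it divides. If r is ordinary, the code names such an entry
directly. The named entry need not have index i, but entries sharing a rough prime are equal, and
the ranks carry this equality over to a'. -/
theorem SameCode.dvd_of_dvd {V : ℝ} {k n : ℕ} {a b a' b' : Fin k → ℕ}
    (h : SameCode V n a b a' b') (ha : HalfStructure V a b) (ha' : HalfStructure V a' b')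
    {i : Fin k} (hi : topRank a b i = n) {r : ℕ} (hr : r.Prime) (hV : V < r) (hra : r ∣ a i)
    (hne : r ≠ largestPrimeFactor (a i)) : r ∣ a' i ∧ r ≠ largestPrimeFactor (a' i) := by
  have hdvdtop : ∀ j, largestPrimeFactor (a j) ∣ a j := fun j =>
    (largestPrimeFactor_mem (ha.top_prime j).one_lt).2
  have hdvdtop' : ∀ j, largestPrimeFactor (a' j) ∣ a' j := fun j =>
    (largestPrimeFactor_mem (ha'.top_prime j).one_lt).2
  have heq : ∀ j, r ∣ a j → a' j = a' i := by
    intro j hj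
    have h1 : a j = a i := ha.eq_of_dvd r hr hV j i hj hra
    have h2 : topRank a b j = topRank a b i := by rw [topRank, topRank, h1]
    have h3 : largestPrimeFactor (a' j) = largestPrimeFactor (a' i) := by
      rw [← specialNth_topRank a' b' j, ← specialNth_topRank a' b' i, ← h.rank, ← h.rank, h2]
    exact ha'.eq_of_dvd _ (ha'.top_prime j) (ha'.top_gt j) j i (hdvdtop' j)
      (h3 ▸ hdvdtop' i)
  by_cases hsp : r ∈ specialPrimes a b
  · have hlt : r < largestPrimeFactor (a i) :=
      lt_of_le_of_ne (le_largestPrimeFactor (ha.ne_zero i) hr hra) hne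
    have hcount : Nat.count (· ∈ specialPrimes a b) r < n := by
      rw [← hi]
      exact Nat.count_strict_mono (p := (· ∈ specialPrimes a b)) hsp hlt
    have hnth : specialNth a b (Nat.count (· ∈ specialPrimes a b) r) = r :=
      Nat.nth_count (p := (· ∈ specialPrimes a b)) hsp
    rcases mem_specialPrimes.1 hsp with ⟨j, hj⟩ | ⟨j, hj⟩
    · exact absurd (by rw [← hj, ha.eq_of_dvd r hr hV j i (hj ▸ hdvdtop j) hra]) hne
    · have hrank : topRank b a j = Nat.count (· ∈ specialPrimes a b) r := by
        rw [topRank, specialPrimes_comm b a, hj]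
      have hj' : largestPrimeFactor (b' j) = r := by
        rw [← specialNth_topRank b' a' j, ← h.rank_other, hrank, specialNth_comm, ← h.pre _ hcount,
          hnth]
      obtain ⟨α, hα⟩ := exists_divIndex_eq_some ⟨i, hra⟩
      have hα' : divIndex a' r = some α := by
        have := h.cross j
        rw [hj, hj', hα] at this
        exact this.symm
      refine ⟨heq α (dvd_of_divIndex_eq_some hα) ▸ dvd_of_divIndex_eq_some hα', ?_⟩
      intro hcon
      have h1 : topRank a' b' i = topRank b' a' j := by
        rw [topRank, topRank, hj', ← hcon, specialPrimes_comm]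
      rw [← h.rank, ← h.rank_other, hi, hrank] at h1
      omega
  · obtain ⟨α, hα⟩ := exists_divIndex_eq_some ⟨i, hra⟩
    have hord : ordinaryIndex a b r = some α := by rw [ordinaryIndex, if_neg hsp, hα]
    have hord' := ordinaryIndex_eq_some ((h.ordinary r hr hV).symm.trans hord)
    refine ⟨heq α (dvd_of_divIndex_eq_some hα) ▸ hord'.2, fun hcon => hord'.1 ?_⟩
    rw [hcon]
    exact top_mem_specialPrimes a' b' i

theorem factorization_div_top {V : ℝ} {k : ℕ} {a b : Fin k → ℕ} (ha : HalfStructure V a b)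
    (i : Fin k) (r : ℕ) (hr : r.Prime) [Decidable ((r : ℝ) ≤ V)]
    [Decidable (r ∣ a i ∧ r ≠ largestPrimeFactor (a i))] :
    (a i / largestPrimeFactor (a i)).factorization r =
      if (r : ℝ) ≤ V then (smoothPart V (a i)).factorization r
      else if r ∣ a i ∧ r ≠ largestPrimeFactor (a i) then 1 else 0 := by
  have hdvd := (largestPrimeFactor_mem (ha.top_prime i).one_lt).2
  rw [Nat.factorization_div hdvd, Finsupp.tsub_apply, (ha.top_prime i).factorization,
    Finsupp.single_apply]
  have htop := ha.top_gt i
  have hle : ¬(r : ℝ) ≤ V → (a i).factorization r ≤ 1 := by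
    intro h2
    by_contra hcon
    exact ha.sqfree r hr (not_le.1 h2) i
      ((hr.pow_dvd_iff_le_factorization (ha.ne_zero i)).2 (by omega))
  by_cases h2 : (r : ℝ) ≤ V
  · rw [if_pos h2, factorization_smoothPart_apply, if_pos h2, if_neg, Nat.sub_zero]
    intro h1
    rw [h1] at htop
    linarith
  · rw [if_neg h2]
    have := hle h2
    by_cases h1 : largestPrimeFactor (a i) = r
    · rw [if_pos h1, if_neg fun h => h.2 h1.symm]
      omega
    · rw [if_neg h1, Nat.sub_zero]
      by_cases h3 : r ∣ a i
      · rw [if_pos ⟨h3, Ne.symm h1⟩]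
        have := hr.factorization_pos_of_dvd (ha.ne_zero i) h3
        omega
      · rw [if_neg fun h => h3 h.1, Nat.factorization_eq_zero_of_not_dvd h3]

/-- The step that makes sieving possible: with the code and the smaller special primes fixed, an
entry is a fixed cofactor times its largest prime factor. The two quotients have the same exponents,
by the smooth parts up to V and by `SameCode.dvd_of_dvd` above V, where exponents are 0 or 1. -/
theorem SameCode.div_top_eq {V : ℝ} {k n : ℕ} {a b a' b' : Fin k → ℕ}
    (h : SameCode V n a b a' b') (ha : HalfStructure V a b) (ha' : HalfStructure V a' b')
    {i : Fin k} (hi : topRank a b i = n) :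
    a i / largestPrimeFactor (a i) = a' i / largestPrimeFactor (a' i) := by
  classical
  have hdvd := (largestPrimeFactor_mem (ha.top_prime i).one_lt).2
  have hdvd' := (largestPrimeFactor_mem (ha'.top_prime i).one_lt).2
  refine Nat.eq_of_factorization_eq
    (Nat.div_pos (Nat.le_of_dvd (Nat.pos_of_ne_zero (ha.ne_zero i)) hdvd)
      (ha.top_prime i).pos).ne'
    (Nat.div_pos (Nat.le_of_dvd (Nat.pos_of_ne_zero (ha'.ne_zero i)) hdvd')
      (ha'.top_prime i).pos).ne' fun r => ?_
  by_cases hr : r.Prime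
  · rw [factorization_div_top ha i r hr, factorization_div_top ha' i r hr, h.low i]
    split_ifs with h1 h2 h3 h4
    · rfl
    · rfl
    · exact absurd (h.dvd_of_dvd ha ha' hi hr (not_le.1 h1) h2.1 h2.2) h3
    · exact absurd (h.symm.dvd_of_dvd ha' ha (by rw [← h.rank, hi]) hr (not_le.1 h1) h4.1 h4.2) h2
    · rfl
  · rw [Nat.factorization_eq_zero_of_not_prime _ hr, Nat.factorization_eq_zero_of_not_prime _ hr]

/-- The shifted primes `a i = p i - 1` and `b i = q i + 1` of a solution, with the properties used
in the sieve. The entry `i₀` carries the largest of all prime factors. -/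
structure SieveConfig (y V : ℝ) {k : ℕ} (d : ℕ) (u : Fin k → ℝ) (i₀ : Fin k)
    (a b : Fin k → ℕ) (e f : ℕ) : Prop where
  left : HalfStructure V a b
  right : HalfStructure V b a
  e_pos : 0 < e
  f_pos : 0 < f
  eqn : (∏ i, a i) * f * d = (∏ i, b i) * e
  le : (((∏ i, b i) * e : ℕ) : ℝ) ≤ y
  smooth : ∀ r : ℕ, r.Prime → r ∣ f * d → (r : ℝ) ≤ V
  prime_left : ∀ i, (a i + 1).Prime
  prime_right : ∀ i, (b i - 1).Prime
  le_top_left : ∀ i, u i ≤ largestPrimeFactor (a i)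
  le_top_right : ∀ i, u i ≤ largestPrimeFactor (b i)
  top_eq : largestPrimeFactor (a i₀) = largestPrimeFactor (b i₀)
  top_lt_left : ∀ i, i ≠ i₀ → largestPrimeFactor (a i) < largestPrimeFactor (a i₀)
  top_lt_right : ∀ i, i ≠ i₀ → largestPrimeFactor (b i) < largestPrimeFactor (b i₀)
  top_large : Real.log y ≤ 8 * logLog y * Real.log (largestPrimeFactor (a i₀))

/-- The primes in `(V, y]` that divide an entry but are not special. -/
noncomputable def ordinaryPrimes (y V : ℝ) {k : ℕ} (a b : Fin k → ℕ) : Finset ℕ :=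
  open Classical in
  (Nat.primesLE ⌊y⌋₊).filter fun r : ℕ => V < r ∧ ordinaryIndex a b r ≠ none

/-- The multiplicity guaranteed for the special prime of rank `c`. -/
def specialMult {k : ℕ} (a b : Fin k → ℕ) (c : ℕ) : ℕ :=
  max (Finset.univ.filter fun i => topRank a b i = c).card
    (Finset.univ.filter fun i => topRank b a i = c).card

theorem mem_ordinaryPrimes {y V : ℝ} {k : ℕ} {a b : Fin k → ℕ} {r : ℕ} :
    r ∈ ordinaryPrimes y V a b ↔
      (r ≤ ⌊y⌋₊ ∧ r.Prime) ∧ V < r ∧ ordinaryIndex a b r ≠ none := by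
  rw [ordinaryPrimes, Finset.mem_filter, Nat.mem_primesLE]

theorem one_le_specialMult_topRank {k : ℕ} (a b : Fin k → ℕ) (i : Fin k) :
    1 ≤ specialMult a b (topRank a b i) :=
  le_max_of_le_left (Finset.card_pos.2 ⟨i, by simp⟩)

theorem dvd_prod_mul {k : ℕ} (b : Fin k → ℕ) (e : ℕ) (i : Fin k) : b i ∣ (∏ i, b i) * e :=
  (Finset.dvd_prod_of_mem b (Finset.mem_univ i)).mul_right _

namespace SieveConfig

variable {y V : ℝ} {k d : ℕ} {u : Fin k → ℝ} {i₀ : Fin k} {a b : Fin k → ℕ} {e f : ℕ}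

theorem total_pos (h : SieveConfig y V d u i₀ a b e f) : 0 < (∏ i, b i) * e :=
  Nat.mul_pos (Finset.prod_pos fun i _ => Nat.pos_of_ne_zero (h.right.ne_zero i)) h.e_pos

theorem left_dvd (h : SieveConfig y V d u i₀ a b e f) (i : Fin k) : a i ∣ (∏ i, b i) * e := by
  rw [← h.eqn, mul_assoc]
  exact (Finset.dvd_prod_of_mem a (Finset.mem_univ i)).mul_right _

theorem cast_le_of_dvd (h : SieveConfig y V d u i₀ a b e f) {n : ℕ}
    (hn : n ∣ (∏ i, b i) * e) : (n : ℝ) ≤ y :=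
  le_trans (by exact_mod_cast Nat.le_of_dvd h.total_pos hn) h.le

theorem top_dvd_left (h : SieveConfig y V d u i₀ a b e f) (i : Fin k) :
    largestPrimeFactor (a i) ∣ a i := (largestPrimeFactor_mem (h.left.top_prime i).one_lt).2

theorem top_dvd_right (h : SieveConfig y V d u i₀ a b e f) (i : Fin k) :
    largestPrimeFactor (b i) ∣ b i := (largestPrimeFactor_mem (h.right.top_prime i).one_lt).2

theorem special_prime (h : SieveConfig y V d u i₀ a b e f) {t : ℕ}
    (ht : t ∈ specialPrimes a b) : t.Prime ∧ V < t := by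
  rcases mem_specialPrimes.1 ht with ⟨i, rfl⟩ | ⟨i, rfl⟩
  · exact ⟨h.left.top_prime i, h.left.top_gt i⟩
  · exact ⟨h.right.top_prime i, h.right.top_gt i⟩

theorem topRank_right_base (h : SieveConfig y V d u i₀ a b e f) :
    topRank b a i₀ = topRank a b i₀ := by
  rw [topRank, topRank, h.top_eq, specialPrimes_comm]

theorem topRank_left_lt (h : SieveConfig y V d u i₀ a b e f) {i : Fin k} (hi : i ≠ i₀) :
    topRank a b i < topRank a b i₀ :=
  Nat.count_strict_mono (p := (· ∈ specialPrimes a b)) (top_mem_specialPrimes a b i)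
    (h.top_lt_left i hi)

theorem topRank_right_lt (h : SieveConfig y V d u i₀ a b e f) {i : Fin k} (hi : i ≠ i₀) :
    topRank b a i < topRank a b i₀ := by
  rw [← h.topRank_right_base]
  exact Nat.count_strict_mono (p := (· ∈ specialPrimes b a)) (top_mem_specialPrimes b a i)
    (h.top_lt_right i hi)

/-- Both products divide the common value of the equation, so the larger of the two multiplicities
is available. -/
theorem specialNth_pow_dvd (h : SieveConfig y V d u i₀ a b e f) (c : ℕ) :
    specialNth a b c ^ specialMult a b c ∣ (∏ i, b i) * e := by
  have key : ∀ (a b : Fin k → ℕ), (∀ i, largestPrimeFactor (a i) ∣ a i) →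
      specialNth a b c ^ (Finset.univ.filter fun i => topRank a b i = c).card ∣ ∏ i, a i := by
    intro a b hdvd
    rw [← Finset.prod_const]
    refine (Finset.prod_dvd_prod_of_dvd _ (fun i => a i) fun i hi => ?_).trans
      (Finset.prod_dvd_prod_of_subset _ _ _ (Finset.filter_subset _ _))
    rw [← (Finset.mem_filter.1 hi).2, specialNth_topRank]
    exact hdvd i
  rcases le_total (Finset.univ.filter fun i => topRank a b i = c).card
    (Finset.univ.filter fun i => topRank b a i = c).card with hle | hle
  · rw [specialMult, max_eq_right hle, specialNth_comm]
    exact (key b a h.top_dvd_right).mul_right e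
  · rw [specialMult, max_eq_left hle, ← h.eqn, mul_assoc]
    exact (key a b h.top_dvd_left).mul_right _

theorem specialNth_prime (h : SieveConfig y V d u i₀ a b e f) {c : ℕ}
    (hc : c ≤ topRank a b i₀) : (specialNth a b c).Prime ∧ V < specialNth a b c :=
  h.special_prime (specialNth_mem (hc.trans_lt (topRank_lt_card a b i₀)))

/-- The three factors are pairwise coprime: their primes are at most V, rough but not special, and
special. Since the total is at most y, this bounds the largest special prime in terms of everything
else. -/
theorem mul_prod_dvd (h : SieveConfig y V d u i₀ a b e f) :
    (d * f * ∏ i, smoothPart V (a i)) * (∏ r ∈ ordinaryPrimes y V a b, r) *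
      ∏ c ∈ Finset.range (topRank a b i₀ + 1), specialNth a b c ^ specialMult a b c ∣
        (∏ i, b i) * e := by
  have h1 : d * f * ∏ i, smoothPart V (a i) ∣ (∏ i, b i) * e := by
    rw [← h.eqn]
    have : ∏ i, smoothPart V (a i) ∣ ∏ i, a i :=
      Finset.prod_dvd_prod_of_dvd _ _ fun i _ => smoothPart_dvd V (h.left.ne_zero i)
    calc d * f * ∏ i, smoothPart V (a i) = (∏ i, smoothPart V (a i)) * f * d := by ring
      _ ∣ _ := mul_dvd_mul (mul_dvd_mul this dvd_rfl) dvd_rfl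
  have h2 : ∏ r ∈ ordinaryPrimes y V a b, r ∣ (∏ i, b i) * e := by
    refine Finset.prod_primes_dvd _ (fun r hr => ?_) fun r hr => ?_
    · exact (mem_ordinaryPrimes.1 hr).1.2.prime
    · obtain ⟨i, hi⟩ := Option.ne_none_iff_exists'.1 (mem_ordinaryPrimes.1 hr).2.2
      exact (ordinaryIndex_eq_some hi).2.trans (h.left_dvd i)
  have h3 : ∏ c ∈ Finset.range (topRank a b i₀ + 1), specialNth a b c ^ specialMult a b c ∣
      (∏ i, b i) * e := by
    refine Finset.prod_dvd_of_isRelPrime ?_ fun c _ => h.specialNth_pow_dvd c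
    intro c hc c' hc' hne
    rw [Finset.coe_range, Set.mem_Iio] at hc hc'
    have hp := (h.specialNth_prime (Nat.lt_succ_iff.1 hc)).1
    have hp' := (h.specialNth_prime (Nat.lt_succ_iff.1 hc')).1
    refine Nat.coprime_iff_isRelPrime.1 (Nat.Coprime.pow _ _ ((Nat.coprime_primes hp hp').2 ?_))
    intro heq
    have hcard := topRank_lt_card a b i₀
    exact hne (specialNth_injOn a b (Set.mem_Iio.2 (by omega)) (Set.mem_Iio.2 (by omega)) heq)
  have hsm : ∀ r : ℕ, r.Prime → r ∣ d * f * ∏ i, smoothPart V (a i) → (r : ℝ) ≤ V := by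
    intro r hr hdvd
    rcases hr.dvd_mul.1 hdvd with h' | h'
    · exact h.smooth r hr (by rwa [mul_comm])
    · obtain ⟨i, _, hi⟩ := (hr.prime.dvd_finsetProd_iff _).1 h'
      exact le_of_prime_dvd_smoothPart hr hi
  refine Nat.Coprime.mul_dvd_of_dvd_of_dvd ?_ (Nat.Coprime.mul_dvd_of_dvd_of_dvd ?_ h1 h2) h3
  · refine Nat.Coprime.prod_right fun c hc => Nat.Coprime.pow_right _ ?_
    have hp := h.specialNth_prime (Nat.lt_succ_iff.1 (Finset.mem_range.1 hc))
    have hmem : specialNth a b c ∈ specialPrimes a b := specialNth_mem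
      ((Nat.lt_succ_iff.1 (Finset.mem_range.1 hc)).trans_lt (topRank_lt_card a b i₀))
    rw [Nat.coprime_comm, hp.1.coprime_iff_not_dvd]
    intro hdvd
    rcases hp.1.dvd_mul.1 hdvd with h' | h'
    · exact absurd (hsm _ hp.1 h') (not_le.2 hp.2)
    · obtain ⟨r, hr, hpr⟩ := (hp.1.prime.dvd_finsetProd_iff _).1 h'
      have hr' := mem_ordinaryPrimes.1 hr
      rw [Nat.prime_dvd_prime_iff_eq hp.1 hr'.1.2] at hpr
      obtain ⟨i, hi⟩ := Option.ne_none_iff_exists'.1 hr'.2.2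
      exact (ordinaryIndex_eq_some hi).1 (hpr ▸ hmem)
  · refine Nat.Coprime.prod_right fun r hr => ?_
    have hr' := mem_ordinaryPrimes.1 hr
    rw [Nat.coprime_comm, hr'.1.2.coprime_iff_not_dvd]
    exact fun hdvd => absurd (hsm r hr'.1.2 hdvd) (not_le.2 hr'.2.1)

end SieveConfig

/-! ### Counting the solutions with a given code. -/

theorem SameCode.extend {V : ℝ} {k n m : ℕ} {a b a' b' : Fin k → ℕ} (h : SameCode V n a b a' b')
    (hpre : ∀ c < m, specialNth a b c = specialNth a' b' c) : SameCode V m a b a' b' :=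
  ⟨h.low, h.ordinary, h.rank, h.rank_other, h.cross, hpre⟩

theorem SameCode.ordinaryPrimes_eq {y V : ℝ} {k n : ℕ} {a b a' b' : Fin k → ℕ}
    (h : SameCode V n a b a' b') : ordinaryPrimes y V a b = ordinaryPrimes y V a' b' := by
  ext r
  rw [mem_ordinaryPrimes, mem_ordinaryPrimes]
  refine and_congr_right fun hr => and_congr_right fun hV => ?_
  rw [h.ordinary r hr.2 hV]

theorem SameCode.entry_eq {V : ℝ} {k n : ℕ} {a b a' b' : Fin k → ℕ}
    (h : SameCode V n a b a' b') (ha : HalfStructure V a b) (ha' : HalfStructure V a' b')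
    {i : Fin k} (hi : topRank a b i < n) : a i = a' i := by
  have h1 := (h.extend (m := topRank a b i) fun c hc => h.pre c (hc.trans hi)).div_top_eq ha ha' rfl
  have h2 : largestPrimeFactor (a i) = largestPrimeFactor (a' i) := by
    rw [← specialNth_topRank a b i, ← specialNth_topRank a' b' i, ← h.rank i, h.pre _ hi]
  rw [← Nat.div_mul_cancel (largestPrimeFactor_mem (ha.top_prime i).one_lt).2, h1, h2,
    Nat.div_mul_cancel (largestPrimeFactor_mem (ha'.top_prime i).one_lt).2]

theorem prod_range_prod_filter_rank {k n : ℕ} (ρ : Fin k → ℕ) (i₀ : Fin k) (h₀ : ρ i₀ = n)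
    (hρ : ∀ i, i ≠ i₀ → ρ i < n) (κ : Fin k → ℝ) :
    ∏ c ∈ Finset.range n, ∏ i ∈ Finset.univ.filter (fun i => ρ i = c), κ i =
      ∏ i ∈ Finset.univ.erase i₀, κ i := by
  rw [← Finset.prod_fiberwise_of_maps_to (s := Finset.univ.erase i₀) (t := Finset.range n) (g := ρ)]
  · refine Finset.prod_congr rfl fun c hc => Finset.prod_congr ?_ fun _ _ => rfl
    ext i
    rw [Finset.mem_filter, Finset.mem_filter, Finset.mem_erase]
    refine ⟨fun h => ⟨⟨fun hi => ?_, Finset.mem_univ _⟩, h.2⟩, fun h => ⟨Finset.mem_univ _, h.2⟩⟩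
    rw [Finset.mem_range, ← h.2, hi, h₀] at hc
    exact lt_irrefl _ hc
  · intro i hi
    exact Finset.mem_range.2 (hρ i (Finset.mem_erase.1 hi).1)

/-- Two tuples have the same code. -/
def CodeEq (V : ℝ) {k : ℕ} (x x' : (Fin k → ℕ) × (Fin k → ℕ) × ℕ × ℕ) : Prop :=
  SameCode V 0 x.1 x.2.1 x'.1 x'.2.1 ∧ SameCode V 0 x.2.1 x.1 x'.2.1 x'.1 ∧ x.2.2 = x'.2.2

/-- The bound for the number of solutions with a prescribed code. -/
theorem exists_card_code_fiber_le :
    ∃ C y₀ : ℝ, 1 ≤ C ∧ ∀ y : ℝ, y₀ ≤ y → ∀ (V : ℝ) (k d : ℕ) (u : Fin k → ℝ) (i₀ : Fin k)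
      (𝓕 : Finset ((Fin k → ℕ) × (Fin k → ℕ) × ℕ × ℕ)), 0 < d →
      (∀ i, i ≠ i₀ → Real.exp 1 ≤ u i) →
      (∀ x ∈ 𝓕, SieveConfig y V d u i₀ x.1 x.2.1 x.2.2.1 x.2.2.2) →
      (∀ x ∈ 𝓕, ∀ x' ∈ 𝓕, CodeEq V x x') → ∀ x ∈ 𝓕,
      (𝓕.card : ℝ) ≤ C * logLog y ^ 6 / Real.log y ^ 3 *
        (y / ((d * x.2.2.2 * ∏ i, smoothPart V (x.1 i) : ℕ) *
          ∏ r ∈ ordinaryPrimes y V x.1 x.2.1, (r : ℝ))) *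
        (∏ i ∈ Finset.univ.erase i₀, C * logLog y ^ 2 / Real.log (u i)) ^ 2 := by
  classical
  obtain ⟨C₁, y₁, hC₁, h₁⟩ := exists_special_prime_sum_le
  obtain ⟨C₂, y₂, hC₂, h₂⟩ := exists_linear_forms_bounds
  -- 512 is the cube of the 8 in `top_large`, which replaces (log X)³ by (log y)³.
  refine ⟨C₁ + 512 * C₂, max (max y₁ y₂) (Real.exp (Real.exp 1)), by linarith, ?_⟩
  intro y hy V k d u i₀ 𝓕 hd hu hconf hcode x₀ hx₀
  have hy1 : y₁ ≤ y := (le_max_left _ _).trans ((le_max_left _ _).trans hy)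
  have hy2 : y₂ ≤ y := (le_max_right _ _).trans ((le_max_left _ _).trans hy)
  have hyexp : Real.exp (Real.exp 1) ≤ y := (le_max_right _ _).trans hy
  have hy0 : 0 < y := (Real.exp_pos _).trans_le hyexp
  have hlogy : Real.exp 1 ≤ Real.log y := by
    rw [Real.le_log_iff_exp_le hy0]; exact hyexp
  have hlogy0 : 0 < Real.log y := (Real.exp_pos 1).trans_le hlogy
  have hL2 : 1 ≤ logLog y := by
    rw [logLog, Real.le_log_iff_exp_le hlogy0]; exact hlogy
  set ρ : Fin k → ℕ := topRank x₀.1 x₀.2.1 with hρ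
  set ρ' : Fin k → ℕ := topRank x₀.2.1 x₀.1 with hρ'
  set n : ℕ := ρ i₀ with hn
  have hrank : ∀ x ∈ 𝓕, ∀ i, topRank x.1 x.2.1 i = ρ i := fun x hx i =>
    (hcode x hx x₀ hx₀).1.rank i
  have hrank' : ∀ x ∈ 𝓕, ∀ i, topRank x.2.1 x.1 i = ρ' i := fun x hx i =>
    (hcode x hx x₀ hx₀).1.rank_other i
  have hρ'0 : ρ' i₀ = n := (hconf x₀ hx₀).topRank_right_base
  have hρlt : ∀ i, i ≠ i₀ → ρ i < n := fun i hi => (hconf x₀ hx₀).topRank_left_lt hi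
  have hρ'lt : ∀ i, i ≠ i₀ → ρ' i < n := fun i hi => (hconf x₀ hx₀).topRank_right_lt hi
  have hρle : ∀ i, ρ i ≤ n := fun i => by
    by_cases hi : i = i₀
    · rw [hi]
    · exact (hρlt i hi).le
  have hρ'le : ∀ i, ρ' i ≤ n := fun i => by
    by_cases hi : i = i₀
    · rw [hi, hρ'0]
    · exact (hρ'lt i hi).le
  set I : ℕ → Finset (Fin k) := fun c => Finset.univ.filter fun i => ρ i = c with hI
  set J : ℕ → Finset (Fin k) := fun c => Finset.univ.filter fun i => ρ' i = c with hJ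
  have hmult : ∀ x ∈ 𝓕, ∀ c, specialMult x.1 x.2.1 c = max (I c).card (J c).card := by
    intro x hx c
    rw [specialMult]
    simp only [hrank x hx, hrank' x hx, hI, hJ]
  set κ : Fin k → ℝ := fun i => C₁ * logLog y ^ 2 / Real.log (u i) with hκ
  set τ : (Fin k → ℕ) × (Fin k → ℕ) × ℕ × ℕ → ℕ → ℕ := fun x => specialNth x.1 x.2.1 with hτ
  set w : ℕ → ℕ → ℝ := fun c t => ((t : ℝ) ^ max (I c).card (J c).card)⁻¹ with hw
  set σ : ℕ → ℝ := fun c => (∏ i ∈ I c, κ i) * ∏ i ∈ J c, κ i with hσ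
  set M : ℝ := ((d * x₀.2.2.2 * ∏ i, smoothPart V (x₀.1 i) : ℕ) : ℝ) *
    ∏ r ∈ ordinaryPrimes y V x₀.1 x₀.2.1, (r : ℝ) with hM
  have hMpos : 0 < M := by
    refine mul_pos ?_ (Finset.prod_pos fun r hr => ?_)
    · have := (hconf x₀ hx₀).f_pos
      have h2 : 0 < ∏ i, smoothPart V (x₀.1 i) :=
        Finset.prod_pos fun i _ => Nat.pos_of_ne_zero (smoothPart_ne_zero V _)
      exact_mod_cast Nat.mul_pos (Nat.mul_pos hd this) h2
    · exact_mod_cast (mem_ordinaryPrimes.1 hr).1.2.pos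
  have hne : ∀ c < n, ∀ i, i ∈ I c ∨ i ∈ J c → i ≠ i₀ := by
    rintro c hc i hi rfl
    simp only [hI, hJ, Finset.mem_filter, Finset.mem_univ, true_and] at hi
    rcases hi with hi | hi
    · omega
    · omega
  have hIJ : ∀ x ∈ 𝓕, ∀ c ≤ n, ∀ i, i ∈ I c ∨ i ∈ J c → u i ≤ τ x c := by
    intro x hx c _ i hi
    simp only [hI, hJ, Finset.mem_filter, Finset.mem_univ, true_and] at hi
    rcases hi with hi | hi
    · rw [← hrank x hx] at hi
      simp only [hτ]
      rw [← hi, specialNth_topRank]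
      exact (hconf x hx).le_top_left i
    · rw [← hrank' x hx] at hi
      simp only [hτ]
      rw [← hi, specialNth_comm, specialNth_topRank]
      exact (hconf x hx).le_top_right i
  have hτprime : ∀ x ∈ 𝓕, ∀ c ≤ n, (τ x c).Prime := fun x hx c hc =>
    ((hconf x hx).specialNth_prime (by rw [hrank x hx]; exact hc)).1
  have hleft : ∀ x ∈ 𝓕, ∀ x' ∈ 𝓕, ∀ i, (∀ c < ρ i, τ x' c = τ x c) →
      x'.1 i = x.1 i / largestPrimeFactor (x.1 i) * τ x' (ρ i) := by
    intro x hx x' hx' i hpre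
    have h3 := ((hcode x hx x' hx').1.extend (m := ρ i) fun c hc => (hpre c hc).symm).div_top_eq
      (hconf x hx).left (hconf x' hx').left (hrank x hx i)
    have h4 : τ x' (ρ i) = largestPrimeFactor (x'.1 i) := by
      simp only [hτ]
      rw [← hrank x' hx', specialNth_topRank]
    rw [h3, h4, Nat.div_mul_cancel ((hconf x' hx').top_dvd_left i)]
  have hright : ∀ x ∈ 𝓕, ∀ x' ∈ 𝓕, ∀ i, (∀ c < ρ' i, τ x' c = τ x c) →
      x'.2.1 i = x.2.1 i / largestPrimeFactor (x.2.1 i) * τ x' (ρ' i) := by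
    intro x hx x' hx' i hpre
    have h3 := ((hcode x hx x' hx').2.1.extend (m := ρ' i) fun c hc => by
      rw [specialNth_comm, specialNth_comm x'.2.1]; exact (hpre c hc).symm).div_top_eq
      (hconf x hx).right (hconf x' hx').right (hrank' x hx i)
    have h4 : τ x' (ρ' i) = largestPrimeFactor (x'.2.1 i) := by
      simp only [hτ]
      rw [← hrank' x' hx', specialNth_comm, specialNth_topRank]
    rw [h3, h4, Nat.div_mul_cancel ((hconf x' hx').top_dvd_right i)]
  have hcoef : ∀ x ∈ 𝓕, ∀ i, 0 < x.1 i / largestPrimeFactor (x.1 i) ∧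
      ((x.1 i / largestPrimeFactor (x.1 i) : ℕ) : ℝ) ≤ 2 * y := by
    intro x hx i
    have h3 := (hconf x hx).cast_le_of_dvd ((hconf x hx).left_dvd i)
    refine ⟨Nat.div_pos (Nat.le_of_dvd (Nat.pos_of_ne_zero ((hconf x hx).left.ne_zero i))
      ((hconf x hx).top_dvd_left i)) ((hconf x hx).left.top_prime i).pos, ?_⟩
    have : ((x.1 i / largestPrimeFactor (x.1 i) : ℕ) : ℝ) ≤ x.1 i := by
      exact_mod_cast Nat.div_le_self _ _
    linarith
  have hcoef' : ∀ x ∈ 𝓕, ∀ i, 0 < x.2.1 i / largestPrimeFactor (x.2.1 i) ∧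
      ((x.2.1 i / largestPrimeFactor (x.2.1 i) : ℕ) : ℝ) ≤ 2 * y := by
    intro x hx i
    have h3 := (hconf x hx).cast_le_of_dvd (dvd_prod_mul x.2.1 x.2.2.1 i)
    refine ⟨Nat.div_pos (Nat.le_of_dvd (Nat.pos_of_ne_zero ((hconf x hx).right.ne_zero i))
      ((hconf x hx).top_dvd_right i)) ((hconf x hx).right.top_prime i).pos, ?_⟩
    have : ((x.2.1 i / largestPrimeFactor (x.2.1 i) : ℕ) : ℝ) ≤ x.2.1 i := by
      exact_mod_cast Nat.div_le_self _ _
    linarith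
  have hκpos : ∀ i, i ≠ i₀ → 0 < κ i := by
    intro i hi
    have h3 := hu i hi
    have : 1 ≤ Real.log (u i) := by
      rw [Real.le_log_iff_exp_le ((Real.exp_pos 1).trans_le h3)]; exact h3
    simp only [hκ]
    positivity
  have hσ0 : ∀ c < n, 0 ≤ σ c := fun c hc =>
    mul_nonneg (Finset.prod_nonneg fun i hi => (hκpos i (hne c hc i (Or.inl hi))).le)
      (Finset.prod_nonneg fun i hi => (hκpos i (hne c hc i (Or.inr hi))).le)
  set K : ℝ := 512 * C₂ * logLog y ^ 6 / Real.log y ^ 3 * (y / M) with hK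
  have hKnn : 0 ≤ K := by positivity
  -- The special primes of rank below n are summed with weight t to the minus their guaranteed
  -- multiplicity. The prime of rank n, the common top of a_{i₀} and b_{i₀}, is counted last.
  have hmain := card_le_of_prefix_bounds 𝓕 τ w σ n K hKnn (fun c t => by positivity) hσ0 ?_ ?_
  · have hprod : ∏ c ∈ Finset.range n, σ c = (∏ i ∈ Finset.univ.erase i₀, κ i) ^ 2 := by
      simp only [hσ]
      rw [Finset.prod_mul_distrib, prod_range_prod_filter_rank ρ i₀ rfl hρlt,
        prod_range_prod_filter_rank ρ' i₀ hρ'0 hρ'lt, sq]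
    rw [hprod] at hmain
    refine hmain.trans ?_
    have hκ0 : 0 ≤ ∏ i ∈ Finset.univ.erase i₀, κ i :=
      Finset.prod_nonneg fun i hi => (hκpos i (Finset.mem_erase.1 hi).1).le
    have hκle : ∏ i ∈ Finset.univ.erase i₀, κ i ≤
        ∏ i ∈ Finset.univ.erase i₀, (C₁ + 512 * C₂) * logLog y ^ 2 / Real.log (u i) := by
      refine Finset.prod_le_prod (fun i hi => (hκpos i (Finset.mem_erase.1 hi).1).le) fun i hi => ?_
      have h3 := hu i (Finset.mem_erase.1 hi).1
      have : 1 ≤ Real.log (u i) := by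
        rw [Real.le_log_iff_exp_le ((Real.exp_pos 1).trans_le h3)]; exact h3
      simp only [hκ]
      gcongr
      linarith
    rw [hK]
    gcongr
    linarith
  · intro c hc x hx
    refine h₁ y hy1 (I c) (J c) u _ (fun i hi => hu i (hne c hc i hi)) ?_ ?_ ?_ ?_
    · have hmem : specialNth x.1 x.2.1 c ∈ specialPrimes x.1 x.2.1 := specialNth_mem (by
        have := topRank_lt_card x.1 x.2.1 i₀
        rw [hrank x hx] at this
        omega)
      have hcount : Nat.count (· ∈ specialPrimes x.1 x.2.1) (specialNth x.1 x.2.1 c) = c := by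
        refine Nat.count_nth_of_lt_card_finite (finite_setOf_mem _) ?_
        rw [card_finite_setOf_mem]
        have := topRank_lt_card x.1 x.2.1 i₀
        rw [hrank x hx] at this
        omega
      rcases mem_specialPrimes.1 hmem with ⟨i, hi⟩ | ⟨i, hi⟩
      · refine Or.inl ⟨i, ?_⟩
        simp only [hI, Finset.mem_filter, Finset.mem_univ, true_and]
        rw [← hrank x hx, topRank, hi, hcount]
      · refine Or.inr ⟨i, ?_⟩
        simp only [hJ, Finset.mem_filter, Finset.mem_univ, true_and]
        rw [← hrank' x hx, topRank, hi, specialPrimes_comm, hcount]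
    · intro t ht
      obtain ⟨x', hx', rfl⟩ := Finset.mem_image.1 ht
      have hx'' := (Finset.mem_filter.1 hx').1
      exact ⟨hτprime x' hx'' c hc.le, hIJ x' hx'' c hc.le⟩
    · intro hcard
      obtain ⟨i, hi⟩ := Finset.card_pos.1 (by omega : 0 < (I c).card)
      have hic : ρ i = c := (Finset.mem_filter.1 hi).2
      refine ⟨_, (hcoef x hx i).1, (hcoef x hx i).2, fun t ht => ?_⟩
      obtain ⟨x', hx', rfl⟩ := Finset.mem_image.1 ht
      rw [Finset.mem_filter] at hx'
      have := hleft x hx x' hx'.1 i fun b hb => hx'.2 b (hic ▸ hb)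
      rw [hic] at this
      rw [← this]
      exact (hconf x' hx'.1).prime_left i
    · intro hcard
      obtain ⟨i, hi⟩ := Finset.card_pos.1 (by omega : 0 < (J c).card)
      have hic : ρ' i = c := (Finset.mem_filter.1 hi).2
      refine ⟨_, (hcoef' x hx i).1, (hcoef' x hx i).2, fun t ht => ?_⟩
      obtain ⟨x', hx', rfl⟩ := Finset.mem_image.1 ht
      rw [Finset.mem_filter] at hx'
      have := hright x hx x' hx'.1 i fun b hb => hx'.2 b (hic ▸ hb)
      rw [hic] at this
      rw [← this]
      exact (hconf x' hx'.1).prime_right i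
  · intro x hx
    set G := 𝓕.filter fun x' => ∀ b < n, τ x' b = τ x b with hG
    have hG𝓕 : ∀ x' ∈ G, x' ∈ 𝓕 := fun x' hx' => (Finset.mem_filter.1 hx').1
    have hGpre : ∀ x' ∈ G, ∀ b < n, τ x' b = τ x b := fun x' hx' => (Finset.mem_filter.1 hx').2
    -- No top has rank above n, so the code and the special primes up to rank n determine every
    -- entry.
    have hinj : Set.InjOn (fun x' => τ x' n) G := by
      intro x₁ hx₁ x₂ hx₂ heq
      have hx₁' := Finset.mem_coe.1 hx₁
      have hx₂' := Finset.mem_coe.1 hx₂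
      have hpre : ∀ c < n + 1, τ x₁ c = τ x₂ c := by
        intro c hc
        rcases Nat.lt_succ_iff_lt_or_eq.1 hc with hc | rfl
        · rw [hGpre x₁ hx₁' c hc, hGpre x₂ hx₂' c hc]
        · exact heq
      have hc := hcode x₁ (hG𝓕 _ hx₁') x₂ (hG𝓕 _ hx₂')
      refine Prod.ext (funext fun i => ?_) (Prod.ext (funext fun i => ?_) hc.2.2)
      · refine (hc.1.extend hpre).entry_eq (hconf x₁ (hG𝓕 _ hx₁')).left
          (hconf x₂ (hG𝓕 _ hx₂')).left ?_
        rw [hrank x₁ (hG𝓕 _ hx₁')]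
        exact Nat.lt_succ_of_le (hρle i)
      · refine (hc.2.1.extend (m := n + 1) fun c hc' => ?_).entry_eq
          (hconf x₁ (hG𝓕 _ hx₁')).right (hconf x₂ (hG𝓕 _ hx₂')).right ?_
        · rw [specialNth_comm, specialNth_comm x₂.2.1]
          exact hpre c hc'
        · rw [hrank' x₁ (hG𝓕 _ hx₁')]
          exact Nat.lt_succ_of_le (hρ'le i)
    set Z : Finset ℕ := G.image fun x' => τ x' n with hZ
    have hcardZ : G.card = Z.card := (Finset.card_image_of_injOn hinj).symm
    set W : ℝ := ∏ c ∈ Finset.range n, w c (τ x c) with hW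
    have hWpos : 0 < W := Finset.prod_pos fun c hc => by
      have := (hτprime x hx c (Finset.mem_range.1 hc).le).pos
      simp only [hw]
      positivity
    -- By `mul_prod_dvd` the total is divisible by M, by the powers of the smaller special primes,
    -- whose product is W⁻¹, and by the last prime; hence the last prime is at most X.
    set X : ℝ := y / M * W with hX
    have hZX : ∀ t ∈ Z, (t : ℝ) ≤ X := by
      intro t ht
      obtain ⟨x', hx', rfl⟩ := Finset.mem_image.1 ht
      have hc' := hconf x' (hG𝓕 x' hx')
      have hcd := hcode x' (hG𝓕 x' hx') x₀ hx₀
      have h3 := hc'.cast_le_of_dvd hc'.mul_prod_dvd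
      rw [hrank x' (hG𝓕 x' hx'), Finset.prod_range_succ] at h3
      push_cast at h3
      have h4 : M * W⁻¹ * (τ x' n : ℝ) ≤ y := by
        refine le_trans ?_ h3
        have h5 : (d : ℝ) * x'.2.2.2 * (∏ i, (smoothPart V (x'.1 i) : ℝ)) *
            (∏ r ∈ ordinaryPrimes y V x'.1 x'.2.1, (r : ℝ)) = M := by
          rw [hM, hcd.1.ordinaryPrimes_eq, hcd.2.2]
          push_cast
          simp only [hcd.1.low]
        have h6 : ∏ c ∈ Finset.range n,
            (specialNth x'.1 x'.2.1 c : ℝ) ^ specialMult x'.1 x'.2.1 c = W⁻¹ := by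
          rw [hW, ← Finset.prod_inv_distrib]
          refine Finset.prod_congr rfl fun c hc => ?_
          simp only [hw, inv_inv]
          rw [hmult x' (hG𝓕 x' hx'), ← hGpre x' hx' c (Finset.mem_range.1 hc)]
        rw [h5, h6, mul_assoc]
        refine mul_le_mul_of_nonneg_left (mul_le_mul_of_nonneg_left ?_ (inv_pos.2 hWpos).le)
          hMpos.le
        have h7 : 1 ≤ specialMult x'.1 x'.2.1 (ρ i₀) := by
          rw [← hrank x' (hG𝓕 x' hx')]
          exact one_le_specialMult_topRank _ _ _
        have h8 : (1 : ℝ) ≤ τ x' n := by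
          exact_mod_cast (hτprime x' (hG𝓕 x' hx') n le_rfl).one_le
        exact le_self_pow₀ h8 (by omega)
      rw [hX, div_mul_eq_mul_div, le_div_iff₀ hMpos]
      have : M * W⁻¹ * (τ x' n : ℝ) * W ≤ y * W := mul_le_mul_of_nonneg_right h4 hWpos.le
      calc (τ x' n : ℝ) * M = M * W⁻¹ * (τ x' n : ℝ) * W := by field_simp
        _ ≤ _ := this
    have hxG : x ∈ G := Finset.mem_filter.2 ⟨hx, fun _ _ => rfl⟩
    have htop : τ x n ∈ Z := Finset.mem_image_of_mem _ hxG
    have htopval : τ x n = largestPrimeFactor (x.1 i₀) := by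
      simp only [hτ]
      rw [hn, ← hrank x hx, specialNth_topRank]
    have hX2 : 2 ≤ X := by
      refine le_trans ?_ (hZX _ htop)
      exact_mod_cast (hτprime x hx n le_rfl).two_le
    -- X is at least the last prime of x itself, so it inherits the lower bound `top_large`.
    have hlogX : Real.log y ≤ 8 * logLog y * Real.log X := by
      refine (hconf x hx).top_large.trans ?_
      rw [← htopval]
      refine mul_le_mul_of_nonneg_left (Real.log_le_log ?_ (hZX _ htop)) (by linarith)
      exact_mod_cast (hτprime x hx n le_rfl).pos
    have hlogX0 : 0 < Real.log X := Real.log_pos (by linarith)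
    have hsieve := (h₂ y hy2 _ _ (hcoef x hx i₀).1 (hcoef' x hx i₀).1 (hcoef x hx i₀).2
      (hcoef' x hx i₀).2 Z (fun t ht => by
        obtain ⟨x', hx', rfl⟩ := Finset.mem_image.1 ht
        exact hτprime x' (hG𝓕 x' hx') n le_rfl)).2 X hX2 (fun t ht => by
        obtain ⟨x', hx', rfl⟩ := Finset.mem_image.1 ht
        have hl := hleft x hx x' (hG𝓕 x' hx') i₀ (hGpre x' hx')
        have hr := hright x hx x' (hG𝓕 x' hx') i₀ (by rw [hρ'0]; exact hGpre x' hx')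
        rw [hρ'0] at hr
        refine ⟨?_, ?_⟩
        · rw [← hl]
          exact (hconf x' (hG𝓕 x' hx')).prime_left i₀
        · rw [← hr]
          exact (hconf x' (hG𝓕 x' hx')).prime_right i₀) hZX
    rw [hcardZ]
    refine hsieve.trans ?_
    have hcube : Real.log y ^ 3 ≤ 512 * logLog y ^ 3 * Real.log X ^ 3 := by
      calc Real.log y ^ 3 ≤ (8 * logLog y * Real.log X) ^ 3 := by gcongr
        _ = _ := by ring
    have hXpos : 0 < X := by linarith
    have hinv : 1 / Real.log X ^ 3 ≤ 512 * logLog y ^ 3 / Real.log y ^ 3 := by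
      rw [div_le_div_iff₀ (by positivity) (by positivity)]
      linarith
    have hfac : 0 ≤ C₂ * X * logLog y ^ 3 := by positivity
    calc C₂ * (X * logLog y ^ 3 / Real.log X ^ 3)
        = C₂ * X * logLog y ^ 3 * (1 / Real.log X ^ 3) := by ring
      _ ≤ C₂ * X * logLog y ^ 3 * (512 * logLog y ^ 3 / Real.log y ^ 3) :=
          mul_le_mul_of_nonneg_left hinv hfac
      _ = K * W := by rw [hK, hX]; ring

/-! ### Prime factors of normal values -/

theorem logLog_mono {x z : ℝ} (hx : Real.exp 1 ≤ x) (h : x ≤ z) : logLog x ≤ logLog z := by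
  have h1 : 1 ≤ Real.log x := by
    rw [Real.le_log_iff_exp_le ((Real.exp_pos 1).trans_le hx)]
    exact hx
  exact Real.log_le_log (by linarith)
    (Real.log_le_log ((Real.exp_pos 1).trans_le hx) h)

theorem one_le_logLog {x : ℝ} (hx : Real.exp (Real.exp 1) ≤ x) : 1 ≤ logLog x := by
  have hx0 := (Real.exp_pos _).trans_le hx
  have h1 : Real.exp 1 ≤ Real.log x := (Real.le_log_iff_exp_le hx0).2 hx
  exact (Real.le_log_iff_exp_le ((Real.exp_pos 1).trans_le h1)).2 h1

theorem exp_one_le_exp_exp_one : Real.exp 1 ≤ Real.exp (Real.exp 1) :=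
  Real.exp_le_exp.2 (by linarith [Real.add_one_le_exp (1 : ℝ)])

theorem bigOmegaBetween_add (n : ℕ) {U T W : ℝ} (h₁ : U ≤ T) (h₂ : T ≤ W) :
    bigOmegaBetween n U W = bigOmegaBetween n U T + bigOmegaBetween n T W := by
  classical
  rw [bigOmegaBetween, bigOmegaBetween, bigOmegaBetween, Finset.sum_filter, Finset.sum_filter,
    Finset.sum_filter, ← Finset.sum_add_distrib]
  refine Finset.sum_congr rfl fun p _ => ?_
  by_cases hT : (p : ℝ) ≤ T
  · have h3 : ¬T < p := not_lt.2 hT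
    have h4 : (p : ℝ) ≤ W := hT.trans h₂
    simp [hT, h3, h4]
  · have h3 : T < p := not_le.1 hT
    have h4 : U < p := h₁.trans_lt h3
    simp [hT, h3, h4]

theorem bigOmegaBetween_min (n : ℕ) (U T : ℝ) :
    bigOmegaBetween n U (min T n) = bigOmegaBetween n U T := by
  classical
  rw [bigOmegaBetween, bigOmegaBetween]
  congr 1
  refine Finset.filter_congr fun p hp => ?_
  have : (p : ℝ) ≤ n := by exact_mod_cast Nat.le_of_mem_primeFactors hp
  simp [this]

theorem bigOmegaBetween_eq_zero {n : ℕ} {U T : ℝ} (h : T ≤ U) : bigOmegaBetween n U T = 0 := by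
  classical
  rw [bigOmegaBetween, Finset.filter_false_of_mem, Finset.sum_empty]
  intro p _ hp
  linarith [hp.1, hp.2]

theorem cardFactors_smoothPart (V : ℝ) (n : ℕ) :
    ArithmeticFunction.cardFactors (smoothPart V n) = bigOmegaBetween n 1 V := by
  classical
  rw [ArithmeticFunction.cardFactors_eq_sum_factorization, factorization_smoothPart, Finsupp.sum,
    Finsupp.support_filter, Nat.support_factorization, bigOmegaBetween]
  have h1 : n.primeFactors.filter (fun p : ℕ => (1 : ℝ) < p ∧ (p : ℝ) ≤ V) =
      n.primeFactors.filter (fun p : ℕ => (p : ℝ) ≤ V) := by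
    refine Finset.filter_congr fun p hp => and_iff_right ?_
    exact_mod_cast (Nat.prime_of_mem_primeFactors hp).one_lt
  rw [h1]
  refine Finset.sum_congr rfl fun p hp => ?_
  rw [Finsupp.filter_apply, if_pos (Finset.mem_filter.1 hp).2]

/-- Normality only speaks of T ≤ m; a larger T can be lowered to m without changing the count. -/
theorem NormalValue.bigOmegaBetween_le {S : ℝ} {m : ℕ} (h : NormalValue S m)
    (hS : Real.exp (Real.exp 1) ≤ S) {U T : ℝ} (hU : S ≤ U) (hT : U ≤ T) :
    (bigOmegaBetween m U T : ℝ) ≤ logLog T - logLog U + Real.sqrt (logLog S * logLog T) := by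
  have he : Real.exp 1 ≤ U := exp_one_le_exp_exp_one.trans (hS.trans hU)
  have hmono := logLog_mono he hT
  rw [← bigOmegaBetween_min]
  rcases le_or_gt (min T (m : ℝ)) U with hle | hlt
  · rw [bigOmegaBetween_eq_zero hle, Nat.cast_zero]
    linarith [Real.sqrt_nonneg (logLog S * logLog T)]
  · have h1 := (abs_lt.1 (h.2 U (min T m) hU hlt (min_le_right _ _))).2
    have h2 : logLog (min T (m : ℝ)) ≤ logLog T := logLog_mono (he.trans hlt.le) (min_le_left _ _)
    have h3 : Real.sqrt (logLog S * logLog (min T (m : ℝ))) ≤ Real.sqrt (logLog S * logLog T) :=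
      Real.sqrt_le_sqrt (mul_le_mul_of_nonneg_left h2 (by linarith [one_le_logLog hS]))
    linarith

theorem sqrt_mul_logLog_le {S T : ℝ} (hS : Real.exp (Real.exp 1) ≤ S) (h : S ≤ T) :
    Real.sqrt (logLog S * logLog T) ≤ logLog T := by
  have h1 := one_le_logLog hS
  have h2 := logLog_mono (exp_one_le_exp_exp_one.trans hS) h
  rw [← Real.sqrt_sq (show 0 ≤ logLog T by linarith)]
  refine Real.sqrt_le_sqrt ?_
  rw [Real.sqrt_sq (by linarith)]
  nlinarith

/-- Up to S there are at most 2 log log S prime factors; from S to V at most log log V - log log S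
plus a square root that is itself at most log log V. -/
theorem NormalValue.cardFactors_smoothPart_le {S : ℝ} {m : ℕ} (h : NormalValue S m)
    (hS : Real.exp (Real.exp 1) ≤ S) {V : ℝ} (hV : S ≤ V) :
    (ArithmeticFunction.cardFactors (smoothPart V m) : ℝ) ≤ 3 * logLog V := by
  have h1S : 1 ≤ S := by linarith [Real.add_one_le_exp (Real.exp 1), Real.exp_pos 1]
  rw [cardFactors_smoothPart, bigOmegaBetween_add m h1S hV]
  push_cast
  have h1 := h.1
  have h2 := h.bigOmegaBetween_le hS le_rfl hV
  have h3 := sqrt_mul_logLog_le hS hV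
  have h4 := logLog_mono (exp_one_le_exp_exp_one.trans hS) hV
  linarith

theorem log_le_cardFactors_mul {n : ℕ} (hn : n ≠ 0) :
    Real.log n ≤ ArithmeticFunction.cardFactors n * Real.log (largestPrimeFactor n) := by
  rw [ArithmeticFunction.cardFactors_eq_sum_factorization, Finsupp.sum]
  conv_lhs => rw [← Nat.prod_factorization_pow_eq_self hn]
  rw [Finsupp.prod, Nat.cast_prod, Real.log_prod, Nat.cast_sum, Finset.sum_mul]
  · refine Finset.sum_le_sum fun p hp => ?_
    rw [Nat.support_factorization, Nat.mem_primeFactors] at hp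
    rw [Nat.cast_pow, Real.log_pow]
    refine mul_le_mul_of_nonneg_left (Real.log_le_log (by exact_mod_cast hp.1.pos) ?_)
      (Nat.cast_nonneg _)
    exact_mod_cast le_largestPrimeFactor hn hp.1 hp.2.1
  · intro p hp
    rw [Nat.support_factorization, Nat.mem_primeFactors] at hp
    exact_mod_cast (pow_pos hp.1.pos _).ne'

theorem IsNormalPrime.normalValue_sub_one {S : ℝ} {p : ℕ} (h : IsNormalPrime S p) :
    NormalValue S (p - 1) := by
  simpa [Nat.totient_prime h.1] using h.2.1

theorem sigma_one_prime {p : ℕ} (hp : p.Prime) : ArithmeticFunction.sigma 1 p = p + 1 := by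
  rw [ArithmeticFunction.sigma_one_apply, Nat.Prime.sum_divisors hp]

/-! ### The windows -/

/-- The hypotheses on the windows `[u_j, v_j]`. -/
structure SieveWindows (y S : ℝ) (k : ℕ) (u v μ ν : ℕ → ℝ) (δ : ℝ) : Prop where
  exp_le : Real.exp (Real.exp 1) ≤ S
  le_last : S ≤ v k
  succ_le : ∀ j, j < k → v (j + 1) ≤ v j
  zero_eq : v 0 = y
  lower : ∀ j, j < k → 1 < u j ∧ u j ≤ v j
  delta_eq : δ = Real.sqrt (logLog S / logLog y)
  nu_eq : ∀ j, ν j = logLog (v j) / logLog y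
  mu_eq : ∀ j, μ j = logLog (u j) / logLog y
  step : ∀ j, 2 ≤ j → j ≤ k - 1 →
    (μ j = μ (j - 1) ∧ ν j = ν (j - 1)) ∨ ν j ≤ μ (j - 1) - 2 * δ
  last : ν k ≤ μ (k - 1) - 2 * δ
  gap : ∀ j, 1 ≤ j → j + 2 ≤ k → ν (j + 2) < ν j

namespace SieveWindows

variable {y S : ℝ} {k : ℕ} {u v μ ν : ℕ → ℝ} {δ : ℝ}

theorem antitone (h : SieveWindows y S k u v μ ν δ) {i j : ℕ} (hij : i ≤ j) (hj : j ≤ k) :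
    v j ≤ v i := by
  induction j, hij using Nat.le_induction with
  | base => exact le_rfl
  | succ n hn ih => exact (h.succ_le n (by omega)).trans (ih (by omega))

theorem le_v (h : SieveWindows y S k u v μ ν δ) {j : ℕ} (hj : j ≤ k) : S ≤ v j :=
  h.le_last.trans (h.antitone hj le_rfl)

theorem exp_le_v (h : SieveWindows y S k u v μ ν δ) {j : ℕ} (hj : j ≤ k) :
    Real.exp (Real.exp 1) ≤ v j := h.exp_le.trans (h.le_v hj)

theorem exp_le_y (h : SieveWindows y S k u v μ ν δ) : Real.exp (Real.exp 1) ≤ y :=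
  h.zero_eq ▸ h.exp_le_v (Nat.zero_le k)

theorem one_le_L (h : SieveWindows y S k u v μ ν δ) : 1 ≤ logLog y := one_le_logLog h.exp_le_y

theorem nu_mul (h : SieveWindows y S k u v μ ν δ) (j : ℕ) : ν j * logLog y = logLog (v j) := by
  have := h.one_le_L
  rw [h.nu_eq, div_mul_cancel₀ _ (by linarith)]

theorem mu_mul (h : SieveWindows y S k u v μ ν δ) (j : ℕ) : μ j * logLog y = logLog (u j) := by
  have := h.one_le_L
  rw [h.mu_eq, div_mul_cancel₀ _ (by linarith)]

theorem nu_zero (h : SieveWindows y S k u v μ ν δ) : ν 0 = 1 := by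
  have := h.one_le_L
  rw [h.nu_eq, h.zero_eq, div_self (by linarith)]

theorem nu_pos (h : SieveWindows y S k u v μ ν δ) {j : ℕ} (hj : j ≤ k) : 0 < ν j := by
  have h1 := h.one_le_L
  have h2 := one_le_logLog (h.exp_le_v hj)
  rw [h.nu_eq]
  positivity

theorem nu_antitone (h : SieveWindows y S k u v μ ν δ) {i j : ℕ} (hij : i ≤ j) (hj : j ≤ k) :
    ν j ≤ ν i := by
  have h1 := h.one_le_L
  rw [h.nu_eq, h.nu_eq]
  exact div_le_div_of_nonneg_right
    (logLog_mono (exp_one_le_exp_exp_one.trans (h.exp_le_v hj)) (h.antitone hij hj)) (by linarith)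

theorem delta_mul (h : SieveWindows y S k u v μ ν δ) :
    δ * logLog y = Real.sqrt (logLog S * logLog y) := by
  have h1 := h.one_le_L
  have h2 := one_le_logLog h.exp_le
  rw [h.delta_eq, Real.sqrt_div (by linarith), Real.sqrt_mul (by linarith)]
  have h3 : Real.sqrt (logLog y) * Real.sqrt (logLog y) = logLog y :=
    Real.mul_self_sqrt (by linarith)
  have h4 : 0 < Real.sqrt (logLog y) := Real.sqrt_pos.2 (by linarith)
  field_simp
  rw [sq, h3]

/-- Uses log log S ≥ 1. It gives δ log log y a lower bound tending to infinity with y, which absorbs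
the Mertens constant and also bounds k. -/
theorem sqrt_le_delta_mul (h : SieveWindows y S k u v μ ν δ) :
    Real.sqrt (logLog y) ≤ δ * logLog y := by
  have h1 := h.one_le_L
  have h2 := one_le_logLog h.exp_le
  rw [h.delta_mul]
  exact Real.sqrt_le_sqrt (by nlinarith)

theorem delta_pos (h : SieveWindows y S k u v μ ν δ) : 0 < δ := by
  have h1 := h.one_le_L
  have h2 := one_le_logLog h.exp_le
  rw [h.delta_eq]
  exact Real.sqrt_pos.2 (by positivity)

theorem mu_le_nu (h : SieveWindows y S k u v μ ν δ) {j : ℕ} (hj : j < k) : μ j ≤ ν j := by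
  have h1 := h.one_le_L
  obtain ⟨h2, h3⟩ := h.lower j hj
  rw [h.nu_eq, h.mu_eq]
  refine div_le_div_of_nonneg_right ?_ (by linarith)
  exact Real.log_le_log (Real.log_pos h2) (Real.log_le_log (by linarith) h3)

theorem lt_of_nu_lt_mu (h : SieveWindows y S k u v μ ν δ) {i j : ℕ} (hi : i < k) (hj : j ≤ k)
    (hlt : ν j < μ i) : v j < u i := by
  have h1 := h.one_le_L
  rw [h.nu_eq, h.mu_eq, div_lt_div_iff_of_pos_right (by linarith)] at hlt
  have hu := (h.lower i hi).1
  have hv := h.exp_le_v hj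
  have hv0 := (Real.exp_pos _).trans_le hv
  have hv1 : 0 < Real.log (v j) :=
    Real.log_pos (by linarith [Real.add_one_le_exp (Real.exp 1), Real.exp_pos 1])
  exact (Real.log_lt_log_iff hv0 (by linarith)).1
    ((Real.log_lt_log_iff hv1 (Real.log_pos hu)).1 hlt)

/-- If the windows i, i+1, i+2 all coincided, ν_i = ν_{i+2} would contradict `gap`. So one of the
two steps is a drop by 2δ, where `last` serves as the second step if i + 2 = k. -/
theorem nu_add_two_le (h : SieveWindows y S k u v μ ν δ) {i : ℕ} (hi : 1 ≤ i) (hik : i + 2 ≤ k) :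
    ν (i + 2) ≤ μ i - 2 * δ := by
  have hanti := h.nu_antitone (Nat.le_succ (i + 1)) hik
  rcases h.step (i + 1) (by omega) (by omega) with ⟨h1, h2⟩ | h1
  · rw [Nat.add_sub_cancel] at h1 h2
    rcases Nat.lt_or_ge (i + 2) k with h3 | h3
    · rcases h.step (i + 2) (by omega) (by omega) with ⟨h4, h5⟩ | h4
      · have h6 := h.gap i hi hik
        have h7 : i + 2 - 1 = i + 1 := by omega
        rw [h7] at h5
        linarith
      · have h7 : i + 2 - 1 = i + 1 := by omega
        rw [h7, h1] at h4
        exact h4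
    · have h4 : i + 2 = k := by omega
      have h5 := h.last
      have h6 : k - 1 = i + 1 := by omega
      rw [h6, h1] at h5
      rw [h4]
      exact h5
  · rw [Nat.add_sub_cancel] at h1
    exact hanti.trans h1

theorem v_add_two_lt (h : SieveWindows y S k u v μ ν δ) {i j : ℕ} (hi : 1 ≤ i) (hij : i + 2 ≤ j)
    (hj : j ≤ k) : v j < u i := by
  have h1 := h.nu_add_two_le hi (hij.trans hj)
  have h2 := h.delta_pos
  have h3 := h.nu_antitone hij hj
  exact h.lt_of_nu_lt_mu (by omega) hj (by linarith)

/-- Ensures that the largest prime factors of the entries of positive index are rough. -/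
theorem v_last_lt (h : SieveWindows y S k u v μ ν δ) {i : ℕ} (hi : 1 ≤ i) (hik : i < k) :
    v k < u i := by
  rcases Nat.lt_or_ge (i + 1) k with h1 | h1
  · exact h.v_add_two_lt hi h1 le_rfl
  · have h2 : i = k - 1 := by omega
    have h3 := h.last
    have h4 := h.delta_pos
    rw [← h2] at h3
    exact h.lt_of_nu_lt_mu hik le_rfl (by linarith)

/-- Starting from ν_1 ≤ 1, the ν_j stay positive and drop by at least 2δ every two steps, while δ ≥
(log log y)^(-1/2); so k is at most 3 (log log y)^(1/2). -/
theorem sq_le (h : SieveWindows y S k u v μ ν δ) : (k : ℝ) ^ 2 ≤ 9 * logLog y := by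
  have hL := h.one_le_L
  have hδ := h.delta_pos
  have hs : 1 ≤ Real.sqrt (logLog y) := Real.one_le_sqrt.2 hL
  have hs2 : Real.sqrt (logLog y) * Real.sqrt (logLog y) = logLog y :=
    Real.mul_self_sqrt (by linarith)
  have hiter : ∀ m : ℕ, 2 * m + 1 ≤ k → ν (2 * m + 1) + 2 * m * δ ≤ 1 := by
    intro m
    induction m with
    | zero =>
      intro h1
      have := h.nu_antitone (Nat.zero_le 1) h1
      rw [h.nu_zero] at this
      simpa using this
    | succ m ih =>
      intro h1
      have h2 := ih (by omega)
      have h3 := h.nu_add_two_le (i := 2 * m + 1) (by omega) (by omega)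
      have h4 := h.mu_le_nu (j := 2 * m + 1) (by omega)
      have h5 : 2 * (m + 1) + 1 = 2 * m + 1 + 2 := by ring
      rw [h5]
      push_cast
      linarith
  have hk : (k : ℝ) ≤ 3 * Real.sqrt (logLog y) := by
    rcases Nat.eq_zero_or_pos k with rfl | hkpos
    · simp
    · have h1 := hiter ((k - 1) / 2) (by omega)
      have h2 := h.nu_pos (j := 2 * ((k - 1) / 2) + 1) (by omega)
      have h3 : (k : ℝ) ≤ 2 * (((k - 1) / 2 : ℕ) : ℝ) + 2 := by
        have : k ≤ 2 * ((k - 1) / 2) + 2 := by omega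
        exact_mod_cast this
      have h4 : 2 * (((k - 1) / 2 : ℕ) : ℝ) * δ ≤ 1 := by linarith
      have h5 := h.sqrt_le_delta_mul
      have h6 : 2 * (((k - 1) / 2 : ℕ) : ℝ) * Real.sqrt (logLog y) ≤ logLog y := by
        have h7 : (0 : ℝ) ≤ 2 * (((k - 1) / 2 : ℕ) : ℝ) := by positivity
        calc _ ≤ 2 * (((k - 1) / 2 : ℕ) : ℝ) * (δ * logLog y) := mul_le_mul_of_nonneg_left h5 h7
          _ = 2 * (((k - 1) / 2 : ℕ) : ℝ) * δ * logLog y := by ring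
          _ ≤ 1 * logLog y := mul_le_mul_of_nonneg_right h4 (by linarith)
          _ = _ := one_mul _
      have h7 := le_of_mul_le_mul_right (h6.trans_eq hs2.symm) (by linarith)
      linarith
  nlinarith [Nat.cast_nonneg (α := ℝ) k]

end SieveWindows

/-! ### Solutions are sieve configurations -/

theorem prime_le_of_largestPrimeFactor_le {V : ℝ} {n r : ℕ} (hn : n ≠ 0)
    (h : (largestPrimeFactor n : ℝ) ≤ V) (hr : r.Prime) (hd : r ∣ n) : (r : ℝ) ≤ V :=
  le_trans (by exact_mod_cast le_largestPrimeFactor hn hr hd) h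

theorem factorization_prod_apply {ι : Type*} (s : Finset ι) (a : ι → ℕ) (ha : ∀ i ∈ s, a i ≠ 0)
    (r : ℕ) : (∏ i ∈ s, a i).factorization r = ∑ i ∈ s, (a i).factorization r := by
  rw [Nat.factorization_prod fun i hi => ha i hi, Finsupp.finsetSum_apply]

/-- If `p i ≠ p j` are primes then `(p i - 1) * (p j - 1)` divides `φ (∏ p)`. -/
theorem mul_dvd_totient_prod {ι : Type*} [Fintype ι] (p : ι → ℕ) (hp : ∀ i, (p i).Prime) {i j : ι}
    (hij : p i ≠ p j) : (p i - 1) * (p j - 1) ∣ Nat.totient (∏ i, p i) := by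
  classical
  have hne : i ≠ j := fun h => hij (congrArg p h)
  have hco : Nat.Coprime (p i) (p j) := (Nat.coprime_primes (hp i) (hp j)).2 hij
  rw [← Nat.totient_prime (hp i), ← Nat.totient_prime (hp j), ← Nat.totient_mul hco]
  refine Nat.totient_dvd_of_dvd ?_
  rw [← Finset.prod_pair hne]
  exact Finset.prod_dvd_prod_of_subset _ _ _ (Finset.subset_univ _)

/-- If the prime `q i` occurs only once in the family, then `q i + 1` divides `σ (∏ q)`. -/
theorem sigma_prod_eq {ι : Type*} [DecidableEq ι] (s : Finset ι) (q : ι → ℕ)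
    (hq : ∀ i, (q i).Prime) {i : ι} (hi : i ∈ s) (huniq : ∀ j ∈ s, q j = q i → j = i) :
    ArithmeticFunction.sigma 1 (∏ j ∈ s, q j) =
      (q i + 1) * ArithmeticFunction.sigma 1 (∏ j ∈ s.erase i, q j) := by
  rw [← Finset.mul_prod_erase s q hi, ArithmeticFunction.isMultiplicative_sigma.map_mul_of_coprime,
    sigma_one_prime (hq i)]
  refine Nat.Coprime.prod_right fun j hj => (Nat.coprime_primes (hq i) (hq j)).2 fun h => ?_
  obtain ⟨h1, h2⟩ := Finset.mem_erase.1 hj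
  exact h1 (huniq j h2 h.symm)

theorem largestPrimeFactor_mem_of_lt {a : ℕ} {V : ℝ} (hV : 1 ≤ V)
    (h : V < largestPrimeFactor a) : (largestPrimeFactor a).Prime ∧ largestPrimeFactor a ∣ a :=
  largestPrimeFactor_mem (by exact_mod_cast hV.trans_lt h)

theorem card_filter_val_le (k j : ℕ) :
    (Finset.univ.filter fun i : Fin k => (i : ℕ) ≤ j).card ≤ j + 1 := by
  refine le_trans (Finset.card_le_card_of_injOn (t := Finset.range (j + 1)) (fun i => (i : ℕ))
    (fun i hi => Finset.mem_coe.2 (Finset.mem_range.2 ?_)) fun i _ i' _ hii => Fin.ext hii)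
    (Finset.card_range _).le
  exact Nat.lt_succ_of_le (Finset.mem_filter.1 (Finset.mem_coe.1 hi)).2

namespace IsSieveSolution

variable {y S : ℝ} {k l d : ℕ} {hk : 1 ≤ k} {u v μ ν : ℕ → ℝ} {δ : ℝ} {p q : Fin k → ℕ} {e f : ℕ}

theorem left_ne_zero (h : IsSieveSolution y S k l d hk u v p q e f) (i : Fin k) : p i - 1 ≠ 0 := by
  have := (h.normal i).1.1.two_le
  omega

theorem smooth_of_dvd (h : IsSieveSolution y S k l d hk u v p q e f) (hd : d ≠ 0)
    (hdv : (largestPrimeFactor d : ℝ) ≤ v k) {r : ℕ} (hr : r.Prime)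
    (hdvd : r ∣ e ∨ r ∣ f ∨ r ∣ d) : (r : ℝ) ≤ v k := by
  have hef : e * f ≠ 0 := mul_ne_zero h.e_pos.ne' h.f_pos.ne'
  rcases hdvd with h1 | h1 | h1
  · exact prime_le_of_largestPrimeFactor_le hef h.smooth hr (h1.mul_right _)
  · exact prime_le_of_largestPrimeFactor_le hef h.smooth hr (h1.mul_left _)
  · exact prime_le_of_largestPrimeFactor_le hd hdv hr h1

theorem exists_dvd_right (h : IsSieveSolution y S k l d hk u v p q e f) (hd : d ≠ 0)
    (hdv : (largestPrimeFactor d : ℝ) ≤ v k) {r : ℕ} (hr : r.Prime) (hV : v k < r) {i : Fin k}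
    (hdvd : r ∣ p i - 1) : ∃ j, r ∣ q j + 1 := by
  have h1 : r ∣ (∏ i, (q i + 1)) * e := by
    rw [← h.eqn, mul_assoc]
    exact (hdvd.trans (Finset.dvd_prod_of_mem (fun i => p i - 1) (Finset.mem_univ i))).mul_right _
  rcases hr.dvd_mul.1 h1 with h2 | h2
  · obtain ⟨j, _, hj⟩ := (hr.prime.dvd_finsetProd_iff _).1 h2
    exact ⟨j, hj⟩
  · exact absurd (h.smooth_of_dvd hd hdv hr (Or.inl h2)) (not_le.2 hV)

theorem exists_dvd_left (h : IsSieveSolution y S k l d hk u v p q e f) (hd : d ≠ 0)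
    (hdv : (largestPrimeFactor d : ℝ) ≤ v k) {r : ℕ} (hr : r.Prime) (hV : v k < r) {i : Fin k}
    (hdvd : r ∣ q i + 1) : ∃ j, r ∣ p j - 1 := by
  have h1 : r ∣ (∏ i, (p i - 1)) * f * d := by
    rw [h.eqn]
    exact (hdvd.trans (Finset.dvd_prod_of_mem (fun i => q i + 1) (Finset.mem_univ i))).mul_right _
  rcases hr.dvd_mul.1 h1 with h2 | h2
  · rcases hr.dvd_mul.1 h2 with h3 | h3
    · obtain ⟨j, _, hj⟩ := (hr.prime.dvd_finsetProd_iff _).1 h3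
      exact ⟨j, hj⟩
    · exact absurd (h.smooth_of_dvd hd hdv hr (Or.inr (Or.inl h3))) (not_le.2 hV)
  · exact absurd (h.smooth_of_dvd hd hdv hr (Or.inr (Or.inr h2))) (not_le.2 hV)

theorem left_eq_of_dvd (h : IsSieveSolution y S k l d hk u v p q e f) {r : ℕ} (hr : r.Prime)
    (hV : v k < r) {i j : Fin k} (hi : r ∣ p i - 1) (hj : r ∣ p j - 1) : p i = p j := by
  by_contra hne
  refine (h.squarefree r hr hV.le).1 (dvd_trans ?_
    (mul_dvd_totient_prod p (fun i => (h.normal i).1.1) hne))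
  rw [sq]
  exact mul_dvd_mul hi hj

theorem left_not_sq_dvd (h : IsSieveSolution y S k l d hk u v p q e f) {r : ℕ} (hr : r.Prime)
    (hV : v k < r) (i : Fin k) : ¬r ^ 2 ∣ p i - 1 := by
  intro hdvd
  refine (h.squarefree r hr hV.le).1 (hdvd.trans ?_)
  rw [← Nat.totient_prime (h.normal i).1.1]
  exact Nat.totient_dvd_of_dvd (Finset.dvd_prod_of_mem p (Finset.mem_univ i))

theorem lower_top (h : IsSieveSolution y S k l d hk u v p q e f)
    (hw : SieveWindows y S k u v μ ν δ) {i : Fin k} (hi : (i : ℕ) ≠ 0) :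
    v k < largestPrimeFactor (p i - 1) ∧ v k < largestPrimeFactor (q i + 1) := by
  have h1 := hw.v_last_lt (Nat.one_le_iff_ne_zero.2 hi) i.2
  exact ⟨h1.trans_le (h.range_p i).1, h1.trans_le (h.range_q i).1⟩

theorem one_le_v (hw : SieveWindows y S k u v μ ν δ) {j : ℕ} (hj : j ≤ k) : 1 ≤ v j := by
  linarith [hw.exp_le_v hj, Real.add_one_le_exp (Real.exp 1), Real.exp_pos 1]

/-- Any prime factor of the divisor in condition (v) will do. This separates index 0 from the
others, whose largest prime factors are at most v_1. -/
theorem exists_rough_prime (h : IsSieveSolution y S k l d hk u v p q e f)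
    (hw : SieveWindows y S k u v μ ν δ) : v 1 < largestPrimeFactor (p ⟨0, hk⟩ - 1) := by
  obtain ⟨b, hb, hyb, hrough⟩ := h.rough
  have hy : 1 < y := by
    linarith [hw.exp_le_y, Real.add_one_le_exp (Real.exp 1), Real.exp_pos 1]
  have hb1 : b ≠ 1 := by
    rintro rfl
    have := Real.one_lt_rpow hy (show (0 : ℝ) < 1 / 2 by norm_num)
    rw [Nat.cast_one] at hyb
    linarith
  obtain ⟨r, hr, hrb⟩ := Nat.exists_prime_and_dvd hb1
  refine (hrough r hr hrb).trans_le ?_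
  exact_mod_cast le_largestPrimeFactor (h.left_ne_zero _) hr (hrb.trans hb)

theorem top_gt (h : IsSieveSolution y S k l d hk u v p q e f)
    (hw : SieveWindows y S k u v μ ν δ) (i : Fin k) : v k < largestPrimeFactor (p i - 1) := by
  by_cases hi : (i : ℕ) = 0
  · have h1 : i = ⟨0, hk⟩ := Fin.ext hi
    rw [h1]
    exact (hw.antitone hk le_rfl).trans_lt (h.exists_rough_prime hw)
  · exact (h.lower_top hw hi).1

theorem top_le_v_one (h : IsSieveSolution y S k l d hk u v p q e f)
    (hw : SieveWindows y S k u v μ ν δ) {i : Fin k} (hi : (i : ℕ) ≠ 0) :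
    (largestPrimeFactor (p i - 1) : ℝ) ≤ v 1 ∧ (largestPrimeFactor (q i + 1) : ℝ) ≤ v 1 := by
  have h1 := hw.antitone (Nat.one_le_iff_ne_zero.2 hi) i.2.le
  exact ⟨(h.range_p i).2.trans h1, (h.range_q i).2.trans h1⟩

/-- The largest prime of p_0 - 1 exceeds v_1, so through the equation it divides some q_j + 1, and
only j = 0 has primes that large. The same argument in the other direction gives equality. -/
theorem top_eq (h : IsSieveSolution y S k l d hk u v p q e f)
    (hw : SieveWindows y S k u v μ ν δ) (hd : d ≠ 0) (hdv : (largestPrimeFactor d : ℝ) ≤ v k) :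
    largestPrimeFactor (p ⟨0, hk⟩ - 1) = largestPrimeFactor (q ⟨0, hk⟩ + 1) := by
  have h1 := h.exists_rough_prime hw
  have hv := hw.antitone hk le_rfl
  have hv1 : 1 ≤ v 1 := one_le_v hw hk
  have hle : largestPrimeFactor (p ⟨0, hk⟩ - 1) ≤ largestPrimeFactor (q ⟨0, hk⟩ + 1) := by
    obtain ⟨hp, hdvd⟩ := largestPrimeFactor_mem_of_lt hv1 h1
    obtain ⟨j, hj⟩ := h.exists_dvd_right hd hdv hp (hv.trans_lt h1) hdvd
    have h2 := le_largestPrimeFactor (Nat.succ_ne_zero _) hp hj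
    by_cases hj0 : (j : ℕ) = 0
    · rwa [show j = ⟨0, hk⟩ from Fin.ext hj0] at h2
    · have h3 := (h.top_le_v_one hw hj0).2
      have h4 : (largestPrimeFactor (p ⟨0, hk⟩ - 1) : ℝ) ≤ largestPrimeFactor (q j + 1) := by
        exact_mod_cast h2
      linarith
  refine le_antisymm hle ?_
  have h1' : v 1 < largestPrimeFactor (q ⟨0, hk⟩ + 1) := h1.trans_le (by exact_mod_cast hle)
  obtain ⟨hp, hdvd⟩ := largestPrimeFactor_mem_of_lt hv1 h1'
  obtain ⟨j, hj⟩ := h.exists_dvd_left hd hdv hp (hv.trans_lt h1') hdvd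
  have h2 := le_largestPrimeFactor (h.left_ne_zero j) hp hj
  by_cases hj0 : (j : ℕ) = 0
  · rwa [show j = ⟨0, hk⟩ from Fin.ext hj0] at h2
  · have h3 := (h.top_le_v_one hw hj0).1
    have h4 : (largestPrimeFactor (q ⟨0, hk⟩ + 1) : ℝ) ≤ largestPrimeFactor (p j - 1) := by
      exact_mod_cast h2
    linarith

/-- Equal primes `p i = p j` have adjacent indices. -/
theorem index_le_of_eq (h : IsSieveSolution y S k l d hk u v p q e f)
    (hw : SieveWindows y S k u v μ ν δ) {i j : Fin k} (hij : i < j) (heq : p i = p j) :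
    0 < (i : ℕ) ∧ (j : ℕ) = i + 1 := by
  have hlt : (i : ℕ) < j := hij
  have hi : 0 < (i : ℕ) := by
    by_contra hcon
    have h1 := h.exists_rough_prime hw
    rw [show (⟨0, hk⟩ : Fin k) = i from Fin.ext (by simp; omega), heq] at h1
    have := (h.top_le_v_one hw (i := j) (by omega)).1
    linarith
  refine ⟨hi, ?_⟩
  by_contra hcon
  -- Windows of positive index two or more apart are disjoint, so one prime factor cannot be the top
  -- in both.
  have h1 := hw.v_add_two_lt (i := i) (j := j) hi (by omega) j.2.le
  have h2 := (h.range_p i).1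
  have h3 := (h.range_p j).2
  rw [heq] at h2
  linarith

/-- All p_i with r ∣ p_i - 1 are equal, and equal ones have adjacent indices, which leaves no room
for three. -/
theorem card_dvd_le_two (h : IsSieveSolution y S k l d hk u v p q e f)
    (hw : SieveWindows y S k u v μ ν δ) {r : ℕ} (hr : r.Prime) (hV : v k < r) :
    (Finset.univ.filter fun i => r ∣ p i - 1).card ≤ 2 := by
  by_contra hcon
  obtain ⟨i₁, i₂, i₃, h1, h2, h3, h12, h23⟩ : ∃ i₁ i₂ i₃ : Fin k, r ∣ p i₁ - 1 ∧ r ∣ p i₂ - 1 ∧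
      r ∣ p i₃ - 1 ∧ i₁ < i₂ ∧ i₂ < i₃ := by
    set s := Finset.univ.filter fun i => r ∣ p i - 1
    have hc : 3 ≤ s.card := by omega
    have hmem : ∀ m : Fin 3, r ∣ p (s.orderEmbOfCardLe hc m) - 1 := fun m =>
      (Finset.mem_filter.1 (show s.orderEmbOfCardLe hc m ∈ Finset.univ.filter fun i => r ∣ p i - 1
        from s.orderEmbOfCardLe_mem hc m)).2
    exact ⟨_, _, _, hmem 0, hmem 1, hmem 2, by simp, by simp⟩
  have e12 := (h.index_le_of_eq hw h12 (h.left_eq_of_dvd hr hV h1 h2)).2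
  have e13 := (h.index_le_of_eq hw (h12.trans h23) (h.left_eq_of_dvd hr hV h1 h3)).2
  have h4 : (i₂ : ℕ) < i₃ := h23
  omega

/-- If a prime q repeats, q + 1 need not divide σ of the product, so condition (iii) cannot be
applied directly to the right side. Its exponent of r is read off the left side instead: d, e, f
contribute nothing, and at most two factors p_i - 1 contribute one each. -/
theorem factorization_right_le (h : IsSieveSolution y S k l d hk u v p q e f)
    (hw : SieveWindows y S k u v μ ν δ) (hd : d ≠ 0) (hdv : (largestPrimeFactor d : ℝ) ≤ v k)
    {r : ℕ} (hr : r.Prime) (hV : v k < r) : ∑ i, (q i + 1).factorization r ≤ 2 := by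
  have hz : ∀ n : ℕ, (n = e ∨ n = f ∨ n = d) → n.factorization r = 0 := by
    intro n hn
    refine Nat.factorization_eq_zero_of_not_dvd fun hdvd => absurd
      (h.smooth_of_dvd hd hdv hr ?_) (not_le.2 hV)
    rcases hn with rfl | rfl | rfl
    exacts [Or.inl hdvd, Or.inr (Or.inl hdvd), Or.inr (Or.inr hdvd)]
  have hP : ∏ i, (p i - 1) ≠ 0 := Finset.prod_ne_zero_iff.2 fun i _ => h.left_ne_zero i
  have hQ : ∏ i, (q i + 1) ≠ 0 := Finset.prod_ne_zero_iff.2 fun i _ => Nat.succ_ne_zero _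
  have h1 := congrArg (fun n : ℕ => n.factorization r) h.eqn
  simp only [Nat.factorization_mul (mul_ne_zero hP h.f_pos.ne') hd, Nat.factorization_mul hP
    h.f_pos.ne', Nat.factorization_mul hQ h.e_pos.ne', Finsupp.add_apply, hz e (Or.inl rfl),
    hz f (Or.inr (Or.inl rfl)), hz d (Or.inr (Or.inr rfl)), add_zero] at h1
  rw [factorization_prod_apply _ _ fun i _ => h.left_ne_zero i,
    factorization_prod_apply _ _ fun i _ => Nat.succ_ne_zero _] at h1
  rw [← h1]
  refine le_trans ?_ (h.card_dvd_le_two hw hr hV)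
  rw [Finset.card_filter]
  refine Finset.sum_le_sum fun i _ => ?_
  split_ifs with h2
  · by_contra hcon
    exact h.left_not_sq_dvd hr hV i
      ((hr.pow_dvd_iff_le_factorization (h.left_ne_zero i)).2 (by omega))
  · rw [Nat.factorization_eq_zero_of_not_dvd h2]

theorem right_unique (h : IsSieveSolution y S k l d hk u v p q e f)
    (hw : SieveWindows y S k u v μ ν δ) (hd : d ≠ 0) (hdv : (largestPrimeFactor d : ℝ) ≤ v k)
    {r : ℕ} (hr : r.Prime) (hV : v k < r) (s : Finset (Fin k)) (hs : ∀ i ∈ s, r ∣ q i + 1) :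
    s.card ≤ 2 := by
  refine le_trans ?_ (h.factorization_right_le hw hd hdv hr hV)
  rw [Finset.card_eq_sum_ones]
  calc ∑ _i ∈ s, 1 ≤ ∑ i ∈ s, (q i + 1).factorization r :=
        Finset.sum_le_sum fun i hi => hr.factorization_pos_of_dvd (Nat.succ_ne_zero _) (hs i hi)
    _ ≤ _ := Finset.sum_le_sum_of_subset (Finset.subset_univ _)

/-- If q_i ≠ q_j, these two indices exhaust the exponent 2, so neither prime is repeated. Then (q_i
+ 1)(q_j + 1) divides σ of the product, against condition (iii). -/
theorem right_eq_of_dvd (h : IsSieveSolution y S k l d hk u v p q e f)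
    (hw : SieveWindows y S k u v μ ν δ) (hd : d ≠ 0) (hdv : (largestPrimeFactor d : ℝ) ≤ v k)
    {r : ℕ} (hr : r.Prime) (hV : v k < r) {i j : Fin k} (hi : r ∣ q i + 1) (hj : r ∣ q j + 1) :
    q i = q j := by
  classical
  by_contra hne
  have hij : i ≠ j := fun h => hne (congrArg q h)
  have hu : ∀ m, r ∣ q m + 1 → m = i ∨ m = j := by
    intro m hm
    by_contra! hcon
    have := h.right_unique hw hd hdv hr hV {m, i, j} (by
      intro t ht
      simp only [Finset.mem_insert, Finset.mem_singleton] at ht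
      rcases ht with rfl | rfl | rfl <;> assumption)
    rw [Finset.card_insert_of_notMem (by simp [hcon.1, hcon.2]), Finset.card_pair hij] at this
    omega
  refine (h.squarefree r hr hV.le).2 ?_
  rw [sigma_prod_eq Finset.univ q (fun i => (h.normal i).2.1) (Finset.mem_univ i),
    sigma_prod_eq (Finset.univ.erase i) q (fun i => (h.normal i).2.1)
      (Finset.mem_erase.2 ⟨hij.symm, Finset.mem_univ j⟩), ← mul_assoc, sq]
  · exact (mul_dvd_mul hi hj).mul_right _
  · intro m _ hm
    rcases hu m (hm ▸ hj) with rfl | rfl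
    · exact absurd hm hne
    · rfl
  · intro m _ hm
    rcases hu m (hm ▸ hi) with rfl | rfl
    · rfl
    · exact absurd hm.symm hne

/-- A repetition of q_i would give r an exponent of at least 4. So q_i occurs once, q_i + 1 divides
σ of the product, and condition (iii) applies. -/
theorem right_not_sq_dvd (h : IsSieveSolution y S k l d hk u v p q e f)
    (hw : SieveWindows y S k u v μ ν δ) (hd : d ≠ 0) (hdv : (largestPrimeFactor d : ℝ) ≤ v k)
    {r : ℕ} (hr : r.Prime) (hV : v k < r) (i : Fin k) : ¬r ^ 2 ∣ q i + 1 := by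
  classical
  intro hdvd
  refine (h.squarefree r hr hV.le).2 ?_
  rw [sigma_prod_eq Finset.univ q (fun i => (h.normal i).2.1) (Finset.mem_univ i)]
  · exact hdvd.mul_right _
  · intro m _ hm
    by_contra hmi
    have h1 := h.factorization_right_le hw hd hdv hr hV
    have h2 : ∑ t ∈ {m, i}, (q t + 1).factorization r ≤ ∑ t, (q t + 1).factorization r :=
      Finset.sum_le_sum_of_subset (Finset.subset_univ _)
    rw [Finset.sum_pair hmi, hm] at h2
    have h3 := (hr.pow_dvd_iff_le_factorization (Nat.succ_ne_zero (q i))).1 hdvd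
    rw [Nat.succ_eq_add_one] at h3
    omega

theorem half_left (h : IsSieveSolution y S k l d hk u v p q e f)
    (hw : SieveWindows y S k u v μ ν δ) (hd : d ≠ 0) (hdv : (largestPrimeFactor d : ℝ) ≤ v k) :
    HalfStructure (v k) (fun i => p i - 1) (fun i => q i + 1) where
  ne_zero := h.left_ne_zero
  eq_of_dvd _ hr hV _ _ hi hj := congrArg (· - 1) (h.left_eq_of_dvd hr hV hi hj)
  sqfree _ hr hV i := h.left_not_sq_dvd hr hV i
  dvd_other _ hr hV _ hi := h.exists_dvd_right hd hdv hr hV hi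
  top_prime i := (largestPrimeFactor_mem_of_lt (one_le_v hw le_rfl) (h.top_gt hw i)).1
  top_gt i := h.top_gt hw i

theorem top_gt_right (h : IsSieveSolution y S k l d hk u v p q e f)
    (hw : SieveWindows y S k u v μ ν δ) (hd : d ≠ 0) (hdv : (largestPrimeFactor d : ℝ) ≤ v k)
    (i : Fin k) : v k < largestPrimeFactor (q i + 1) := by
  by_cases hi : (i : ℕ) = 0
  · rw [show i = ⟨0, hk⟩ from Fin.ext hi, ← h.top_eq hw hd hdv]
    exact h.top_gt hw _
  · exact (h.lower_top hw hi).2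

theorem half_right (h : IsSieveSolution y S k l d hk u v p q e f)
    (hw : SieveWindows y S k u v μ ν δ) (hd : d ≠ 0) (hdv : (largestPrimeFactor d : ℝ) ≤ v k) :
    HalfStructure (v k) (fun i => q i + 1) (fun i => p i - 1) where
  ne_zero _ := Nat.succ_ne_zero _
  eq_of_dvd _ hr hV _ _ hi hj := congrArg (· + 1) (h.right_eq_of_dvd hw hd hdv hr hV hi hj)
  sqfree _ hr hV i := h.right_not_sq_dvd hw hd hdv hr hV i
  dvd_other _ hr hV _ hi := h.exists_dvd_left hd hdv hr hV hi
  top_prime i :=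
    (largestPrimeFactor_mem_of_lt (one_le_v hw le_rfl) (h.top_gt_right hw hd hdv i)).1
  top_gt i := h.top_gt_right hw hd hdv i

theorem left_le (h : IsSieveSolution y S k l d hk u v p q e f) (i : Fin k) :
    ((p i - 1 : ℕ) : ℝ) ≤ y := by
  refine le_trans ?_ h.le
  rw [← h.eqn, mul_assoc]
  have h1 : p i - 1 ∣ (∏ i, (p i - 1)) * (f * d) :=
    (Finset.dvd_prod_of_mem (fun i => p i - 1) (Finset.mem_univ i)).mul_right _
  have h2 : 0 < (∏ i, (p i - 1)) * (f * d) := by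
    rw [← mul_assoc, h.eqn]
    exact Nat.mul_pos (Finset.prod_pos fun i _ => Nat.succ_pos _) h.e_pos
  exact_mod_cast Nat.le_of_dvd h2 h1

/-- By normality p_0 - 1 has at most 3 log log y prime factors, and by (v) it is at least y^(1/2),
so its largest prime factor is large. -/
theorem top_large (h : IsSieveSolution y S k l d hk u v p q e f)
    (hw : SieveWindows y S k u v μ ν δ) :
    Real.log y ≤ 8 * logLog y * Real.log (largestPrimeFactor (p ⟨0, hk⟩ - 1)) := by
  obtain ⟨b, hb, hyb, hrough⟩ := h.rough
  have hy := hw.exp_le_y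
  have hy0 : 0 < y := (Real.exp_pos _).trans_le hy
  have hL := hw.one_le_L
  set n := p ⟨0, hk⟩ - 1 with hn
  have hn0 : n ≠ 0 := h.left_ne_zero _
  have h1 : (1 / 2) * Real.log y ≤ Real.log n := by
    rw [← Real.log_rpow hy0]
    refine Real.log_le_log (Real.rpow_pos_of_pos hy0 _) (hyb.trans ?_)
    exact_mod_cast Nat.le_of_dvd (Nat.pos_of_ne_zero hn0) hb
  have h2 := log_le_cardFactors_mul hn0
  have h3 : smoothPart y n = n := smoothPart_eq_self hn0 fun r hr hdvd =>
    le_trans (by exact_mod_cast Nat.le_of_dvd (Nat.pos_of_ne_zero hn0) hdvd) (h.left_le _)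
  have h4 := ((h.normal ⟨0, hk⟩).1.normalValue_sub_one).cardFactors_smoothPart_le hw.exp_le
    (hw.zero_eq ▸ hw.le_v (Nat.zero_le k))
  rw [← hn, h3] at h4
  have h5 : 0 ≤ Real.log (largestPrimeFactor n) := Real.log_natCast_nonneg _
  have h6 := mul_le_mul_of_nonneg_right h4 h5
  nlinarith

theorem sieveConfig (h : IsSieveSolution y S k l d hk u v p q e f)
    (hw : SieveWindows y S k u v μ ν δ) (hd : d ≠ 0) (hdv : (largestPrimeFactor d : ℝ) ≤ v k) :
    SieveConfig y (v k) d (fun i : Fin k => u i) ⟨0, hk⟩ (fun i => p i - 1) (fun i => q i + 1)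
      e f where
  left := h.half_left hw hd hdv
  right := h.half_right hw hd hdv
  e_pos := h.e_pos
  f_pos := h.f_pos
  eqn := h.eqn
  le := h.le
  smooth _ hr hdvd := h.smooth_of_dvd hd hdv hr (Or.inr (hr.dvd_mul.1 hdvd))
  prime_left i := by
    rw [Nat.sub_add_cancel (h.normal i).1.1.one_le]
    exact (h.normal i).1.1
  prime_right i := (h.normal i).2.1
  le_top_left i := (h.range_p i).1
  le_top_right i := (h.range_q i).1
  top_eq := h.top_eq hw hd hdv
  top_lt_left i hi := by
    have h1 := (h.top_le_v_one hw fun h0 => hi (Fin.ext h0)).1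
    exact_mod_cast h1.trans_lt (h.exists_rough_prime hw)
  top_lt_right i hi := by
    have h1 := (h.top_le_v_one hw fun h0 => hi (Fin.ext h0)).2
    have h2 := h1.trans_lt (h.exists_rough_prime hw)
    rw [h.top_eq hw hd hdv] at h2
    exact_mod_cast h2
  top_large := h.top_large hw

/-- An entry divisible by a prime above `v (j + 1)` has index at most `j`. -/
theorem index_le_of_dvd (h : IsSieveSolution y S k l d hk u v p q e f)
    (hw : SieveWindows y S k u v μ ν δ) {r j : ℕ} (hr : r.Prime) (hj : v (j + 1) < r)
    {i : Fin k} (hi : r ∣ p i - 1 ∨ r ∣ q i + 1) : (i : ℕ) ≤ j := by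
  by_contra hcon
  have h1 := hw.antitone (i := j + 1) (j := i) (by omega) i.2.le
  rcases hi with hi | hi
  · have h2 := prime_le_of_largestPrimeFactor_le (h.left_ne_zero i) (h.range_p i).2 hr hi
    linarith
  · have h2 := prime_le_of_largestPrimeFactor_le (Nat.succ_ne_zero _) (h.range_q i).2 hr hi
    linarith

/-- A prime above v_{j+1} divides only entries p_i - 1 with i ≤ j, and normality limits the number
of primes of the window in each of these j + 1 entries. -/
theorem card_ordinaryPrimes_le (h : IsSieveSolution y S k l d hk u v p q e f)
    (hw : SieveWindows y S k u v μ ν δ) {j : ℕ} (hj : j < k) :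
    (((ordinaryPrimes y (v k) (fun i => p i - 1) (fun i => q i + 1)).filter
      fun r : ℕ => v (j + 1) < r ∧ (r : ℝ) ≤ v j).card : ℝ) ≤
        ((j : ℝ) + 1) * ((ν j - ν (j + 1)) * logLog y + δ * logLog y) := by
  classical
  set s := (ordinaryPrimes y (v k) (fun i => p i - 1) (fun i => q i + 1)).filter
      fun r : ℕ => v (j + 1) < r ∧ (r : ℝ) ≤ v j with hs
  have h1 : s ⊆ (Finset.univ.filter fun i : Fin k => (i : ℕ) ≤ j).biUnion fun i =>
      (p i - 1).primeFactors.filter fun r : ℕ => v (j + 1) < r ∧ (r : ℝ) ≤ v j := by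
    intro r hr
    obtain ⟨h2, h3⟩ := Finset.mem_filter.1 hr
    have h4 := mem_ordinaryPrimes.1 h2
    obtain ⟨i, hi⟩ := Option.ne_none_iff_exists'.1 h4.2.2
    have h5 := (ordinaryIndex_eq_some hi).2
    refine Finset.mem_biUnion.2 ⟨i, Finset.mem_filter.2 ⟨Finset.mem_univ _,
      h.index_le_of_dvd hw h4.1.2 h3.1 (Or.inl h5)⟩, Finset.mem_filter.2
      ⟨Nat.mem_primeFactors.2 ⟨h4.1.2, h5, h.left_ne_zero i⟩, h3⟩⟩
  have h2 : ∀ i : Fin k, (((p i - 1).primeFactors.filter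
      fun r : ℕ => v (j + 1) < r ∧ (r : ℝ) ≤ v j).card : ℝ) ≤
        (ν j - ν (j + 1)) * logLog y + δ * logLog y := by
    intro i
    have h3 : ((p i - 1).primeFactors.filter
      fun r : ℕ => v (j + 1) < r ∧ (r : ℝ) ≤ v j).card ≤
        bigOmegaBetween (p i - 1) (v (j + 1)) (v j) := by
      rw [bigOmegaBetween, Finset.card_eq_sum_ones]
      refine le_trans (le_of_eq ?_) (Finset.sum_le_sum (f := fun _ => 1) fun r hr => ?_)
      · congr
      · have h4 := Nat.mem_primeFactors.1 (Finset.mem_filter.1 hr).1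
        exact h4.1.factorization_pos_of_dvd h4.2.2 h4.2.1
    have h4 := ((h.normal i).1.normalValue_sub_one).bigOmegaBetween_le hw.exp_le
      (hw.le_v (j := j + 1) hj) (hw.succ_le j hj)
    have h5 : Real.sqrt (logLog S * logLog (v j)) ≤ δ * logLog y := by
      rw [hw.delta_mul]
      refine Real.sqrt_le_sqrt (mul_le_mul_of_nonneg_left ?_ (by linarith [one_le_logLog hw.exp_le]))
      rw [← hw.zero_eq]
      exact logLog_mono (exp_one_le_exp_exp_one.trans (hw.exp_le_v hj.le))
        (hw.antitone (Nat.zero_le j) hj.le)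
    rw [sub_mul, hw.nu_mul, hw.nu_mul]
    refine le_trans (by exact_mod_cast h3) (h4.trans (by linarith))
  have h6 := card_filter_val_le k j
  have h7 : 0 ≤ (ν j - ν (j + 1)) * logLog y + δ * logLog y :=
    le_trans (Nat.cast_nonneg _) (h2 ⟨j, hj⟩)
  calc (s.card : ℝ) ≤ ∑ i ∈ Finset.univ.filter fun i : Fin k => (i : ℕ) ≤ j,
        (((p i - 1).primeFactors.filter
          fun r : ℕ => v (j + 1) < r ∧ (r : ℝ) ≤ v j).card : ℝ) := by
        exact_mod_cast (Finset.card_le_card h1).trans Finset.card_biUnion_le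
    _ ≤ ∑ _i ∈ Finset.univ.filter fun i : Fin k => (i : ℕ) ≤ j,
        ((ν j - ν (j + 1)) * logLog y + δ * logLog y) := Finset.sum_le_sum fun i _ => h2 i
    _ = ((Finset.univ.filter fun i : Fin k => (i : ℕ) ≤ j).card : ℝ) *
        ((ν j - ν (j + 1)) * logLog y + δ * logLog y) := by rw [Finset.sum_const, nsmul_eq_mul]
    _ ≤ _ := mul_le_mul_of_nonneg_right (by exact_mod_cast h6) h7

end IsSieveSolution

theorem finite_sieveSolutions {y S : ℝ} {k l d : ℕ} {hk : 1 ≤ k} {u v : ℕ → ℝ} :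
    (sieveSolutions y S k l d hk u v).Finite := by
  set N := ⌊y⌋₊ + 1
  refine Set.Finite.subset
    ((Set.Finite.pi' (fun _ : Fin k => Set.finite_Iic N)).prod
      ((Set.Finite.pi' (fun _ : Fin k => Set.finite_Iic N)).prod
        ((Set.finite_Iic N).prod (Set.finite_Iic N)))) ?_
  rintro ⟨p, q, e, f⟩ h
  have h : IsSieveSolution y S k l d hk u v p q e f := h
  have htot : 0 < (∏ i, (q i + 1)) * e :=
    Nat.mul_pos (Finset.prod_pos fun i _ => Nat.succ_pos _) h.e_pos
  have hdvd : ∀ n : ℕ, n ∣ (∏ i, (q i + 1)) * e → n ≤ ⌊y⌋₊ := fun n hn =>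
    Nat.le_floor (le_trans (by exact_mod_cast Nat.le_of_dvd htot hn) h.le)
  refine ⟨fun i => ?_, fun i => ?_, ?_, ?_⟩
  · have h1 := hdvd (p i - 1) (by
      rw [← h.eqn, mul_assoc]
      exact (Finset.dvd_prod_of_mem (fun i => p i - 1) (Finset.mem_univ i)).mul_right _)
    simp only [Set.mem_Iic]
    omega
  · have h1 := hdvd (q i + 1)
      ((Finset.dvd_prod_of_mem (fun i => q i + 1) (Finset.mem_univ i)).mul_right _)
    simp only [Set.mem_Iic]
    omega
  · have h1 := hdvd e (dvd_mul_left _ _)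
    simp only [Set.mem_Iic]
    omega
  · have h1 := hdvd f (by
      rw [← h.eqn, mul_assoc]
      exact (dvd_mul_right f d).mul_left _)
    simp only [Set.mem_Iic]
    omega

/-! ### Sums over codes -/

/-- The triples of codes that occur are embedded in the product of the three ranges, so the weighted
sum factors. The third component carries no weight and is merely counted. -/
theorem card_le_of_code_bounds {α β γ τ : Type*} [DecidableEq β] [DecidableEq γ] [DecidableEq τ]
    [Fintype τ] (𝓕 : Finset α) (g₁ : α → β)
    (g₂ : α → γ) (g₃ : α → τ) (w₁ : β → ℝ) (w₂ : γ → ℝ) (K : ℝ) (hK : 0 ≤ K)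
    (hw₁ : ∀ b, 0 ≤ w₁ b) (hw₂ : ∀ c, 0 ≤ w₂ c)
    (h : ∀ x ∈ 𝓕, ((𝓕.filter fun x' => g₁ x' = g₁ x ∧ g₂ x' = g₂ x ∧ g₃ x' = g₃ x).card : ℝ) ≤
      K * (w₁ (g₁ x) * w₂ (g₂ x))) :
    (𝓕.card : ℝ) ≤
      K * Fintype.card τ * ((∑ b ∈ 𝓕.image g₁, w₁ b) * ∑ c ∈ 𝓕.image g₂, w₂ c) := by
  rw [Finset.card_eq_sum_card_image (fun x => (g₁ x, g₂ x, g₃ x)) 𝓕]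
  push_cast
  calc _ ≤ ∑ t ∈ 𝓕.image (fun x => (g₁ x, g₂ x, g₃ x)), K * (w₁ t.1 * w₂ t.2.1) := by
        refine Finset.sum_le_sum fun t ht => ?_
        obtain ⟨x, hx, rfl⟩ := Finset.mem_image.1 ht
        simp only [Prod.mk.injEq]
        exact h x hx
    _ ≤ ∑ t ∈ 𝓕.image g₁ ×ˢ 𝓕.image g₂ ×ˢ (Finset.univ : Finset τ), K * (w₁ t.1 * w₂ t.2.1) := by
        refine Finset.sum_le_sum_of_subset_of_nonneg (fun t ht => ?_) fun t _ _ =>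
          mul_nonneg hK (mul_nonneg (hw₁ _) (hw₂ _))
        obtain ⟨x, hx, rfl⟩ := Finset.mem_image.1 ht
        exact Finset.mem_product.2 ⟨Finset.mem_image_of_mem _ hx,
          Finset.mem_product.2 ⟨Finset.mem_image_of_mem _ hx, Finset.mem_univ _⟩⟩
    _ = _ := by
        rw [Finset.sum_product]
        simp only [Finset.sum_product, Finset.sum_const, Finset.card_univ, nsmul_eq_mul]
        rw [Finset.sum_mul_sum, Finset.mul_sum]
        refine Finset.sum_congr rfl fun b _ => ?_
        rw [Finset.mul_sum]
        refine Finset.sum_congr rfl fun c _ => ?_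
        ring

/-- Each prime factor of n, with multiplicity, goes to one of m places. -/
theorem card_finMulAntidiag_le (m n : ℕ) :
    (Nat.finMulAntidiag m n).card ≤ m ^ ArithmeticFunction.cardFactors n := by
  induction n using induction_on_primes with
  | zero => simp
  | one =>
    rw [ArithmeticFunction.cardFactors_one, pow_zero]
    have h1 : ∀ s ∈ Nat.finMulAntidiag m 1, ∀ i, s i = 1 := fun s hs i => Nat.dvd_one.1
      ((Nat.mem_finMulAntidiag.1 hs).1 ▸ Finset.dvd_prod_of_mem s (Finset.mem_univ i))
    exact Finset.card_le_one.2 fun s hs t ht => funext fun i => by rw [h1 s hs, h1 t ht]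
  | prime_mul p a hp ih =>
    rcases Nat.eq_zero_or_pos a with rfl | ha
    · simp
    · rw [ArithmeticFunction.cardFactors_mul hp.ne_zero ha.ne',
        ArithmeticFunction.cardFactors_apply_prime hp, add_comm, pow_succ]
      have hsub : Nat.finMulAntidiag m (p * a) ⊆
          ((Nat.finMulAntidiag m a) ×ˢ (Finset.univ : Finset (Fin m))).image
            fun z => Function.update z.1 z.2 (p * z.1 z.2) := by
        intro t ht
        rw [Nat.mem_finMulAntidiag] at ht
        obtain ⟨i, _, c, hc⟩ := (hp.prime.dvd_finsetProd_iff _).1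
          (show p ∣ ∏ i, t i from ht.1 ▸ dvd_mul_right p a)
        refine Finset.mem_image.2 ⟨(Function.update t i c, i), Finset.mem_product.2
          ⟨Nat.mem_finMulAntidiag.2 ⟨?_, ha.ne'⟩, Finset.mem_univ _⟩, ?_⟩
        · refine Nat.eq_of_mul_eq_mul_left hp.pos ?_
          rw [← ht.1, Finset.prod_update_of_mem (Finset.mem_univ i), ← mul_assoc, ← hc,
            Finset.sdiff_singleton_eq_erase, Finset.mul_prod_erase _ _ (Finset.mem_univ i)]
        · simp [← hc]
      refine (Finset.card_le_card hsub).trans (Finset.card_image_le.trans ?_)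
      rw [Finset.card_product, Finset.card_univ, Fintype.card_fin]
      exact Nat.mul_le_mul_right m ih

/-- Fix n, the product of the left smooth parts and f. The left data factor n into k + 1 parts and
the right data factor nd into k + 1 parts, so there are at most (k+1)^(2Ω(n) + Ω(d)) possibilities.
What remains is the sum of 1/n over V-smooth n. -/
theorem exists_sum_low_le : ∃ C : ℝ, 0 < C ∧ ∀ (V B : ℝ) (k d : ℕ)
    (𝓛 : Finset ((Fin k → ℕ) × (Fin k → ℕ) × ℕ × ℕ)), Real.exp 1 ≤ V → 0 < d →
    (∀ x ∈ 𝓛, (∏ i, x.1 i) * x.2.2.2 * d = (∏ i, x.2.1 i) * x.2.2.1 ∧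
      (∏ i, x.1 i) * x.2.2.2 ≠ 0 ∧
      (∀ r : ℕ, r.Prime → r ∣ (∏ i, x.1 i) * x.2.2.2 → (r : ℝ) ≤ V) ∧
      (ArithmeticFunction.cardFactors ((∏ i, x.1 i) * x.2.2.2) : ℝ) ≤ B) →
    ∑ x ∈ 𝓛, ((d * x.2.2.2 * ∏ i, x.1 i : ℕ) : ℝ)⁻¹ ≤
      C * Real.log V * ((k : ℝ) + 1) ^ ArithmeticFunction.cardFactors d *
        ((k : ℝ) + 1) ^ (2 * B) / d := by
  classical
  obtain ⟨C, hC, hsum⟩ := exists_sum_inv_smooth_le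
  refine ⟨C, hC, fun V B k d 𝓛 hV hd h𝓛 => ?_⟩
  set g : (Fin k → ℕ) × (Fin k → ℕ) × ℕ × ℕ → ℕ := fun x => (∏ i, x.1 i) * x.2.2.2 with hg
  have hk1 : (1 : ℝ) ≤ (k : ℝ) + 1 := by linarith [Nat.cast_nonneg (α := ℝ) k]
  have hd' : (0 : ℝ) < d := by exact_mod_cast hd
  set M : ℝ := ((k : ℝ) + 1) ^ ArithmeticFunction.cardFactors d * ((k : ℝ) + 1) ^ (2 * B) with hM
  have hM0 : 0 ≤ M := by positivity
  have hfib : ∀ n ∈ 𝓛.image g, ((𝓛.filter fun x => g x = n).card : ℝ) ≤ M := by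
    intro n hn
    obtain ⟨x₀, hx₀, rfl⟩ := Finset.mem_image.1 hn
    obtain ⟨_, h0, _, hΩ⟩ := h𝓛 x₀ hx₀
    have hcard : (𝓛.filter fun x => g x = g x₀).card ≤
        (k + 1) ^ ArithmeticFunction.cardFactors (g x₀) *
          (k + 1) ^ ArithmeticFunction.cardFactors (g x₀ * d) := by
      refine le_trans (Finset.card_le_card_of_injOn
        (t := Nat.finMulAntidiag (k + 1) (g x₀) ×ˢ Nat.finMulAntidiag (k + 1) (g x₀ * d))
        (fun x => (Fin.cons x.2.2.2 x.1, Fin.cons x.2.2.1 x.2.1)) ?_ ?_) ?_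
      · intro x hx
        obtain ⟨hx1, hx2⟩ := Finset.mem_filter.1 (Finset.mem_coe.1 hx)
        refine Finset.mem_coe.2 (Finset.mem_product.2 ⟨Nat.mem_finMulAntidiag.2 ⟨?_, h0⟩,
          Nat.mem_finMulAntidiag.2 ⟨?_, mul_ne_zero h0 hd.ne'⟩⟩)
        · rw [← hx2, Fin.prod_univ_succ]
          simp only [Fin.cons_zero, Fin.cons_succ, hg]
          ring
        · rw [← hx2, Fin.prod_univ_succ]
          simp only [Fin.cons_zero, Fin.cons_succ, hg]
          rw [(h𝓛 x hx1).1]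
          ring
      · rintro ⟨s, s', e, f⟩ _ ⟨t, t', e', f'⟩ _ heq
        simp only [Prod.mk.injEq, Fin.cons_inj] at heq ⊢
        tauto
      · rw [Finset.card_product]
        exact Nat.mul_le_mul (card_finMulAntidiag_le _ _) (card_finMulAntidiag_le _ _)
    have hcard' : ((𝓛.filter fun x => g x = g x₀).card : ℝ) ≤
        ((k : ℝ) + 1) ^ ArithmeticFunction.cardFactors (g x₀) *
          ((k : ℝ) + 1) ^ ArithmeticFunction.cardFactors (g x₀ * d) := by exact_mod_cast hcard
    refine hcard'.trans ?_
    rw [ArithmeticFunction.cardFactors_mul h0 hd.ne', pow_add]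
    have h1 : ((k : ℝ) + 1) ^ ArithmeticFunction.cardFactors (g x₀) *
        ((k : ℝ) + 1) ^ ArithmeticFunction.cardFactors (g x₀) ≤ ((k : ℝ) + 1) ^ (2 * B) := by
      rw [← pow_add, ← Real.rpow_natCast]
      refine Real.rpow_le_rpow_of_exponent_le hk1 ?_
      push_cast
      linarith
    calc _ = ((k : ℝ) + 1) ^ ArithmeticFunction.cardFactors d *
        (((k : ℝ) + 1) ^ ArithmeticFunction.cardFactors (g x₀) *
        ((k : ℝ) + 1) ^ ArithmeticFunction.cardFactors (g x₀)) := by ring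
      _ ≤ _ := mul_le_mul_of_nonneg_left h1 (by positivity)
  have hs := hsum V (𝓛.image g) hV (by
    intro n hn
    obtain ⟨x, hx, rfl⟩ := Finset.mem_image.1 hn
    exact ⟨(h𝓛 x hx).2.1, (h𝓛 x hx).2.2.1⟩)
  rw [← Finset.sum_fiberwise_of_maps_to (t := 𝓛.image g) (g := g)
    fun x hx => Finset.mem_image_of_mem g hx]
  calc _ ≤ ∑ n ∈ 𝓛.image g, M / d * (n : ℝ)⁻¹ := by
        refine Finset.sum_le_sum fun n hn => ?_
        have h1 : ∀ x ∈ 𝓛.filter fun x => g x = n, ((d * x.2.2.2 * ∏ i, x.1 i : ℕ) : ℝ)⁻¹ =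
            (d : ℝ)⁻¹ * (n : ℝ)⁻¹ := by
          intro x hx
          rw [← (Finset.mem_filter.1 hx).2, ← mul_inv]
          congr 1
          rw [hg]
          push_cast
          ring
        rw [Finset.sum_congr rfl h1, Finset.sum_const, nsmul_eq_mul, div_eq_mul_inv, mul_assoc]
        exact mul_le_mul_of_nonneg_right (hfib n hn) (by positivity)
    _ = M / d * ∑ n ∈ 𝓛.image g, (n : ℝ)⁻¹ := by rw [Finset.mul_sum]
    _ ≤ M / d * (C * Real.log V) := mul_le_mul_of_nonneg_left hs (by positivity)
    _ = _ := by rw [hM]; ring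

/-- A tilting argument in the manner of Rankin. Bounding the sum directly would give exponents (lev
+ 1)²/r. Since the product of lev + 1 over the assigned primes is at most P, each weight may first
be divided by lev + 1; the (lev + 1)² choices then leave only (lev + 1)/r. -/
theorem sum_prod_assignments_le (R : Finset ℕ) (k : ℕ) (lev : ℕ → ℕ)
    (𝓓 : Finset (R → Option (Fin k) × Option (Fin k))) (P : ℝ) (hP : 0 ≤ P)
    (h₁ : ∀ D ∈ 𝓓, ∀ r : R, D r = (none, none) ∨ ∃ α β : Fin k, D r = (some α, some β) ∧
      (α : ℕ) ≤ lev r ∧ (β : ℕ) ≤ lev r)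
    (h₂ : ∀ D ∈ 𝓓, ∏ r : R, (if D r = (none, none) then (1 : ℝ) else lev r + 1) ≤ P) :
    ∑ D ∈ 𝓓, ∏ r : R, (if D r = (none, none) then (1 : ℝ) else ((r : ℕ) : ℝ)⁻¹) ≤
      P * Real.exp (∑ r ∈ R, ((lev r : ℝ) + 1) / r) := by
  set w : (r : R) → Option (Fin k) × Option (Fin k) → ℝ := fun r o =>
    if o = (none, none) then 1 else (((lev r : ℝ) + 1) * ((r : ℕ) : ℝ))⁻¹ with hw
  have hw0 : ∀ r o, 0 ≤ w r o := by
    intro r o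
    rw [hw]
    dsimp only
    split_ifs <;> positivity
  set A : R → Finset (Fin k) := fun r => Finset.univ.filter fun i : Fin k => (i : ℕ) ≤ lev r
  set t : R → Finset (Option (Fin k) × Option (Fin k)) := fun r =>
    {(none, none)} ∪ (A r ×ˢ A r).image fun z => (some z.1, some z.2) with ht
  have hpt : ∀ D ∈ 𝓓, ∏ r : R, (if D r = (none, none) then (1 : ℝ) else ((r : ℕ) : ℝ)⁻¹) ≤
      P * ∏ r : R, w r (D r) := by
    intro D hD
    have : ∏ r : R, (if D r = (none, none) then (1 : ℝ) else ((r : ℕ) : ℝ)⁻¹) =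
        (∏ r : R, (if D r = (none, none) then (1 : ℝ) else lev r + 1)) * ∏ r : R, w r (D r) := by
      rw [← Finset.prod_mul_distrib]
      refine Finset.prod_congr rfl fun r _ => ?_
      rw [hw]
      dsimp only
      split_ifs
      · rw [one_mul]
      · have : (lev r : ℝ) + 1 ≠ 0 := by positivity
        rw [mul_inv, ← mul_assoc, mul_inv_cancel₀ this, one_mul]
    rw [this]
    exact mul_le_mul_of_nonneg_right (h₂ D hD) (Finset.prod_nonneg fun r _ => hw0 r _)
  have hone : ∀ r : R, ∑ o ∈ t r, w r o ≤ Real.exp (((lev r : ℝ) + 1) / ((r : ℕ) : ℝ)) := by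
    intro r
    have hA : ((A r).card : ℝ) ≤ (lev r : ℝ) + 1 := by exact_mod_cast card_filter_val_le k (lev r)
    have hr0 : (0 : ℝ) ≤ ((r : ℕ) : ℝ) := Nat.cast_nonneg _
    have hN0 : (0 : ℝ) < (lev r : ℝ) + 1 := by positivity
    calc ∑ o ∈ t r, w r o ≤ ∑ o ∈ {((none : Option (Fin k)), (none : Option (Fin k)))}, w r o +
          ∑ o ∈ (A r ×ˢ A r).image (fun z => (some z.1, some z.2)), w r o := by
          rw [← Finset.sum_union_inter]
          exact le_add_of_nonneg_right (Finset.sum_nonneg fun o _ => hw0 r o)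
      _ ≤ 1 + ((lev r : ℝ) + 1) / ((r : ℕ) : ℝ) := by
          refine add_le_add ?_ ?_
          · rw [Finset.sum_singleton, hw]
            simp
          · have h1 : ∀ o ∈ (A r ×ˢ A r).image
                (fun z => ((some z.1 : Option (Fin k)), (some z.2 : Option (Fin k)))),
                w r o = (((lev r : ℝ) + 1) * ((r : ℕ) : ℝ))⁻¹ := by
              intro o ho
              obtain ⟨z, _, rfl⟩ := Finset.mem_image.1 ho
              rw [hw]
              simp
            rw [Finset.sum_congr rfl h1, Finset.sum_const, nsmul_eq_mul]
            have h2 : (((A r ×ˢ A r).image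
                (fun z => ((some z.1 : Option (Fin k)), (some z.2 : Option (Fin k))))).card : ℝ) ≤
                ((lev r : ℝ) + 1) * ((lev r : ℝ) + 1) := by
              have h3 := Finset.card_image_le (s := A r ×ˢ A r)
                (f := fun z => ((some z.1 : Option (Fin k)), (some z.2 : Option (Fin k))))
              rw [Finset.card_product] at h3
              have h4 : (((A r ×ˢ A r).image
                  (fun z => ((some z.1 : Option (Fin k)), (some z.2 : Option (Fin k))))).card : ℝ) ≤
                  ((A r).card : ℝ) * (A r).card := by exact_mod_cast h3
              exact h4.trans <| mul_le_mul hA hA (Nat.cast_nonneg _) hN0.le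
            refine (mul_le_mul_of_nonneg_right h2 (by positivity)).trans (le_of_eq ?_)
            rw [mul_inv, div_eq_mul_inv]
            field_simp
      _ ≤ _ := by
          rw [add_comm]
          exact Real.add_one_le_exp _
  have hsub : 𝓓 ⊆ Fintype.piFinset t := by
    intro D hD
    refine Fintype.mem_piFinset.2 fun r => ?_
    rw [ht]
    rcases h₁ D hD r with h | ⟨α, β, h, hα, hβ⟩
    · exact Finset.mem_union_left _ (Finset.mem_singleton.2 h)
    · refine Finset.mem_union_right _ (Finset.mem_image.2 ⟨(α, β), Finset.mem_product.2
        ⟨Finset.mem_filter.2 ⟨Finset.mem_univ _, hα⟩,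
          Finset.mem_filter.2 ⟨Finset.mem_univ _, hβ⟩⟩, h.symm⟩)
  calc _ ≤ ∑ D ∈ 𝓓, P * ∏ r : R, w r (D r) := Finset.sum_le_sum hpt
    _ = P * ∑ D ∈ 𝓓, ∏ r : R, w r (D r) := by rw [Finset.mul_sum]
    _ ≤ P * ∑ D ∈ Fintype.piFinset t, ∏ r : R, w r (D r) :=
        mul_le_mul_of_nonneg_left (Finset.sum_le_sum_of_subset_of_nonneg hsub fun D _ _ =>
          Finset.prod_nonneg fun r _ => hw0 r _) hP
    _ = P * ∏ r : R, ∑ o ∈ t r, w r o := by rw [Finset.prod_univ_sum]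
    _ ≤ P * ∏ r : R, Real.exp (((lev r : ℝ) + 1) / ((r : ℕ) : ℝ)) :=
        mul_le_mul_of_nonneg_left (Finset.prod_le_prod
          (fun r _ => Finset.sum_nonneg fun o _ => hw0 r o) fun r _ => hone r) hP
    _ = _ := by
        rw [← Real.exp_sum, Finset.sum_coe_sort R fun r : ℕ => ((lev r : ℝ) + 1) / (r : ℝ)]

/-! ### Counting solutions by their codes -/

theorem cardFactors_prod {ι : Type*} (s : Finset ι) (a : ι → ℕ) (ha : ∀ i ∈ s, a i ≠ 0) :
    ArithmeticFunction.cardFactors (∏ i ∈ s, a i) =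
      ∑ i ∈ s, ArithmeticFunction.cardFactors (a i) := by
  classical
  induction s using Finset.induction_on with
  | empty => simp
  | insert i s hi ih =>
    rw [Finset.prod_insert hi, Finset.sum_insert hi, ArithmeticFunction.cardFactors_mul
      (ha i (Finset.mem_insert_self _ _))
      (Finset.prod_ne_zero_iff.2 fun j hj => ha j (Finset.mem_insert_of_mem hj)),
      ih fun j hj => ha j (Finset.mem_insert_of_mem hj)]

theorem HalfStructure.exists_ordinaryIndex {V : ℝ} {k : ℕ} {a b : Fin k → ℕ}
    (h : HalfStructure V a b) {r : ℕ} (hr : r.Prime) (hV : V < r) {i : Fin k}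
    (hi : ordinaryIndex a b r = some i) : ∃ j, ordinaryIndex b a r = some j := by
  obtain ⟨h1, h2⟩ := ordinaryIndex_eq_some hi
  rw [ordinaryIndex, specialPrimes_comm, if_neg h1]
  exact exists_divIndex_eq_some (h.dvd_other r hr hV i h2)

/-- The primes in `(V, y]`. -/
noncomputable def roughPrimes (y V : ℝ) : Finset ℕ :=
  open Classical in (Nat.primesLE ⌊y⌋₊).filter fun r : ℕ => V < r

theorem mem_roughPrimes {y V : ℝ} {r : ℕ} :
    r ∈ roughPrimes y V ↔ (r ≤ ⌊y⌋₊ ∧ r.Prime) ∧ V < r := by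
  rw [roughPrimes, Finset.mem_filter, Nat.mem_primesLE]

/-- The smooth part of the code of a solution. -/
noncomputable def lowCode (V : ℝ) {k : ℕ} (x : (Fin k → ℕ) × (Fin k → ℕ) × ℕ × ℕ) :
    (Fin k → ℕ) × (Fin k → ℕ) × ℕ × ℕ :=
  (fun i => smoothPart V (x.1 i), fun i => smoothPart V (x.2.1 i), x.2.2.1, x.2.2.2)

/-- The assignment of the rough primes that are not special to the entries they divide. -/
noncomputable def assignment (y V : ℝ) {k : ℕ} (x : (Fin k → ℕ) × (Fin k → ℕ) × ℕ × ℕ) :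
    roughPrimes y V → Option (Fin k) × Option (Fin k) :=
  fun r => (ordinaryIndex x.1 x.2.1 r, ordinaryIndex x.2.1 x.1 r)

/-- The relative position of the special primes. -/
noncomputable def specialPattern {k : ℕ} (x : (Fin k → ℕ) × (Fin k → ℕ) × ℕ × ℕ) :
    (Fin k → Fin (2 * k)) × (Fin k → Fin (2 * k)) ×
      (Fin k → Option (Fin k)) × (Fin k → Option (Fin k)) :=
  (fun i => ⟨topRank x.1 x.2.1 i, (topRank_lt_card _ _ i).trans_le (card_specialPrimes_le _ _)⟩,
    fun i => ⟨topRank x.2.1 x.1 i, (topRank_lt_card _ _ i).trans_le (card_specialPrimes_le _ _)⟩,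
    fun i => divIndex x.1 (largestPrimeFactor (x.2.1 i)),
    fun i => divIndex x.2.1 (largestPrimeFactor (x.1 i)))

theorem card_specialPattern_le {k : ℕ} (hk : 1 ≤ k) :
    (Fintype.card ((Fin k → Fin (2 * k)) × (Fin k → Fin (2 * k)) ×
      (Fin k → Option (Fin k)) × (Fin k → Option (Fin k))) : ℝ) ≤ (2 * (k : ℝ)) ^ (4 * k) := by
  simp only [Fintype.card_prod, Fintype.card_fun, Fintype.card_fin, Fintype.card_option]
  have h1 : (k + 1) ^ k ≤ (2 * k) ^ k := Nat.pow_le_pow_left (by omega) k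
  have h2 : (2 * k) ^ k * ((2 * k) ^ k * ((k + 1) ^ k * (k + 1) ^ k)) ≤ (2 * k) ^ (4 * k) := by
    calc _ ≤ (2 * k) ^ k * ((2 * k) ^ k * ((2 * k) ^ k * (2 * k) ^ k)) := by gcongr
      _ = (2 * k) ^ (4 * k) := by
        rw [← pow_add, ← pow_add, ← pow_add]
        congr 1
        ring
  exact_mod_cast h2

namespace SieveConfig

variable {y V : ℝ} {k d : ℕ} {u : Fin k → ℝ} {i₀ : Fin k} {a b : Fin k → ℕ} {e f : ℕ}

theorem ordinaryIndex_eq_none (h : SieveConfig y V d u i₀ a b e f) {r : ℕ} (hr : ⌊y⌋₊ < r) :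
    ordinaryIndex a b r = none ∧ ordinaryIndex b a r = none := by
  have hy : ∀ n : ℕ, n ∣ (∏ i, b i) * e → n ≤ ⌊y⌋₊ := fun n hn => Nat.le_floor (h.cast_le_of_dvd hn)
  constructor
  · by_contra hne
    obtain ⟨i, hi⟩ := Option.ne_none_iff_exists'.1 hne
    have := hy r ((ordinaryIndex_eq_some hi).2.trans (h.left_dvd i))
    omega
  · by_contra hne
    obtain ⟨i, hi⟩ := Option.ne_none_iff_exists'.1 hne
    have := hy r ((ordinaryIndex_eq_some hi).2.trans (dvd_prod_mul b e i))
    omega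

theorem assignment_cases (h : SieveConfig y V d u i₀ a b e f) (r : roughPrimes y V) :
    assignment y V (a, b, e, f) r = (none, none) ∧ ordinaryIndex a b r = none ∨
      ∃ α β, assignment y V (a, b, e, f) r = (some α, some β) ∧ (r : ℕ) ∣ a α ∧ (r : ℕ) ∣ b β := by
  have hr := mem_roughPrimes.1 r.2
  rcases hα : ordinaryIndex a b r with _ | α
  · rcases hβ : ordinaryIndex b a r with _ | β
    · exact Or.inl ⟨Prod.ext hα hβ, rfl⟩
    · obtain ⟨α, hα'⟩ := h.right.exists_ordinaryIndex hr.1.2 hr.2 hβ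
      rw [hα] at hα'
      cases hα'
  · obtain ⟨β, hβ⟩ := h.left.exists_ordinaryIndex hr.1.2 hr.2 hα
    exact Or.inr ⟨α, β, Prod.ext hα hβ, (ordinaryIndex_eq_some hα).2, (ordinaryIndex_eq_some hβ).2⟩

theorem prod_assignment (h : SieveConfig y V d u i₀ a b e f) (w : ℕ → ℝ) :
    ∏ r : roughPrimes y V, (if assignment y V (a, b, e, f) r = (none, none) then (1 : ℝ) else w r) =
      ∏ r ∈ ordinaryPrimes y V a b, w r := by
  have h1 : ordinaryPrimes y V a b =
      (roughPrimes y V).filter fun r => ordinaryIndex a b r ≠ none := by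
    ext r
    rw [mem_ordinaryPrimes, Finset.mem_filter, mem_roughPrimes]
    tauto
  rw [h1, Finset.prod_filter, ← Finset.prod_coe_sort (roughPrimes y V)]
  refine Finset.prod_congr rfl fun r _ => ?_
  rcases h.assignment_cases r with ⟨h2, h3⟩ | ⟨α, β, h2, _⟩
  · rw [if_pos h2, if_neg (not_not.2 h3)]
  · have h3 : ordinaryIndex a b r = some α := congrArg Prod.fst h2
    rw [if_neg (by rw [h2]; simp), if_pos (by rw [h3]; simp)]

end SieveConfig

theorem codeEq_of_codes_eq {y V : ℝ} {k d : ℕ} {u : Fin k → ℝ} {i₀ : Fin k}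
    {x x' : (Fin k → ℕ) × (Fin k → ℕ) × ℕ × ℕ}
    (hx : SieveConfig y V d u i₀ x.1 x.2.1 x.2.2.1 x.2.2.2)
    (hx' : SieveConfig y V d u i₀ x'.1 x'.2.1 x'.2.2.1 x'.2.2.2)
    (h₁ : lowCode V x = lowCode V x') (h₂ : assignment y V x = assignment y V x')
    (h₃ : specialPattern x = specialPattern x') : CodeEq V x x' := by
  simp only [lowCode, specialPattern, Prod.mk.injEq, funext_iff, Fin.mk.injEq] at h₁ h₃
  have h4 : ∀ r : ℕ, r.Prime → V < r → ordinaryIndex x.1 x.2.1 r = ordinaryIndex x'.1 x'.2.1 r ∧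
      ordinaryIndex x.2.1 x.1 r = ordinaryIndex x'.2.1 x'.1 r := by
    intro r hr hV
    rcases Nat.lt_or_ge ⌊y⌋₊ r with hlt | hle
    · obtain ⟨h5, h6⟩ := hx.ordinaryIndex_eq_none hlt
      obtain ⟨h7, h8⟩ := hx'.ordinaryIndex_eq_none hlt
      rw [h5, h6, h7, h8]
      exact ⟨rfl, rfl⟩
    · have h5 := congrFun h₂ ⟨r, mem_roughPrimes.2 ⟨⟨hle, hr⟩, hV⟩⟩
      simpa [assignment] using h5
  refine ⟨⟨h₁.1, fun r hr hV => (h4 r hr hV).1, h₃.1, h₃.2.1, h₃.2.2.1, fun c hc => by omega⟩,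
    ⟨h₁.2.1, fun r hr hV => (h4 r hr hV).2, h₃.2.1, h₃.1, h₃.2.2.2, fun c hc => by omega⟩,
    Prod.ext h₁.2.2.1 h₁.2.2.2⟩

/-- The index `j` with `v (j + 1) < r ≤ v j`. -/
noncomputable def windowLevel (v : ℕ → ℝ) (k r : ℕ) : ℕ :=
  open Classical in Nat.findGreatest (fun j => (r : ℝ) ≤ v j) k

theorem windowLevel_spec {y : ℝ} {k : ℕ} {v : ℕ → ℝ} (hv : v 0 = y) (hy : 0 ≤ y) {r : ℕ}
    (hr : r ∈ roughPrimes y (v k)) :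
    windowLevel v k r < k ∧ (r : ℝ) ≤ v (windowLevel v k r) ∧
      v (windowLevel v k r + 1) < r := by
  classical
  obtain ⟨⟨h1, _⟩, h2⟩ := mem_roughPrimes.1 hr
  have h0 : (r : ℝ) ≤ v 0 := by
    rw [hv]
    exact (Nat.le_floor_iff hy).1 h1
  have h3 : (r : ℝ) ≤ v (windowLevel v k r) := by
    rw [windowLevel]
    exact Nat.findGreatest_spec (P := fun j => (r : ℝ) ≤ v j) (Nat.zero_le k) h0
  have h4 : windowLevel v k r ≤ k := by
    rw [windowLevel]
    exact Nat.findGreatest_le k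
  have h5 : windowLevel v k r < k := by
    refine lt_of_le_of_ne h4 fun h => ?_
    rw [h] at h3
    linarith
  refine ⟨h5, h3, ?_⟩
  by_contra hcon
  exact Nat.findGreatest_is_greatest (P := fun j => (r : ℝ) ≤ v j) (n := k)
    (k := windowLevel v k r + 1) (by rw [windowLevel]; exact Nat.lt_succ_self _) h5 (not_lt.1 hcon)

namespace SieveWindows

variable {y S : ℝ} {k : ℕ} {u v μ ν : ℕ → ℝ} {δ : ℝ}

theorem level_spec (h : SieveWindows y S k u v μ ν δ) {r : ℕ} (hr : r ∈ roughPrimes y (v k)) :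
    windowLevel v k r < k ∧ (r : ℝ) ≤ v (windowLevel v k r) ∧ v (windowLevel v k r + 1) < r :=
  windowLevel_spec h.zero_eq ((Real.exp_pos _).le.trans h.exp_le_y) hr

theorem sum_level_le (h : SieveWindows y S k u v μ ν δ) {c : ℝ}
    (hc : ∀ U T : ℝ, Real.exp 1 ≤ U → U ≤ T →
      ∑ p ∈ (Finset.Ioc ⌊U⌋₊ ⌊T⌋₊).filter Nat.Prime, 1 / (p : ℝ) ≤ logLog T - logLog U + c) :
    ∑ r ∈ roughPrimes y (v k), ((windowLevel v k r : ℝ) + 1) / r ≤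
      ∑ j ∈ Finset.range k, ((j : ℝ) + 1) * ((ν j - ν (j + 1)) * logLog y + c) := by
  rw [← Finset.sum_fiberwise_of_maps_to (t := Finset.range k) (g := windowLevel v k)
    fun r hr => Finset.mem_range.2 (h.level_spec hr).1]
  refine Finset.sum_le_sum fun j hj => ?_
  have hjk := Finset.mem_range.1 hj
  have h1 : ∀ r ∈ (roughPrimes y (v k)).filter fun r => windowLevel v k r = j,
      ((windowLevel v k r : ℝ) + 1) / r = ((j : ℝ) + 1) * (1 / (r : ℝ)) := by
    intro r hr
    rw [(Finset.mem_filter.1 hr).2]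
    ring
  rw [Finset.sum_congr rfl h1, ← Finset.mul_sum]
  refine mul_le_mul_of_nonneg_left ?_ (by positivity)
  rw [sub_mul, h.nu_mul, h.nu_mul]
  refine le_trans ?_ (hc (v (j + 1)) (v j) (exp_one_le_exp_exp_one.trans (h.exp_le_v hjk))
    (h.succ_le j hjk))
  refine Finset.sum_le_sum_of_subset_of_nonneg (fun r hr => ?_) fun r _ _ => by positivity
  obtain ⟨hr1, hr2⟩ := Finset.mem_filter.1 hr
  obtain ⟨_, h3, h4⟩ := h.level_spec hr1
  rw [hr2] at h3 h4
  have hv0 : ∀ i, i ≤ k → 0 ≤ v i := fun i hi => (Real.exp_pos _).le.trans (h.exp_le_v hi)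
  exact Finset.mem_filter.2 ⟨Finset.mem_Ioc.2 ⟨(Nat.floor_lt (hv0 _ hjk)).2 h4, Nat.le_floor h3⟩,
    (mem_roughPrimes.1 hr1).1.2⟩

end SieveWindows

namespace IsSieveSolution

variable {y S : ℝ} {k l d : ℕ} {hk : 1 ≤ k} {u v μ ν : ℕ → ℝ} {δ : ℝ} {p q : Fin k → ℕ} {e f : ℕ}

/-- Supplies the bound P for `sum_prod_assignments_le`, from the number of ordinary primes in each
window. -/
theorem prod_level_le (h : IsSieveSolution y S k l d hk u v p q e f)
    (hw : SieveWindows y S k u v μ ν δ) :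
    ∏ r ∈ ordinaryPrimes y (v k) (fun i => p i - 1) (fun i => q i + 1),
      ((windowLevel v k r : ℝ) + 1) ≤
        Real.exp (∑ j ∈ Finset.range k, ((j : ℝ) + 1) *
          ((ν j - ν (j + 1)) * logLog y + δ * logLog y) * Real.log ((j : ℝ) + 1)) := by
  classical
  set s := ordinaryPrimes y (v k) (fun i => p i - 1) (fun i => q i + 1) with hs
  have hmem : ∀ r ∈ s, r ∈ roughPrimes y (v k) := fun r hr => by
    have := mem_ordinaryPrimes.1 hr
    exact mem_roughPrimes.2 ⟨this.1, this.2.1⟩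
  have h1 : ∏ r ∈ s, ((windowLevel v k r : ℝ) + 1) =
      Real.exp (∑ r ∈ s, Real.log ((windowLevel v k r : ℝ) + 1)) := by
    rw [Real.exp_sum]
    exact Finset.prod_congr rfl fun r _ => (Real.exp_log (by positivity)).symm
  rw [h1, ← Finset.sum_fiberwise_of_maps_to (t := Finset.range k) (g := windowLevel v k)
    fun r hr => Finset.mem_range.2 (hw.level_spec (hmem r hr)).1]
  refine Real.exp_le_exp.2 (Finset.sum_le_sum fun j hj => ?_)
  have hjk := Finset.mem_range.1 hj
  have h2 : ∀ r ∈ s.filter fun r => windowLevel v k r = j,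
      Real.log ((windowLevel v k r : ℝ) + 1) = Real.log ((j : ℝ) + 1) := by
    intro r hr
    rw [(Finset.mem_filter.1 hr).2]
  rw [Finset.sum_congr rfl h2, Finset.sum_const, nsmul_eq_mul]
  refine mul_le_mul_of_nonneg_right (le_trans ?_ (h.card_ordinaryPrimes_le hw hjk))
    (Real.log_nonneg (by linarith [Nat.cast_nonneg (α := ℝ) j]))
  refine Nat.cast_le.2 (Finset.card_le_card fun r hr => ?_)
  obtain ⟨hr1, hr2⟩ := Finset.mem_filter.1 hr
  obtain ⟨_, h3, h4⟩ := hw.level_spec (hmem r hr1)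
  rw [hr2] at h3 h4
  exact Finset.mem_filter.2 ⟨hr1, h4, h3⟩

/-- Taking smooth parts is multiplicative and fixes d, e, f, so the equation survives. Normality
gives each left entry at most 3 log log v_k small prime factors, and (iv) bounds those of f. -/
theorem low_spec (h : IsSieveSolution y S k l d hk u v p q e f)
    (hw : SieveWindows y S k u v μ ν δ) (hd : d ≠ 0) (hdv : (largestPrimeFactor d : ℝ) ≤ v k) :
    (∏ i, smoothPart (v k) (p i - 1)) * f * d = (∏ i, smoothPart (v k) (q i + 1)) * e ∧
    (∏ i, smoothPart (v k) (p i - 1)) * f ≠ 0 ∧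
    (∀ r : ℕ, r.Prime → r ∣ (∏ i, smoothPart (v k) (p i - 1)) * f → (r : ℝ) ≤ v k) ∧
    (ArithmeticFunction.cardFactors ((∏ i, smoothPart (v k) (p i - 1)) * f) : ℝ) ≤
      4 * ((k : ℝ) + l) * logLog (v k) := by
  have hs0 : ∏ i, smoothPart (v k) (p i - 1) ≠ 0 :=
    Finset.prod_ne_zero_iff.2 fun i _ => smoothPart_ne_zero _ _
  refine ⟨?_, mul_ne_zero hs0 h.f_pos.ne', fun r hr hdvd => ?_, ?_⟩
  · have hP : ∏ i, (p i - 1) ≠ 0 := Finset.prod_ne_zero_iff.2 fun i _ => h.left_ne_zero i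
    have hQ : ∏ i, (q i + 1) ≠ 0 := Finset.prod_ne_zero_iff.2 fun i _ => Nat.succ_ne_zero _
    have h1 := congrArg (smoothPart (v k)) h.eqn
    rwa [smoothPart_mul _ (mul_ne_zero hP h.f_pos.ne') hd, smoothPart_mul _ hP h.f_pos.ne',
      smoothPart_mul _ hQ h.e_pos.ne', smoothPart_prod _ _ _ fun i _ => h.left_ne_zero i,
      smoothPart_prod _ _ _ fun i _ => Nat.succ_ne_zero _,
      smoothPart_eq_self h.f_pos.ne' fun r hr hdvd =>
        h.smooth_of_dvd hd hdv hr (Or.inr (Or.inl hdvd)),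
      smoothPart_eq_self h.e_pos.ne' fun r hr hdvd => h.smooth_of_dvd hd hdv hr (Or.inl hdvd),
      smoothPart_eq_self hd fun r hr hdvd => h.smooth_of_dvd hd hdv hr (Or.inr (Or.inr hdvd))] at h1
  · rcases hr.dvd_mul.1 hdvd with h1 | h1
    · obtain ⟨i, _, hi⟩ := (hr.prime.dvd_finsetProd_iff _).1 h1
      exact le_of_prime_dvd_smoothPart hr hi
    · exact h.smooth_of_dvd hd hdv hr (Or.inr (Or.inl h1))
  · rw [ArithmeticFunction.cardFactors_mul hs0 h.f_pos.ne',
      cardFactors_prod _ _ fun i _ => smoothPart_ne_zero _ _]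
    push_cast
    have h1 : ∑ i, (ArithmeticFunction.cardFactors (smoothPart (v k) (p i - 1)) : ℝ) ≤
        ∑ _i : Fin k, 3 * logLog (v k) := Finset.sum_le_sum fun i _ =>
      ((h.normal i).1.normalValue_sub_one).cardFactors_smoothPart_le hw.exp_le (hw.le_v le_rfl)
    rw [Finset.sum_const, Finset.card_univ, Fintype.card_fin, nsmul_eq_mul] at h1
    have h2 := h.omega_f
    have h3 := one_le_logLog (hw.exp_le_v le_rfl)
    have h4 : 0 ≤ (k : ℝ) * logLog (v k) := by positivity
    linarith

end IsSieveSolution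

/-- The shifted form `(p - 1, q + 1, e, f)` of a solution `(p, q, e, f)`. -/
def shiftSolution {k : ℕ} (x : (Fin k → ℕ) × (Fin k → ℕ) × ℕ × ℕ) :
    (Fin k → ℕ) × (Fin k → ℕ) × ℕ × ℕ :=
  (fun i => x.1 i - 1, fun i => x.2.1 i + 1, x.2.2.1, x.2.2.2)

/-- The bound for one code is a constant times a weight of the smooth data times ∏ 1/r over the
assigned primes, and it does not depend on the pattern of special primes. So the sum over codes
splits into three independent factors. -/
theorem exists_card_sieveSolutions_le :
    ∃ C₁ C₂ c y₀ : ℝ, 1 ≤ C₁ ∧ 0 < C₂ ∧ 0 ≤ c ∧ ∀ (y S : ℝ) (k l d : ℕ) (hk : 1 ≤ k)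
      (u v μ ν : ℕ → ℝ) (δ : ℝ), y₀ ≤ y → SieveWindows y S k u v μ ν δ → d ≠ 0 →
      (largestPrimeFactor d : ℝ) ≤ v k →
      ((sieveSolutions y S k l d hk u v).ncard : ℝ) ≤
        C₁ * logLog y ^ 6 / Real.log y ^ 3 * y *
          (∏ i ∈ Finset.univ.erase (⟨0, hk⟩ : Fin k), C₁ * logLog y ^ 2 / Real.log (u i)) ^ 2 *
          (2 * (k : ℝ)) ^ (4 * k) *
          ((C₂ * Real.log (v k) * ((k : ℝ) + 1) ^ ArithmeticFunction.cardFactors d *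
            ((k : ℝ) + 1) ^ (2 * (4 * ((k : ℝ) + l) * logLog (v k))) / d) *
          (Real.exp (∑ j ∈ Finset.range k, ((j : ℝ) + 1) *
            ((ν j - ν (j + 1)) * logLog y + δ * logLog y) * Real.log ((j : ℝ) + 1)) *
           Real.exp (∑ j ∈ Finset.range k,
            ((j : ℝ) + 1) * ((ν j - ν (j + 1)) * logLog y + c)))) := by
  classical
  obtain ⟨C₁, y₀, hC₁, hfiber⟩ := exists_card_code_fiber_le
  obtain ⟨C₂, hC₂, hlow⟩ := exists_sum_low_le
  obtain ⟨c, hc, hmertens⟩ := exists_sum_one_div_prime_Ioc_le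
  refine ⟨C₁, C₂, c, y₀, hC₁, hC₂, hc, fun y S k l d hk u v μ ν δ hy hw hd hdv => ?_⟩
  set V := v k with hV
  set i₀ : Fin k := ⟨0, hk⟩ with hi₀
  have hfin := finite_sieveSolutions (y := y) (S := S) (l := l) (d := d) (hk := hk) (u := u) (v := v)
  set 𝓕 := hfin.toFinset.image shiftSolution with h𝓕
  have hcard : (sieveSolutions y S k l d hk u v).ncard = 𝓕.card := by
    rw [Set.ncard_eq_toFinset_card _ hfin, h𝓕, Finset.card_image_of_injOn]
    rintro ⟨p, q, e, f⟩ hx ⟨p', q', e', f'⟩ hx' heq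
    have hx : IsSieveSolution y S k l d hk u v p q e f := hfin.mem_toFinset.1 (Finset.mem_coe.1 hx)
    have hx' : IsSieveSolution y S k l d hk u v p' q' e' f' :=
      hfin.mem_toFinset.1 (Finset.mem_coe.1 hx')
    simp only [shiftSolution, Prod.mk.injEq, funext_iff] at heq
    refine Prod.ext (funext fun i => ?_) (Prod.ext (funext fun i => ?_)
      (Prod.ext heq.2.2.1 heq.2.2.2))
    · have h1 := heq.1 i
      have h2 := (hx.normal i).1.1.two_le
      have h3 := (hx'.normal i).1.1.two_le
      simp only at h1 ⊢
      omega
    · have h1 := heq.2.1 i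
      simp only at h1 ⊢
      omega
  have hmem : ∀ x ∈ 𝓕, ∃ p q : Fin k → ℕ, ∃ e f : ℕ, IsSieveSolution y S k l d hk u v p q e f ∧
      x = (fun i => p i - 1, fun i => q i + 1, e, f) := by
    intro x hx
    obtain ⟨⟨p, q, e, f⟩, hz, rfl⟩ := Finset.mem_image.1 hx
    exact ⟨p, q, e, f, hfin.mem_toFinset.1 hz, rfl⟩
  have hconf : ∀ x ∈ 𝓕, SieveConfig y V d (fun i : Fin k => u i) i₀ x.1 x.2.1 x.2.2.1 x.2.2.2 := by
    intro x hx
    obtain ⟨p, q, e, f, h, rfl⟩ := hmem x hx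
    exact h.sieveConfig hw hd hdv
  have hL := hw.one_le_L
  have hlogy : 0 < Real.log y :=
    Real.log_pos (by linarith [hw.exp_le_y, Real.add_one_le_exp (Real.exp 1), Real.exp_pos 1])
  have hy0 : 0 ≤ y := (Real.exp_pos _).le.trans hw.exp_le_y
  have hu : ∀ i : Fin k, i ≠ i₀ → Real.exp 1 ≤ u i := by
    intro i hi
    have h1 : (i : ℕ) ≠ 0 := fun h => hi (Fin.ext h)
    exact exp_one_le_exp_exp_one.trans ((hw.exp_le_v le_rfl).trans
      (hw.v_last_lt (Nat.one_le_iff_ne_zero.2 h1) i.2).le)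
  set K : ℝ := C₁ * logLog y ^ 6 / Real.log y ^ 3 * y *
    (∏ i ∈ Finset.univ.erase i₀, C₁ * logLog y ^ 2 / Real.log (u i)) ^ 2 with hK
  have hK0 : 0 ≤ K := by positivity
  have hmain := card_le_of_code_bounds 𝓕 (lowCode V) (assignment y V) specialPattern
    (fun t => ((d * t.2.2.2 * ∏ i, t.1 i : ℕ) : ℝ)⁻¹)
    (fun D => ∏ r : roughPrimes y V, (if D r = (none, none) then (1 : ℝ) else ((r : ℕ) : ℝ)⁻¹))
    K hK0 (fun t => by positivity) (fun D => Finset.prod_nonneg fun r _ => by positivity) (by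
      intro x hx
      have h1 := hfiber y hy V k d (fun i : Fin k => u i) i₀
        (𝓕.filter fun x' => lowCode V x' = lowCode V x ∧ assignment y V x' = assignment y V x ∧
          specialPattern x' = specialPattern x) (Nat.pos_of_ne_zero hd) hu
        (fun x' hx' => hconf x' (Finset.mem_filter.1 hx').1) (by
          intro z hz z' hz'
          obtain ⟨hz1, hz2, hz3, hz4⟩ := Finset.mem_filter.1 hz
          obtain ⟨hz1', hz2', hz3', hz4'⟩ := Finset.mem_filter.1 hz'
          exact codeEq_of_codes_eq (hconf z hz1) (hconf z' hz1') (hz2.trans hz2'.symm)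
            (hz3.trans hz3'.symm) (hz4.trans hz4'.symm))
        x (Finset.mem_filter.2 ⟨hx, rfl, rfl, rfl⟩)
      refine le_trans (le_of_eq (by congr!)) (h1.trans (le_of_eq ?_))
      have h2 := (hconf x hx).prod_assignment fun r => (r : ℝ)⁻¹
      rw [Finset.prod_inv_distrib] at h2
      have h3 : assignment y V (x.1, x.2.1, x.2.2.1, x.2.2.2) = assignment y V x := rfl
      rw [h3] at h2
      rw [h2, hK]
      simp only [lowCode]
      rw [div_eq_mul_inv y, mul_inv]
      ring)
  have hsumlow : ∑ t ∈ 𝓕.image (lowCode V), ((d * t.2.2.2 * ∏ i, t.1 i : ℕ) : ℝ)⁻¹ ≤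
      C₂ * Real.log V * ((k : ℝ) + 1) ^ ArithmeticFunction.cardFactors d *
            ((k : ℝ) + 1) ^ (2 * (4 * ((k : ℝ) + l) * logLog V)) / d := by
    refine hlow V _ k d _ (exp_one_le_exp_exp_one.trans (hw.exp_le_v le_rfl))
      (Nat.pos_of_ne_zero hd) ?_
    intro t ht
    obtain ⟨x, hx, rfl⟩ := Finset.mem_image.1 ht
    obtain ⟨p, q, e, f, h, rfl⟩ := hmem x hx
    exact h.low_spec hw hd hdv
  have hsumD := sum_prod_assignments_le (roughPrimes y V) k (windowLevel v k)
    (𝓕.image (assignment y V)) (Real.exp (∑ j ∈ Finset.range k, ((j : ℝ) + 1) *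
          ((ν j - ν (j + 1)) * logLog y + δ * logLog y) * Real.log ((j : ℝ) + 1)))
    (Real.exp_pos _).le (by
      intro D hD r
      obtain ⟨x, hx, rfl⟩ := Finset.mem_image.1 hD
      obtain ⟨p, q, e, f, h, rfl⟩ := hmem x hx
      obtain ⟨_, _, h3⟩ := hw.level_spec r.2
      have hr := (mem_roughPrimes.1 r.2).1.2
      rcases (h.sieveConfig hw hd hdv).assignment_cases r with ⟨h4, _⟩ | ⟨α, β, h4, h5, h6⟩
      · exact Or.inl h4
      · exact Or.inr ⟨α, β, h4, h.index_le_of_dvd hw hr h3 (Or.inl h5),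
          h.index_le_of_dvd hw hr h3 (Or.inr h6)⟩) (by
      intro D hD
      obtain ⟨x, hx, rfl⟩ := Finset.mem_image.1 hD
      obtain ⟨p, q, e, f, h, rfl⟩ := hmem x hx
      rw [(h.sieveConfig hw hd hdv).prod_assignment fun r => (windowLevel v k r : ℝ) + 1]
      exact h.prod_level_le hw)
  have hsumD' := hsumD.trans (mul_le_mul_of_nonneg_left
    (Real.exp_le_exp.2 (hw.sum_level_le hmertens)) (Real.exp_pos _).le)
  rw [hcard]
  refine hmain.trans (mul_le_mul (mul_le_mul_of_nonneg_left (card_specialPattern_le hk) hK0)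
    (mul_le_mul hsumlow hsumD' (Finset.sum_nonneg fun D _ => Finset.prod_nonneg fun r _ => by
      positivity) ?_) ?_ (by positivity))
  · exact le_trans (Finset.sum_nonneg fun t _ => by positivity) hsumlow
  · exact mul_nonneg (Finset.sum_nonneg fun t _ => by positivity)
      (Finset.sum_nonneg fun D _ => Finset.prod_nonneg fun r _ => by positivity)

/-! ### The main estimate -/

theorem sum_Icc_one_eq_sum_range (f : ℕ → ℝ) (m : ℕ) :
    ∑ i ∈ Finset.Icc 1 m, f i = ∑ j ∈ Finset.range m, f (j + 1) := by
  rw [show Finset.Icc 1 m = Finset.Ico 1 (m + 1) by ext; simp, Finset.sum_Ico_eq_sum_range]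
  exact Finset.sum_congr (by simp) fun j _ => by rw [add_comm]

theorem sum_Icc_two_eq_sum_range (f : ℕ → ℝ) (m : ℕ) :
    ∑ i ∈ Finset.Icc 2 (m + 1), f i = ∑ j ∈ Finset.range m, f (j + 2) := by
  rw [show Finset.Icc 2 (m + 1) = Finset.Ico 2 (m + 2) by ext; simp; omega,
    Finset.sum_Ico_eq_sum_range]
  exact Finset.sum_congr (by simp) fun j _ => by rw [add_comm]

/-- Summation by parts with the weights `n log n + n`. -/
theorem sum_weights_mul_sub (ν : ℕ → ℝ) (m : ℕ) :
    ∑ j ∈ Finset.range (m + 1),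
      (((j : ℝ) + 1) * Real.log ((j : ℝ) + 1) + ((j : ℝ) + 1)) * (ν j - ν (j + 1)) =
      ν 0 + ∑ i ∈ Finset.Icc 1 m, (simplexCoeff i + 2) * ν i -
        (((m : ℝ) + 1) * Real.log ((m : ℝ) + 1) + ((m : ℝ) + 1)) * ν (m + 1) := by
  rw [sum_Icc_one_eq_sum_range]
  induction m with
  | zero => simp
  | succ m ih =>
    -- With w_n = n log n + n, the increment w_{n+1} - w_n equals `simplexCoeff n` + 2.
    rw [Finset.sum_range_succ, ih, Finset.sum_range_succ _ m, simplexCoeff]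
    push_cast
    ring

/-- The two exponents combine into the weights (j+1) log(j+1) + (j+1), to which summation by parts
applies; the boundary term at ν_{m+1} has a favourable sign. The Mertens constant is absorbed in δ
log log y, except at j = 0, where the sum in E, which starts at i = 2, has no room; there it
survives as the additive c. -/
theorem SieveWindows.exponent_le {y S : ℝ} {m : ℕ} {u v μ ν : ℕ → ℝ} {δ c : ℝ}
    (h : SieveWindows y S (m + 1) u v μ ν δ) (hc : c ≤ δ * logLog y) :
    (∑ j ∈ Finset.range (m + 1), ((j : ℝ) + 1) *
        ((ν j - ν (j + 1)) * logLog y + δ * logLog y) * Real.log ((j : ℝ) + 1)) +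
      (∑ j ∈ Finset.range (m + 1), ((j : ℝ) + 1) * ((ν j - ν (j + 1)) * logLog y + c)) ≤
      c + logLog y * (1 + ∑ i ∈ Finset.Icc 1 m, (simplexCoeff i + 2) * ν i +
        δ * ∑ i ∈ Finset.Icc 2 (m + 1), ((i : ℝ) * Real.log i + i)) := by
  have hL := h.one_le_L
  have h1 := sum_weights_mul_sub ν m
  have hlast : 0 ≤ (((m : ℝ) + 1) * Real.log ((m : ℝ) + 1) + ((m : ℝ) + 1)) * ν (m + 1) := by
    have h2 := h.nu_pos le_rfl
    have h3 : 0 ≤ Real.log ((m : ℝ) + 1) :=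
      Real.log_nonneg (by linarith [Nat.cast_nonneg (α := ℝ) m])
    positivity
  rw [h.nu_zero] at h1
  have h2 : ∑ j ∈ Finset.range (m + 1),
      ((j : ℝ) + 1) * (δ * logLog y * Real.log ((j : ℝ) + 1) + c) ≤
      c + logLog y * (δ * ∑ i ∈ Finset.Icc 2 (m + 1), ((i : ℝ) * Real.log i + i)) := by
    rw [Finset.sum_range_succ', sum_Icc_two_eq_sum_range, ← mul_assoc, Finset.mul_sum, add_comm c]
    refine add_le_add (Finset.sum_le_sum fun j _ => ?_) (by simp)
    push_cast
    have h3 : (j : ℝ) + 1 + 1 = (j : ℝ) + 2 := by ring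
    rw [h3]
    have h4 : (0 : ℝ) ≤ (j : ℝ) + 2 := by positivity
    nlinarith [mul_le_mul_of_nonneg_left hc h4]
  have h3 : (∑ j ∈ Finset.range (m + 1), ((j : ℝ) + 1) *
        ((ν j - ν (j + 1)) * logLog y + δ * logLog y) * Real.log ((j : ℝ) + 1)) +
      (∑ j ∈ Finset.range (m + 1), ((j : ℝ) + 1) * ((ν j - ν (j + 1)) * logLog y + c)) =
      logLog y * (∑ j ∈ Finset.range (m + 1),
        (((j : ℝ) + 1) * Real.log ((j : ℝ) + 1) + ((j : ℝ) + 1)) * (ν j - ν (j + 1))) +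
      ∑ j ∈ Finset.range (m + 1), ((j : ℝ) + 1) * (δ * logLog y * Real.log ((j : ℝ) + 1) + c) := by
    rw [← Finset.sum_add_distrib, Finset.mul_sum, ← Finset.sum_add_distrib]
    exact Finset.sum_congr rfl fun j _ => by ring
  rw [h3, h1]
  have h4 : 0 ≤ logLog y := by linarith
  nlinarith [mul_nonneg h4 hlast]

theorem SieveWindows.prod_eq {y S : ℝ} {m : ℕ} {u v μ ν : ℕ → ℝ} {δ : ℝ}
    (h : SieveWindows y S (m + 1) u v μ ν δ) (B : ℝ) (hk : 0 < m + 1) :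
    ∏ i ∈ Finset.univ.erase (⟨0, hk⟩ : Fin (m + 1)), B / Real.log (u i) =
      B ^ m * Real.exp (-(logLog y * ∑ i ∈ Finset.Icc 1 m, μ i)) := by
  have h1 : ∀ i : Fin (m + 1), B / Real.log (u i) = B * Real.exp (-(logLog y * μ i)) := by
    intro i
    have h2 : 0 < Real.log (u i) := Real.log_pos (h.lower i i.2).1
    rw [mul_comm (logLog y), h.mu_mul, Real.exp_neg, logLog, Real.exp_log h2, div_eq_mul_inv]
  rw [Finset.prod_congr rfl fun i _ => h1 i, Finset.prod_mul_distrib, Finset.prod_const,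
    Finset.card_erase_of_mem (Finset.mem_univ _), Finset.card_univ, Fintype.card_fin,
    Nat.add_sub_cancel, ← Real.exp_sum, Finset.sum_neg_distrib, ← Finset.mul_sum,
    Finset.sum_erase_eq_sub (Finset.mem_univ _), Fin.sum_univ_eq_sum_range (fun i => μ i),
    Finset.sum_range_succ', sum_Icc_one_eq_sum_range]
  simp

/-- The power of L comes out as 6 + 4m + 2m = 6(m + 1): the last sieve, the other special primes,
and the pattern count, where k² ≤ 9L is used 2m times and the leftover k⁴ is at most 16^k. The
constant is 20736 = 256 · 81. -/
theorem constants_le {C₁ L : ℝ} {m : ℕ} (hC : 1 ≤ C₁) (hL : 0 ≤ L)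
    (hm : ((m : ℝ) + 1) ^ 2 ≤ 9 * L) :
    C₁ * L ^ 6 * ((C₁ * L ^ 2) ^ m) ^ 2 * (2 * ((m : ℝ) + 1)) ^ (4 * (m + 1)) ≤
      (20736 * C₁ * L) ^ (6 * (m + 1)) := by
  have h1 : ((m : ℝ) + 1) ^ 4 ≤ 16 ^ (m + 1) := by
    have h2 : (m : ℝ) + 1 ≤ 2 ^ (m + 1) := by
      have := (Nat.lt_two_pow_self (n := m + 1)).le
      exact_mod_cast this
    calc ((m : ℝ) + 1) ^ 4 ≤ (2 ^ (m + 1)) ^ 4 := pow_le_pow_left₀ (by positivity) h2 4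
      _ = (2 ^ 4) ^ (m + 1) := by rw [← pow_mul, ← pow_mul, mul_comm]
      _ = _ := by norm_num
  have h3 : (2 * ((m : ℝ) + 1)) ^ (4 * (m + 1)) ≤ 256 ^ (m + 1) * (9 * L) ^ (2 * m) := by
    calc (2 * ((m : ℝ) + 1)) ^ (4 * (m + 1))
        = (2 ^ 4) ^ (m + 1) * ((((m : ℝ) + 1) ^ 2) ^ (2 * m) * ((m : ℝ) + 1) ^ 4) := by
          rw [mul_pow, ← pow_mul, ← pow_mul, ← pow_add]
          congr 2
          ring
      _ ≤ (2 ^ 4) ^ (m + 1) * ((9 * L) ^ (2 * m) * 16 ^ (m + 1)) := by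
          refine mul_le_mul_of_nonneg_left (mul_le_mul (pow_le_pow_left₀ (by positivity) hm _) h1
            (by positivity) (by positivity)) (by positivity)
      _ = (2 ^ 4 * 16) ^ (m + 1) * (9 * L) ^ (2 * m) := by
          rw [mul_pow (2 ^ 4 : ℝ) 16]
          ring
      _ = _ := by norm_num
  have h4 : C₁ ^ (2 * m + 1) ≤ C₁ ^ (6 * (m + 1)) := pow_le_pow_right₀ hC (by omega)
  have h5 : (256 : ℝ) ^ (m + 1) ≤ 256 ^ (6 * (m + 1)) := pow_le_pow_right₀ (by norm_num) (by omega)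
  have h6 : (81 : ℝ) ^ m ≤ 81 ^ (6 * (m + 1)) := pow_le_pow_right₀ (by norm_num) (by omega)
  calc C₁ * L ^ 6 * ((C₁ * L ^ 2) ^ m) ^ 2 * (2 * ((m : ℝ) + 1)) ^ (4 * (m + 1))
      ≤ C₁ * L ^ 6 * ((C₁ * L ^ 2) ^ m) ^ 2 * (256 ^ (m + 1) * (9 * L) ^ (2 * m)) :=
        mul_le_mul_of_nonneg_left h3 (by positivity)
    _ = C₁ ^ (2 * m + 1) * 256 ^ (m + 1) * (9 ^ 2) ^ m * L ^ (6 * (m + 1)) := by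
        rw [mul_pow, mul_pow, mul_pow, ← pow_mul, ← pow_mul, ← pow_mul, ← pow_mul]
        ring
    _ = C₁ ^ (2 * m + 1) * 256 ^ (m + 1) * 81 ^ m * L ^ (6 * (m + 1)) := by norm_num
    _ ≤ C₁ ^ (6 * (m + 1)) * 256 ^ (6 * (m + 1)) * 81 ^ (6 * (m + 1)) * L ^ (6 * (m + 1)) := by
        gcongr
    _ = _ := by
        rw [← mul_pow, ← mul_pow, ← mul_pow]
        congr 1
        ring

theorem mainTheorem4 :
    ∃ c C y₀ : ℝ, 0 < c ∧ 0 < C ∧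
      ∀ (y S : ℝ) (k l d : ℕ) (hk : 1 ≤ k) (u v μ ν : ℕ → ℝ) (δ E : ℝ),
        y₀ ≤ y →
        1 ≤ d →
        Real.exp (Real.exp 1) ≤ S →
        S ≤ v k →
        (∀ j, j < k → v (j + 1) ≤ v j) →
        v 0 = y →
        (∀ j, j < k → 1 < u j ∧ u j ≤ v j) →
        δ = Real.sqrt (logLog S / logLog y) →
        (∀ j, ν j = logLog (v j) / logLog y) →
        (∀ j, μ j = logLog (u j) / logLog y) →
        E = δ * (∑ i ∈ Finset.Icc 2 k, ((i : ℝ) * Real.log (i : ℝ) + (i : ℝ))) +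
          2 * ∑ i ∈ Finset.Icc 1 (k - 1), (ν i - μ i) →
        (largestPrimeFactor d : ℝ) ≤ v k →
        (∀ j, 2 ≤ j → j ≤ k - 1 →
          (μ j = μ (j - 1) ∧ ν j = ν (j - 1)) ∨ ν j ≤ μ (j - 1) - 2 * δ) →
        ν k ≤ μ (k - 1) - 2 * δ →
        (∀ j, 1 ≤ j → j + 2 ≤ k → ν (j + 2) < ν j) →
        (sieveSolutions y S k l d hk u v).Finite ∧
        ((sieveSolutions y S k l d hk u v).ncard : ℝ) ≤
          C * (y / (d : ℝ)) * (c * logLog y) ^ (6 * k) *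
            ((k : ℝ) + 1) ^ (ArithmeticFunction.cardFactors d) *
            Real.log (v k) ^ (8 * ((k : ℝ) + (l : ℝ)) * Real.log ((k : ℝ) + 1) + 1) *
            Real.log y ^ (-2 + ∑ i ∈ Finset.Icc 1 (k - 1), simplexCoeff i * ν i + E) := by
  obtain ⟨C₁, C₂, c₀, y₀, hC₁, hC₂, hc₀, hcount⟩ := exists_card_sieveSolutions_le
  -- exp(c₀) pays for the Mertens constant of the window j = 0; the threshold for y makes log log y
  -- ≥ c₀², so that c₀ ≤ δ log log y in all other windows.
  refine ⟨20736 * C₁, C₂ * Real.exp c₀, max y₀ (Real.exp (Real.exp (c₀ ^ 2))), by positivity,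
    by positivity, ?_⟩
  intro y S k l d hk u v μ ν δ E hy hd hS hSv hv hv0 hu hδ hν hμ hE hdv hstep hlast hgap
  have hw : SieveWindows y S k u v μ ν δ := ⟨hS, hSv, hv, hv0, hu, hδ, hν, hμ, hstep, hlast, hgap⟩
  refine ⟨finite_sieveSolutions, ?_⟩
  obtain ⟨m, rfl⟩ : ∃ m, k = m + 1 := ⟨k - 1, by omega⟩
  have hmain := hcount y S (m + 1) l d hk u v μ ν δ ((le_max_left _ _).trans hy) hw (by omega) hdv
  have hL := hw.one_le_L
  have hy0 : 0 < y := (Real.exp_pos _).trans_le hw.exp_le_y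
  have hd0 : (0 : ℝ) < d := by exact_mod_cast hd
  have hlogy : 0 < Real.log y :=
    Real.log_pos (by linarith [hw.exp_le_y, Real.add_one_le_exp (Real.exp 1), Real.exp_pos 1])
  have hlogy' : Real.log y = Real.exp (logLog y) := (Real.exp_log hlogy).symm
  have hlogv : 0 < Real.log (v (m + 1)) := Real.log_pos (by
    linarith [hw.exp_le_v le_rfl, Real.add_one_le_exp (Real.exp 1), Real.exp_pos 1])
  have hc : c₀ ≤ δ * logLog y := by
    refine le_trans ?_ hw.sqrt_le_delta_mul
    have h1 : Real.exp (Real.exp (c₀ ^ 2)) ≤ y := (le_max_right _ _).trans hy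
    have h2 : Real.exp (c₀ ^ 2) ≤ Real.log y := (Real.le_log_iff_exp_le hy0).2 h1
    have h3 : c₀ ^ 2 ≤ logLog y := (Real.le_log_iff_exp_le hlogy).2 h2
    exact Real.le_sqrt_of_sq_le h3
  have hexp := hw.exponent_le hc
  rw [hw.prod_eq, ← Real.exp_add] at hmain
  simp only [Nat.add_sub_cancel] at hE ⊢
  have hlow : ((((m + 1 : ℕ) : ℝ)) + 1) ^ (2 * (4 * (((m + 1 : ℕ) : ℝ) + l) *
      logLog (v (m + 1)))) * Real.log (v (m + 1)) =
      Real.log (v (m + 1)) ^ (8 * (((m + 1 : ℕ) : ℝ) + l) *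
        Real.log (((m + 1 : ℕ) : ℝ) + 1) + 1) := by
    rw [Real.rpow_add_one hlogv.ne', Real.rpow_def_of_pos hlogv,
      Real.rpow_def_of_pos (by positivity), logLog]
    congr 2
    ring
  have hconst := constants_le hC₁ (by linarith : (0 : ℝ) ≤ logLog y)
    (by exact_mod_cast hw.sq_le)
  have hpow : Real.log y ^ 3 = Real.exp (3 * logLog y) := by
    rw [hlogy', ← Real.exp_nat_mul]
    norm_num
  -- The -3 of the last sieve and the 1 from ν_0 give -2. The surplus 2 ∑ ν_i from the weights meets
  -- -2 ∑ μ_i from the other special primes and forms the second half of E.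
  have hfinal : -(3 * logLog y) + 2 * (-(logLog y * ∑ i ∈ Finset.Icc 1 m, μ i)) +
      (logLog y * (1 + ∑ i ∈ Finset.Icc 1 m, (simplexCoeff i + 2) * ν i +
        δ * ∑ i ∈ Finset.Icc 2 (m + 1), ((i : ℝ) * Real.log i + i))) =
      logLog y * (-2 + ∑ i ∈ Finset.Icc 1 m, simplexCoeff i * ν i + E) := by
    have h1 : ∑ i ∈ Finset.Icc 1 m, (simplexCoeff i + 2) * ν i =
        ∑ i ∈ Finset.Icc 1 m, simplexCoeff i * ν i + 2 * ∑ i ∈ Finset.Icc 1 m, ν i := by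
      rw [Finset.mul_sum, ← Finset.sum_add_distrib]
      exact Finset.sum_congr rfl fun i _ => by ring
    rw [hE, h1, Finset.sum_sub_distrib]
    ring
  have hrpow : Real.log y ^ (-2 + ∑ i ∈ Finset.Icc 1 m, simplexCoeff i * ν i + E) =
      Real.exp (logLog y * (-2 + ∑ i ∈ Finset.Icc 1 m, simplexCoeff i * ν i + E)) := by
    rw [Real.rpow_def_of_pos hlogy, logLog]
  refine hmain.trans ?_
  set A := (∑ j ∈ Finset.range (m + 1), ((j : ℝ) + 1) *
        ((ν j - ν (j + 1)) * logLog y + δ * logLog y) * Real.log ((j : ℝ) + 1)) +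
      (∑ j ∈ Finset.range (m + 1), ((j : ℝ) + 1) * ((ν j - ν (j + 1)) * logLog y + c₀)) with hA
  set M := ∑ i ∈ Finset.Icc 1 m, μ i with hM
  set Q := logLog y * (1 + ∑ i ∈ Finset.Icc 1 m, (simplexCoeff i + 2) * ν i +
        δ * ∑ i ∈ Finset.Icc 2 (m + 1), ((i : ℝ) * Real.log i + i)) with hQ
  rw [hrpow, ← hfinal, ← hlow, hpow]
  set W := ((((m + 1 : ℕ) : ℝ)) + 1) ^ (2 * (4 * (((m + 1 : ℕ) : ℝ) + l) *
      logLog (v (m + 1)))) with hW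
  set O := ((((m + 1 : ℕ) : ℝ)) + 1) ^ ArithmeticFunction.cardFactors d with hO
  have hW0 : 0 ≤ W := by positivity
  have hO0 : 0 ≤ O := by positivity
  push_cast
  have hee : Real.exp (-(3 * logLog y)) * Real.exp (-(logLog y * M)) ^ 2 * Real.exp A ≤
      Real.exp c₀ * Real.exp (-(3 * logLog y) + 2 * (-(logLog y * M)) + Q) := by
    rw [← Real.exp_nat_mul, ← Real.exp_add, ← Real.exp_add, ← Real.exp_add]
    refine Real.exp_le_exp.2 ?_
    push_cast
    linarith
  calc _ = (C₁ * logLog y ^ 6 * ((C₁ * logLog y ^ 2) ^ m) ^ 2 *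
        (2 * ((m : ℝ) + 1)) ^ (4 * (m + 1))) *
        (Real.exp (-(3 * logLog y)) * Real.exp (-(logLog y * M)) ^ 2 * Real.exp A) *
        (C₂ * (y / d) * O * (W * Real.log (v (m + 1)))) := by
        rw [Real.exp_neg (3 * logLog y)]
        ring
    _ ≤ (20736 * C₁ * logLog y) ^ (6 * (m + 1)) *
        (Real.exp c₀ * Real.exp (-(3 * logLog y) + 2 * (-(logLog y * M)) + Q)) *
        (C₂ * (y / d) * O * (W * Real.log (v (m + 1)))) := by
        refine mul_le_mul_of_nonneg_right (mul_le_mul hconst hee (by positivity) (by positivity))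
          (by positivity)
    _ = _ := by ring
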